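/- **Theorem.** Let $d\ge 3$, $1\le m\le d-2$, $r\ge 0$ be integers and $\alpha>0$. Let $g:\mathbb R^d\to\mathbb R$ be homogeneous of order $\alpha$, i.e. $g(tv)=t^\alpha g(v)$ for all $t>0$, $v\in\mathbb R^d$, positive at some point, and of class $C^{2r+2}$ on $\mathbb R^d\setminus\{0\}$. Put $$\hat g=\max_{\|v\|=1}g(v),\qquad \mathcal M=\{v\in\mathbb R^d:\ \|v\|=1,\ g(v)=\hat g\},$$ and assume that the (compact) set $\mathcal M$ is an $m$-dimensional submanifold of class $C^{2r+2}$ without boundary. For $v\in\mathcal M$ choose an orthonormal basis $u_1,\dots,u_{d-1}$ of the hyperplane $v^{\perp}$, let $g''_{d-1}(v)$ be the Hessian matrix at $t=0$ of $t\mapsto g(v+t_1u_1+\dots+t_{d-1}u_{d-1})$, and put $$A_{d-1}(v)=\frac{g''_{d-1}(v)}{\alpha\hat g}-I_{d-1}.$$ Assume that $A_{d-1}(v)$ has rank $d-1-m$ for every $v\in\mathcal M$, and let $D(v)$ be the product of its $d-1-m$ non-zero eigenvalues, counted with multiplicity (equivalently, its non-zero $(d-1-m)$-minor after an orthogonal change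 of basis that turns $A_{d-1}(v)$ into an invertible $(d-1-m)\times(d-1-m)$ block bordered by zeros). Put $$h_0=\frac1{(2\pi)^{(m+1)/2}}\int_{\mathcal M}|D(v)|^{-1/2}\,dV(v),$$ where $dV$ is the $m$-dimensional volume on $\mathcal M$; the integral converges. Let $\eta=(\eta_1,\dots,\eta_d)$ have independent standard normal coordinates. Then, as $x\to\infty$, $$\mathbb P\{g(\eta)>x\}=(x/\hat g)^{\frac{m-1}{\alpha}}e^{-(x/\hat g)^{2/\alpha}/2}\Bigl(h_0+\sum_{i=1}^r h_i x^{-2i/\alpha}+o(x^{-2r/\alpha})\Bigr),$$ where, for given $d,m,r$, the coefficients $h_1,\dots,h_r\in\mathbb R$ depend only on $\alpha$, $\hat g$ and the derivatives, of orders up to $2r+2$, of the angular function $v\mapsto g(v/\|v\|)$ at the points of $\mathcal M$. Moreover, the distribution of $g(\eta)$ restricted to $\mathbb R\setminus\{0\}$ has a density $p_{g(\eta)}$ that is continuous on $(0,\infty)$, and there are $\tilde h_1,\dots,\tilde h_r\in\mathbb R$ such that, as $x\to\infty$, $$p_{g(\eta)}(x)=(x/\hat g)^{\frac{m+1}{\alpha}-1}e^{-(x/\hat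 g)^{2/\alpha}/2}\Bigl(\frac{h_0}{\alpha\hat g}+\sum_{i=1}^r\tilde h_i x^{-2i/\alpha}+o(x^{-2r/\alpha})\Bigr).$$ -/

import Mathlib

open MeasureTheory ProbabilityTheory Filter Topology Asymptotics

namespace GaussianChaos

/-- The space `ℝ^d` with its Euclidean norm. -/
abbrev E (d : ℕ) : Type := EuclideanSpace ℝ (Fin d)

/-- `g` is homogeneous of order `α`: `g (t x) = t ^ α g x` for all `t > 0`. -/
def Homogeneous {d : ℕ} (g : E d → ℝ) (α : ℝ) : Prop :=
  ∀ (t : ℝ) (x : E d), 0 < t → g (t • x) = t ^ α * g x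

/-- The maximum of `g` on the unit sphere. -/
noncomputable def sphereMax {d : ℕ} (g : E d → ℝ) : ℝ :=
  sSup (g '' Metric.sphere (0 : E d) 1)

/-- The set of points of the unit sphere where `g` attains its maximum on the sphere. -/
def maxSet {d : ℕ} (g : E d → ℝ) : Set (E d) :=
  {v | v ∈ Metric.sphere (0 : E d) 1 ∧ g v = sphereMax g}

/-- `M` is an (embedded) `m`-dimensional submanifold of `ℝ^d`, of class `C^n`, without boundary:
around each of its points there is a `C^n` diffeomorphism between open subsets of `ℝ^d` and of
`ℝ^m × ℝ^(d-m)` that takes `M` to `ℝ^m × {0}`. -/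
def IsSubmanifold {d : ℕ} (n m : ℕ) (M : Set (E d)) : Prop :=
  ∀ v ∈ M, ∃ e : OpenPartialHomeomorph (E d) (E m × E (d - m)),
    v ∈ e.source ∧ ContDiffOn ℝ n e e.source ∧ ContDiffOn ℝ n e.symm e.target ∧
      ∀ w ∈ e.source, w ∈ M ↔ (e w).2 = 0

/-- The Hessian matrix `∂²f / ∂tᵢ ∂tⱼ` at the point `t`. -/
noncomputable def hessian {n : ℕ} (f : (Fin n → ℝ) → ℝ) (t : Fin n → ℝ) :
    Matrix (Fin n) (Fin n) ℝ :=
  Matrix.of fun i j =>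
    fderiv ℝ (fun s => fderiv ℝ f s (Pi.single j 1)) t (Pi.single i 1)

/-- `u₁, …, u_{d-1}` is an orthonormal basis of the hyperplane orthogonal to the
unit vector `v` of `ℝ^d`. -/
def IsTangentFrame {d : ℕ} (v : E d) (u : Fin (d - 1) → E d) : Prop :=
  Orthonormal ℝ u ∧ ∀ i, inner ℝ v (u i) = 0

/-- The Hessian matrix at `v` of `g` restricted to the hyperplane tangent to the sphere at `v`, in
the coordinates `t ↦ v + t₁ u₁ + ⋯ + t_{d-1} u_{d-1}`. -/
noncomputable def tangentHessian {d : ℕ} (g : E d → ℝ) (v : E d) (u : Fin (d - 1) → E d) :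
    Matrix (Fin (d - 1)) (Fin (d - 1)) ℝ :=
  hessian (fun t => g (v + ∑ i, t i • u i)) 0

/-- The matrix `g''_{d-1}(v) / (α ĝ) - I_{d-1}`. -/
noncomputable def matA {d : ℕ} (g : E d → ℝ) (α : ℝ) (v : E d) (u : Fin (d - 1) → E d) :
    Matrix (Fin (d - 1)) (Fin (d - 1)) ℝ :=
  (sphereMax g * α)⁻¹ • tangentHessian g v u - 1

/-- The product of the non-zero eigenvalues (with multiplicity) of a real symmetric matrix. If the
matrix has rank `k`, then this is its non-zero `k`-minor after an orthogonal change of basis that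
turns it into an invertible `k × k` block bordered by zeros, see `nonzeroMinor_eq_det`. -/
noncomputable def nonzeroMinor {n : ℕ} (A : Matrix (Fin n) (Fin n) ℝ) : ℝ :=
  (A.charpoly.roots.filter (fun x => x ≠ 0)).prod

theorem nonzeroMinor_eq_det {n k l : ℕ} (A Q : Matrix (Fin n) (Fin n) ℝ) (hA : A.IsSymm)
    (hQ : Q ∈ Matrix.orthogonalGroup (Fin n) ℝ) (s : Fin n ≃ Fin k ⊕ Fin l)
    (B : Matrix (Fin k) (Fin k) ℝ) (hB : B.det ≠ 0)
    (h : Matrix.reindex s s (Q * A * Q.transpose) = Matrix.fromBlocks B 0 0 0) :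
    nonzeroMinor A = B.det := by
  have hQ1 : Q.transpose * Q = 1 := (Matrix.mem_orthogonalGroup_iff' (Fin n) ℝ).1 hQ
  have h1 : A.charpoly = B.charpoly * Polynomial.X ^ l := by
    have e1 : (Q * A * Q.transpose).charpoly = A.charpoly := by
      rw [Matrix.charpoly_mul_comm, ← mul_assoc, hQ1, one_mul]
    rw [← e1, ← Matrix.charpoly_reindex s, h, Matrix.charpoly_fromBlocks_zero₁₂,
      Matrix.charpoly_zero, Fintype.card_fin]
  have hS : (Matrix.fromBlocks B 0 0 (0 : Matrix (Fin l) (Fin l) ℝ)).IsSymm := by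
    rw [← h]
    refine Matrix.IsSymm.reindex ?_ s
    simp only [Matrix.IsSymm, Matrix.transpose_mul, Matrix.transpose_transpose, hA.eq, mul_assoc]
  have hBs : B.IsHermitian := by
    have hB1 := (Matrix.isSymm_fromBlocks_iff.1 hS).1
    rw [Matrix.IsHermitian, Matrix.conjTranspose_eq_transpose_of_trivial]
    exact hB1
  have hdet := Matrix.det_eq_prod_roots_charpoly_of_splits hBs.splits_charpoly
  have hne : ∀ x ∈ B.charpoly.roots, x ≠ 0 := by
    rintro x hx rfl
    exact hB (hdet ▸ Multiset.prod_eq_zero hx)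
  have hz : B.charpoly * Polynomial.X ^ l ≠ 0 :=
    mul_ne_zero (Matrix.charpoly_monic B).ne_zero (pow_ne_zero _ Polynomial.X_ne_zero)
  rw [nonzeroMinor, h1, Polynomial.roots_mul hz, Multiset.filter_add,
    Multiset.filter_eq_self.2 hne, Polynomial.roots_X_pow, Multiset.filter_eq_nil.2, add_zero,
    ← hdet]
  intro x hx
  rw [Multiset.nsmul_singleton] at hx
  simpa using Multiset.eq_of_mem_replicate hx

/-- The integrand of the leading constant: the absolute value of the non-zero `(d-1-m)`-minor to
the power `-1/2`. -/
noncomputable def leadingIntegrand {d : ℕ} (g : E d → ℝ) (α : ℝ) (u : E d → Fin (d - 1) → E d)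
    (v : E d) : ℝ :=
  |nonzeroMinor (matA g α v (u v))| ^ (-(1 / 2) : ℝ)

/-- The leading constant `h₀`; `μHE[m]` is the `m`-dimensional Hausdorff measure, normalized to be
the Lebesgue measure on `ℝ^m`, so that it is the volume on an `m`-dimensional submanifold. -/
noncomputable def leadingConst {d : ℕ} (g : E d → ℝ) (α : ℝ) (m : ℕ)
    (u : E d → Fin (d - 1) → E d) : ℝ :=
  1 / (2 * Real.pi) ^ (((m : ℝ) + 1) / 2) * ∫ v in maxSet g, leadingIntegrand g α u v ∂μHE[m]

/-- A jet of order `N`: a point together with the values of derivatives of orders `0, …, N`. -/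
abbrev Jet (d N : ℕ) : Type :=
  E d × ((k : Fin (N + 1)) → ContinuousMultilinearMap ℝ (fun _ : Fin k => E d) ℝ)

/-- The angular function `v ↦ g (v / ‖v‖)`. -/
noncomputable def angular {d : ℕ} (g : E d → ℝ) (v : E d) : ℝ := g (‖v‖⁻¹ • v)

/-- The derivatives, of orders `0, …, N`, of the angular function of `g` at all points where `g` is
maximal on the sphere, as the graph of a function on this set. -/
noncomputable def angularJets {d : ℕ} (N : ℕ) (g : E d → ℝ) : Set (Jet d N) :=
  (fun v => (v, fun k => iteratedFDeriv ℝ k (angular g) v)) '' maxSet g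

/-- `p` is a density of the real random variable `X` on `ℝ \ {0}`, in the version that is continuous
on `(0, ∞)`. -/
def IsDensityOffZero {Ω : Type*} [MeasurableSpace Ω] (P : Measure Ω) (X : Ω → ℝ)
    (p : ℝ → ℝ) : Prop :=
  Measurable p ∧ (∀ x, 0 ≤ p x) ∧ ContinuousOn p (Set.Ioi 0) ∧
    (P.map X).restrict {0}ᶜ = volume.withDensity (fun x => ENNReal.ofReal (p x))

/-- As `x → ∞`,
`F x = (x / ĝ) ^ β e^{-(x / ĝ) ^ (2 / α) / 2} (c₀ + ∑_{i=1}^r cᵢ x ^ (-2 i / α) + o(x ^ (-2 r / α)))`. -/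
def HasChaosExpansion (F : ℝ → ℝ) (α gmax β : ℝ) (r : ℕ) (c₀ : ℝ) (c : ℕ → ℝ) : Prop :=
  ∃ ρ : ℝ → ℝ, ρ =o[atTop] (fun x : ℝ => x ^ (-(2 * (r : ℝ)) / α)) ∧
    ∀ᶠ x in atTop, F x = (x / gmax) ^ β * Real.exp (-(x / gmax) ^ (2 / α) / 2) *
      (c₀ + ∑ i ∈ Finset.Icc 1 r, c i * x ^ (-(2 * (i : ℝ)) / α) + ρ x)

end GaussianChaos

/-! In polar coordinates the density of `g(η)` at `x > 0` is an integral over the sphere of a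
function of `x / g(v)` (`withDensity_preimage_eq`), which for large `x` concentrates where `g` is
maximal. To avoid doing Laplace's method on the sphere, an artificial radius is added: multiplying
by the Gaussian integral of `exp(-l log² t / 2) dt/t` gives an integral of `amplitude * exp(-l *
phase)` over an open cone of `ℝ^d`, with `l = (x/ĝ)^(2/α)`. The phase is nonnegative and vanishes
exactly on the set `M` of maximum points (`chaosDensity_eq`, `phase_eq_zero_iff`).

In a chart `M` becomes `ℝ^m × {0}`. Put `l = t⁻²` and rescale the normal variable, `z = tζ`. The
integrand then has a Taylor expansion in `t` whose remainder is dominated by a polynomial in `‖ζ‖`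
times a Gaussian (`scaledIntegrand_taylor`), so it may be integrated term by term. The integral is
even in `t`, hence only integral powers of `1/l` survive (`exists_hasAsymptotics_laplace`). The
leading coefficient is a Gaussian integral along the fibre. It produces the determinant of the
normal Hessian and cancels the normal part of the Jacobian of the chart; the area formula turns the
tangential part into the volume of `M` (`exists_local_laplace`). A partition of unity makes this
global.

Homogeneity identifies the Hessian of the phase at `v ∈ M`: it is `1` in the direction `v` and `-A`
on the tangent hyperplane (`isLittleO_phase`). Since the phase is nonnegative, `-A` is positive
semidefinite, and the rank hypothesis makes it nondegenerate normally to `M`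
(`hasNormalHessian_phase`). This gives the expansion of the density. For the tail, the substitution
`y = ĝ w^(α/2)` leads to incomplete Gamma integrals, which are expanded by repeated integration by
parts (`gammaTail_recursion`).

That the coefficients depend only on jets is proved without computing them. If two functions share
`α`, `ĝ` and the jets on `M`, their phases differ by `o(dist(z, M)^(2r+2))`. The squared distance is
`O(phase)`, so the difference is `o(phase^(r+1))` and changes the normalized Laplace integral by
`o(l^(-r))` only (`isLittleO_sub`). An expansion valid for one function is thus valid for the other,
and the coefficients can be chosen as a function of the jets (`laplaceCoeff`). -/

namespace GaussianChaos

/-! ### Taylor's formula -/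

/-- Taylor's formula whose remainder is bounded by the oscillation of the highest derivative. -/
theorem abs_sub_taylor_le {V : Type*} [NormedAddCommGroup V] [NormedSpace ℝ V] {f : V → ℝ}
    {x y : V} {N : ℕ} {ε : ℝ} (hf : ∀ s ∈ Set.Icc (0 : ℝ) 1, ContDiffAt ℝ N f (x + s • y))
    (hε : ∀ s ∈ Set.Icc (0 : ℝ) 1,
      ‖iteratedFDeriv ℝ N f (x + s • y) - iteratedFDeriv ℝ N f x‖ ≤ ε) :
    |f (x + y) - ∑ k ∈ Finset.range (N + 1),
      (k.factorial : ℝ)⁻¹ * iteratedFDeriv ℝ k f x (fun _ => y)| ≤ ε * ‖y‖ ^ N := by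
  have hterm : ∀ s ∈ Set.Icc (0 : ℝ) 1, |iteratedFDeriv ℝ N f (x + s • y) (fun _ => y) -
      iteratedFDeriv ℝ N f x (fun _ => y)| ≤ ε * ‖y‖ ^ N := by
    intro s hs
    have h1 := (iteratedFDeriv ℝ N f (x + s • y) - iteratedFDeriv ℝ N f x).le_opNorm (fun _ => y)
    simp only [sub_apply, Finset.prod_const, Finset.card_univ,
      Fintype.card_fin, Real.norm_eq_abs] at h1
    exact h1.trans (by gcongr; exact hε s hs)
  -- The integral form of the remainder needs a positive order; for order zero the claim is the
  -- hypothesis at `s = 1`.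
  rcases N with _ | n
  · have h := hterm 1 (by simp)
    simpa using h
  · rw [map_add_eq_sum_add_integral_iteratedFDeriv (f := f) (x := x) (y := y) (n := n)
        (by exact_mod_cast hf),
      Finset.sum_range_succ _ (n + 1)]
    simp only [smul_eq_mul]
    set D : ℝ → ℝ := fun s => iteratedFDeriv ℝ (n + 1) f (x + s • y) (fun _ => y) with hD
    have hDc : ContinuousOn D (Set.uIcc (0 : ℝ) 1) := by
      intro t ht
      rw [Set.uIcc_of_le zero_le_one] at ht
      have h_cont : ContinuousAt (iteratedFDeriv ℝ (n + 1) f) (x + t • y) :=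
        ((hf t ht).iteratedFDeriv_right (i := n + 1) (m := 0) (by simp)).continuousAt
      exact (h_cont.comp (x := t) (by fun_prop)).continuousWithinAt.eval_const _
    have hint : ∫ t in (0 : ℝ)..1, (1 - t) ^ n = ((n : ℝ) + 1)⁻¹ := by
      rw [intervalIntegral.integral_comp_sub_left (fun t => t ^ n)]
      simp
    have hi1 : IntervalIntegrable (fun t : ℝ => (1 - t) ^ n * D t) volume 0 1 :=
      (ContinuousOn.mul (by fun_prop) hDc).intervalIntegrable
    have hi2 : IntervalIntegrable (fun t : ℝ => (1 - t) ^ n * D 0) volume 0 1 :=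
      (Continuous.intervalIntegrable (by fun_prop) _ _)
    have hi3 : IntervalIntegrable (fun t : ℝ => (1 - t) ^ n * (ε * ‖y‖ ^ (n + 1))) volume 0 1 :=
      (Continuous.intervalIntegrable (by fun_prop) _ _)
    have hD0 : iteratedFDeriv ℝ (n + 1) f x (fun _ => y) = D 0 := by simp [hD]
    -- The last Taylor term is written with the kernel of the integral remainder, so that the
    -- difference of the two is an integral of the oscillation `D t - D 0`.
    have hkey : ((n + 1).factorial : ℝ)⁻¹ * D 0 =
        (n.factorial : ℝ)⁻¹ * ∫ t in (0 : ℝ)..1, (1 - t) ^ n * D 0 := by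
      rw [intervalIntegral.integral_mul_const, hint, Nat.factorial_succ]
      push_cast
      rw [mul_inv]; ring
    rw [hD0, hkey, add_sub_add_left_eq_sub, ← mul_sub, ← intervalIntegral.integral_sub hi1 hi2]
    have hb : |∫ t in (0 : ℝ)..1, ((1 - t) ^ n * D t - (1 - t) ^ n * D 0)| ≤
        ∫ t in (0 : ℝ)..1, (1 - t) ^ n * (ε * ‖y‖ ^ (n + 1)) := by
      rw [← Real.norm_eq_abs]
      refine intervalIntegral.norm_integral_le_of_norm_le zero_le_one ?_ hi3
      refine Eventually.of_forall fun t ht => ?_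
      have ht' : t ∈ Set.Icc (0 : ℝ) 1 := ⟨ht.1.le, ht.2⟩
      have h0 : 0 ≤ (1 - t) ^ n := pow_nonneg (by linarith [ht.2]) _
      rw [← mul_sub, norm_mul, Real.norm_of_nonneg h0]
      refine mul_le_mul_of_nonneg_left ?_ h0
      rw [← hD0]
      exact hterm t ht'
    rw [intervalIntegral.integral_mul_const, hint] at hb
    rw [abs_mul, abs_of_nonneg (by positivity)]
    have hpos : 0 ≤ ε * ‖y‖ ^ (n + 1) := (abs_nonneg _).trans (hterm 0 (by simp))
    have hfac : (1 : ℝ) ≤ n.factorial := by exact_mod_cast n.factorial_pos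
    calc (n.factorial : ℝ)⁻¹ * _ ≤ 1 * (1 * (ε * ‖y‖ ^ (n + 1))) := by
          refine mul_le_mul (inv_le_one_of_one_le₀ hfac) (hb.trans ?_) (abs_nonneg _) zero_le_one
          refine mul_le_mul_of_nonneg_right ?_ hpos
          exact inv_le_one_of_one_le₀ (by linarith [(Nat.cast_nonneg n : (0 : ℝ) ≤ n)])
      _ = _ := by ring


/-! ### Taylor expansions with polynomially growing coefficients and remainders -/

section DominatedTaylor

variable {Y Z : Type*} [NormedAddCommGroup Y] [NormedAddCommGroup Z]

/-- Continuous functions of polynomial growth in the second variable, uniformly for the first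
variable in `K`. -/
def polyGrowth (K : Set Y) : Subalgebra ℝ (Y × Z → ℝ) where
  carrier := {c | Continuous c ∧ ∃ C : ℝ, ∃ l : ℕ, 0 ≤ C ∧
    ∀ p : Y × Z, p.1 ∈ K → |c p| ≤ C * (1 + ‖p.2‖) ^ l}
  mul_mem' := by
    rintro a b ⟨ha, C, l, hC, h⟩ ⟨hb, C', l', hC', h'⟩
    refine ⟨ha.mul hb, C * C', l + l', by positivity, fun p hp => ?_⟩
    rw [Pi.mul_apply, abs_mul]
    calc |a p| * |b p| ≤ (C * (1 + ‖p.2‖) ^ l) * (C' * (1 + ‖p.2‖) ^ l') :=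
          mul_le_mul (h p hp) (h' p hp) (abs_nonneg _) (by positivity)
      _ = _ := by ring
  add_mem' := by
    rintro a b ⟨ha, C, l, hC, h⟩ ⟨hb, C', l', hC', h'⟩
    refine ⟨ha.add hb, C + C', l + l', by positivity, fun p hp => ?_⟩
    rw [Pi.add_apply]
    have h1 : (1 : ℝ) ≤ 1 + ‖p.2‖ := by linarith [norm_nonneg p.2]
    calc |a p + b p| ≤ |a p| + |b p| := abs_add_le _ _
      _ ≤ C * (1 + ‖p.2‖) ^ (l + l') + C' * (1 + ‖p.2‖) ^ (l + l') := by
          refine add_le_add ((h p hp).trans ?_) ((h' p hp).trans ?_)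
          · gcongr
            · omega
          · gcongr
            · omega
      _ = _ := by ring
  algebraMap_mem' := by
    intro r
    refine ⟨continuous_const, |r|, 0, abs_nonneg _, fun p _ => ?_⟩
    simp [Pi.algebraMap_apply]

variable {K : Set Y}

/-- The value at `(p, t)` of a polynomial in `t` with coefficients in `polyGrowth K`. -/
noncomputable def polyVal (P : Polynomial (polyGrowth (Z := Z) K)) (p : Y × Z) (t : ℝ) : ℝ :=
  (P.eval (algebraMap ℝ (polyGrowth (Z := Z) K) t) : polyGrowth (Z := Z) K).1 p

theorem polyVal_eq_sum (P : Polynomial (polyGrowth (Z := Z) K)) (p : Y × Z) (t : ℝ) :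
    polyVal P p t = ∑ j ∈ Finset.range (P.natDegree + 1), (P.coeff j).1 p * t ^ j := by
  rw [polyVal, Polynomial.eval_eq_sum_range]
  simp [Finset.sum_apply]

theorem polyVal_mul (P Q : Polynomial (polyGrowth (Z := Z) K)) (p : Y × Z) (t : ℝ) :
    polyVal (P * Q) p t = polyVal P p t * polyVal Q p t := by
  simp [polyVal]

theorem polyVal_add (P Q : Polynomial (polyGrowth (Z := Z) K)) (p : Y × Z) (t : ℝ) :
    polyVal (P + Q) p t = polyVal P p t + polyVal Q p t := by
  simp [polyVal]

theorem continuous_polyVal (P : Polynomial (polyGrowth (Z := Z) K)) (p : Y × Z) :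
    Continuous (polyVal P p) := by
  have : polyVal P p =
      fun t => ∑ j ∈ Finset.range (P.natDegree + 1), (P.coeff j).1 p * t ^ j := by
    ext t; exact polyVal_eq_sum P p t
  rw [this]; fun_prop

/-- The sum of the absolute values of the coefficients lies again in `polyGrowth K`, and it
dominates the polynomial for `|t| ≤ 1`. -/
theorem exists_abs_polyVal_le (P : Polynomial (polyGrowth (Z := Z) K)) :
    ∃ C : ℝ, ∃ l : ℕ, 0 ≤ C ∧ ∀ p : Y × Z, p.1 ∈ K → ∀ t : ℝ, |t| ≤ 1 →
      |polyVal P p t| ≤ C * (1 + ‖p.2‖) ^ l := by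
  have hmem : (fun p => ∑ j ∈ Finset.range (P.natDegree + 1), |(P.coeff j).1 p|) ∈
      polyGrowth (Z := Z) K := by
    have : (fun p => ∑ j ∈ Finset.range (P.natDegree + 1), |(P.coeff j).1 p|) =
      ∑ j ∈ Finset.range (P.natDegree + 1), (fun p => |(P.coeff j).1 p|) := by
      ext p; simp
    rw [this]
    refine Subalgebra.sum_mem _ fun j _ => ?_
    obtain ⟨h1, C, l, hC, h2⟩ := (P.coeff j).2
    exact ⟨h1.abs, C, l, hC, fun p hp => by simpa using h2 p hp⟩
  obtain ⟨-, C, l, hC, h⟩ := hmem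
  refine ⟨C, l, hC, fun p hp t ht => ?_⟩
  refine le_trans ?_ ((le_abs_self _).trans (h p hp))
  rw [polyVal_eq_sum]
  refine (Finset.abs_sum_le_sum_abs _ _).trans (Finset.sum_le_sum fun j _ => ?_)
  rw [abs_mul, abs_pow]
  exact mul_le_of_le_one_right (abs_nonneg _) (pow_le_one₀ (abs_nonneg _) ht)

/-- `F p t` has a Taylor polynomial of order `n` in `t` at `0`, with a remainder that has
polynomial growth as long as `|t| ‖p.2‖ ≤ ρ`. -/
def HasDominatedTaylor (K : Set Y) (n : ℕ) (ρ : ℝ) (F : Y × Z → ℝ → ℝ)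
    (P : Polynomial (polyGrowth (Z := Z) K)) : Prop :=
  (∀ p : Y × Z, p.1 ∈ K → (fun t => F p t - polyVal P p t) =o[𝓝[≠] 0] fun t : ℝ => t ^ n) ∧
  ∃ C : ℝ, ∃ l : ℕ, 0 ≤ C ∧ ∀ p : Y × Z, p.1 ∈ K → ∀ t : ℝ, t ≠ 0 → |t| ≤ 1 → |t| * ‖p.2‖ ≤ ρ →
    |F p t - polyVal P p t| ≤ C * (1 + ‖p.2‖) ^ l * |t| ^ n

variable {n : ℕ} {ρ : ℝ} {F G : Y × Z → ℝ → ℝ} {P Q : Polynomial (polyGrowth (Z := Z) K)}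

theorem HasDominatedTaylor.exists_abs_le (hF : HasDominatedTaylor K n ρ F P) :
    ∃ C : ℝ, ∃ l : ℕ, 0 ≤ C ∧ ∀ p : Y × Z, p.1 ∈ K → ∀ t : ℝ, t ≠ 0 → |t| ≤ 1 → |t| * ‖p.2‖ ≤ ρ →
      |F p t| ≤ C * (1 + ‖p.2‖) ^ l := by
  obtain ⟨-, C, l, hC, h⟩ := hF
  obtain ⟨C', l', hC', h'⟩ := exists_abs_polyVal_le P
  refine ⟨C + C', l + l', by positivity, fun p hp t ht0 ht1 ht => ?_⟩
  have h1 : (1 : ℝ) ≤ 1 + ‖p.2‖ := by linarith [norm_nonneg p.2]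
  calc |F p t| = |(F p t - polyVal P p t) + polyVal P p t| := by ring_nf
    _ ≤ |F p t - polyVal P p t| + |polyVal P p t| := abs_add_le _ _
    _ ≤ C * (1 + ‖p.2‖) ^ l * 1 + C' * (1 + ‖p.2‖) ^ l' := by
        refine add_le_add ((h p hp t ht0 ht1 ht).trans ?_) (h' p hp t ht1)
        gcongr
        exact pow_le_one₀ (abs_nonneg _) ht1
    _ ≤ C * (1 + ‖p.2‖) ^ (l + l') + C' * (1 + ‖p.2‖) ^ (l + l') := by
        rw [mul_one]
        gcongr
        · omega
        · omega
    _ = _ := by ring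

theorem HasDominatedTaylor.add (hF : HasDominatedTaylor K n ρ F P)
    (hG : HasDominatedTaylor K n ρ G Q) :
    HasDominatedTaylor K n ρ (fun p t => F p t + G p t) (P + Q) := by
  refine ⟨fun p hp => ?_, ?_⟩
  · refine ((hF.1 p hp).add (hG.1 p hp)).congr_left fun t => ?_
    rw [polyVal_add]; ring
  · obtain ⟨-, C, l, hC, h⟩ := hF
    obtain ⟨-, C', l', hC', h'⟩ := hG
    refine ⟨C + C', l + l', by positivity, fun p hp t ht0 ht1 ht => ?_⟩
    have h1 : (1 : ℝ) ≤ 1 + ‖p.2‖ := by linarith [norm_nonneg p.2]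
    rw [polyVal_add]
    calc |F p t + G p t - (polyVal P p t + polyVal Q p t)|
        = |(F p t - polyVal P p t) + (G p t - polyVal Q p t)| := by ring_nf
      _ ≤ C * (1 + ‖p.2‖) ^ l * |t| ^ n + C' * (1 + ‖p.2‖) ^ l' * |t| ^ n :=
          (abs_add_le _ _).trans (add_le_add (h p hp t ht0 ht1 ht) (h' p hp t ht0 ht1 ht))
      _ ≤ C * (1 + ‖p.2‖) ^ (l + l') * |t| ^ n + C' * (1 + ‖p.2‖) ^ (l + l') * |t| ^ n := by
          gcongr
          · omega
          · omega
      _ = _ := by ring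

/-- Uses `FG - PQ = (F - P) G + P (G - Q)`. The product polynomial is not truncated at degree `n`:
the superfluous terms are harmless and are only dropped in `hasAsymptotics_of_even`. -/
theorem HasDominatedTaylor.mul (hF : HasDominatedTaylor K n ρ F P)
    (hG : HasDominatedTaylor K n ρ G Q) :
    HasDominatedTaylor K n ρ (fun p t => F p t * G p t) (P * Q) := by
  refine ⟨fun p hp => ?_, ?_⟩
  · have hP : polyVal P p =O[𝓝[≠] 0] fun _ : ℝ => (1 : ℝ) :=
      (((continuous_polyVal P p).tendsto 0).mono_left nhdsWithin_le_nhds).isBigO_one ℝ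
    have hQ : polyVal Q p =O[𝓝[≠] 0] fun _ : ℝ => (1 : ℝ) :=
      (((continuous_polyVal Q p).tendsto 0).mono_left nhdsWithin_le_nhds).isBigO_one ℝ
    have hn : (fun t : ℝ => t ^ n) =O[𝓝[≠] 0] fun _ : ℝ => (1 : ℝ) :=
      ((((continuous_id (X := ℝ)).pow n).tendsto 0).mono_left nhdsWithin_le_nhds).isBigO_one ℝ
    have hG' : G p =O[𝓝[≠] 0] fun _ : ℝ => (1 : ℝ) :=
      (((hG.1 p hp).isBigO.trans hn).add hQ).congr_left fun t => by ring
    have e1 : (fun t => (F p t - polyVal P p t) * G p t) =o[𝓝[≠] 0] fun t : ℝ => t ^ n := by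
      simpa using (hF.1 p hp).mul_isBigO hG'
    have e2 : (fun t => polyVal P p t * (G p t - polyVal Q p t)) =o[𝓝[≠] 0]
        fun t : ℝ => t ^ n := by
      simpa using hP.mul_isLittleO (hG.1 p hp)
    refine (e1.add e2).congr_left fun t => ?_
    rw [polyVal_mul]; ring
  · obtain ⟨C₁, l₁, hC₁, h₁⟩ := hG.exists_abs_le
    obtain ⟨C₂, l₂, hC₂, h₂⟩ := exists_abs_polyVal_le P
    obtain ⟨-, C, l, hC, h⟩ := hF
    obtain ⟨-, C', l', hC', h'⟩ := hG
    refine ⟨C * C₁ + C₂ * C', l + l₁ + (l₂ + l'), by positivity, fun p hp t ht0 ht1 ht => ?_⟩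
    have h1 : (1 : ℝ) ≤ 1 + ‖p.2‖ := by linarith [norm_nonneg p.2]
    rw [polyVal_mul]
    calc |F p t * G p t - polyVal P p t * polyVal Q p t|
        = |(F p t - polyVal P p t) * G p t + polyVal P p t * (G p t - polyVal Q p t)| := by ring_nf
      _ ≤ |F p t - polyVal P p t| * |G p t| + |polyVal P p t| * |G p t - polyVal Q p t| := by
          rw [← abs_mul, ← abs_mul]; exact abs_add_le _ _
      _ ≤ (C * (1 + ‖p.2‖) ^ l * |t| ^ n) * (C₁ * (1 + ‖p.2‖) ^ l₁) +
          (C₂ * (1 + ‖p.2‖) ^ l₂) * (C' * (1 + ‖p.2‖) ^ l' * |t| ^ n) := by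
          gcongr
          · exact h p hp t ht0 ht1 ht
          · exact h₁ p hp t ht0 ht1 ht
          · exact h₂ p hp t ht1
          · exact h' p hp t ht0 ht1 ht
      _ = C * C₁ * (1 + ‖p.2‖) ^ (l + l₁) * |t| ^ n +
          C₂ * C' * (1 + ‖p.2‖) ^ (l₂ + l') * |t| ^ n := by ring
      _ ≤ C * C₁ * (1 + ‖p.2‖) ^ (l + l₁ + (l₂ + l')) * |t| ^ n +
          C₂ * C' * (1 + ‖p.2‖) ^ (l + l₁ + (l₂ + l')) * |t| ^ n := by
          have e₁ := pow_le_pow_right₀ h1 (Nat.le_add_right (l + l₁) (l₂ + l'))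
          have e₂ := pow_le_pow_right₀ h1 (Nat.le_add_left (l₂ + l') (l + l₁))
          gcongr C * C₁ * ?_ * _ + C₂ * C' * ?_ * _
      _ = _ := by ring

theorem HasDominatedTaylor.of_mem (c : polyGrowth (Z := Z) K) :
    HasDominatedTaylor K n ρ (fun p _ => c.1 p) (Polynomial.C c) := by
  have h0 : ∀ p : Y × Z, ∀ t, polyVal (Polynomial.C c) p t = c.1 p := fun p t => by simp [polyVal]
  refine ⟨fun p _ => ?_, 0, 0, le_rfl, fun p _ t _ _ _ => by simp [h0]⟩
  simp only [h0, sub_self]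
  exact isLittleO_zero _ _

theorem HasDominatedTaylor.const (c : ℝ) :
    ∃ P, HasDominatedTaylor (Z := Z) K n ρ (fun _ _ => c) P :=
  ⟨_, HasDominatedTaylor.of_mem (algebraMap ℝ (polyGrowth (Z := Z) K) c)⟩

theorem HasDominatedTaylor.exists_pow (hF : HasDominatedTaylor K n ρ F P) (k : ℕ) :
    ∃ Q, HasDominatedTaylor K n ρ (fun p t => F p t ^ k) Q := by
  induction k with
  | zero => simpa using HasDominatedTaylor.const 1
  | succ k ih =>
    obtain ⟨Q, hQ⟩ := ih
    exact ⟨_, by simpa [pow_succ] using hQ.mul hF⟩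

theorem HasDominatedTaylor.exists_sum {ι : Type*} (s : Finset ι) {F : ι → Y × Z → ℝ → ℝ}
    (h : ∀ i ∈ s, ∃ Q, HasDominatedTaylor K n ρ (F i) Q) :
    ∃ Q, HasDominatedTaylor K n ρ (fun p t => ∑ i ∈ s, F i p t) Q := by
  classical
  induction s using Finset.induction_on with
  | empty => simpa using HasDominatedTaylor.const 0
  | insert i s his ih =>
    obtain ⟨Q, hQ⟩ := ih fun j hj => h j (Finset.mem_insert_of_mem hj)
    obtain ⟨R, hR⟩ := h i (Finset.mem_insert_self _ _)
    exact ⟨_, by simpa [Finset.sum_insert his] using hR.add hQ⟩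

variable [NormedSpace ℝ Y] [NormedSpace ℝ Z]

/-- The coefficients of the Taylor expansion of `t ↦ G (y, t ζ)`. -/
noncomputable def fibreCoeff (G : Y × Z → ℝ) (j : ℕ) (p : Y × Z) : ℝ :=
  (j.factorial : ℝ)⁻¹ * iteratedFDeriv ℝ j G (p.1, 0) (fun _ => ((0 : Y), p.2))

/-- The coefficient is a form of degree `j` in `ζ`, and its norm at `(y, 0)` is bounded for `y` in
the compact set `K`. -/
theorem fibreCoeff_mem (hK : IsCompact K) {G : Y × Z → ℝ} {N j : ℕ} (hG : ContDiff ℝ N G)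
    (hj : j ≤ N) : fibreCoeff G j ∈ polyGrowth (Z := Z) K := by
  have hc : Continuous (iteratedFDeriv ℝ j G) := hG.continuous_iteratedFDeriv (by exact_mod_cast hj)
  obtain ⟨C, hC⟩ := hK.exists_bound_of_continuousOn
    (f := fun y : Y => iteratedFDeriv ℝ j G (y, 0)) (by fun_prop)
  refine ⟨?_, (j.factorial : ℝ)⁻¹ * max C 0, j, by positivity, fun p hp => ?_⟩
  · have h1 : Continuous fun p : Y × Z => iteratedFDeriv ℝ j G (p.1, 0) := by fun_prop
    have h2 : Continuous fun p : Y × Z => (fun _ : Fin j => ((0 : Y), p.2)) := by fun_prop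
    unfold fibreCoeff
    exact continuous_const.mul (continuous_eval.comp (h1.prodMk h2))
  · rw [fibreCoeff, abs_mul, abs_of_nonneg (by positivity), mul_assoc]
    refine mul_le_mul_of_nonneg_left ?_ (by positivity)
    have h1 := (iteratedFDeriv ℝ j G (p.1, 0)).le_opNorm (fun _ => ((0 : Y), p.2))
    simp only [Finset.prod_const, Finset.card_univ, Fintype.card_fin, Real.norm_eq_abs,
      Prod.norm_mk, norm_zero] at h1
    refine h1.trans ?_
    have : max 0 ‖p.2‖ ≤ 1 + ‖p.2‖ := max_le (by positivity) (by linarith)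
    gcongr
    exact (hC _ hp).trans (le_max_left _ _)

/-- Taylor's formula at `(y, 0)` with increment `(0, tζ)`: the oscillation of the top derivative
tends to zero with `t`, by continuity. -/
theorem fibre_taylor_isLittleO {G : Y × Z → ℝ} {N : ℕ} (hG : ContDiff ℝ N G) (p : Y × Z) :
    (fun t : ℝ => G (p.1, t • p.2) - ∑ j ∈ Finset.range (N + 1), t ^ j * fibreCoeff G j p)
      =o[𝓝[≠] 0] fun t : ℝ => t ^ N := by
  refine isLittleO_iff.2 fun ε hε => ?_
  have hc : Continuous (iteratedFDeriv ℝ N G) := hG.continuous_iteratedFDeriv le_rfl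
  have hcont : Tendsto (fun s : ℝ => iteratedFDeriv ℝ N G (p.1, s • p.2)) (𝓝 0)
      (𝓝 (iteratedFDeriv ℝ N G (p.1, 0))) := by
    have : Continuous fun s : ℝ => iteratedFDeriv ℝ N G (p.1, s • p.2) := by fun_prop
    simpa using this.tendsto 0
  -- The remainder carries a factor `‖ζ‖ ^ N`, which this choice absorbs; the `1` guards against `ζ
  -- = 0`.
  have hε' : 0 < ε / (‖p.2‖ ^ N + 1) := by positivity
  obtain ⟨δ, hδ, h⟩ := Metric.tendsto_nhds_nhds.1 hcont _ hε'
  have hmem : Metric.ball (0 : ℝ) δ ∈ 𝓝[≠] (0 : ℝ) :=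
    mem_nhdsWithin_of_mem_nhds (Metric.ball_mem_nhds _ hδ)
  filter_upwards [hmem] with t ht
  rw [Metric.mem_ball, dist_zero_right, Real.norm_eq_abs] at ht
  have key := abs_sub_taylor_le (f := G) (x := (p.1, (0 : Z))) (y := ((0 : Y), t • p.2)) (N := N)
    (ε := ε / (‖p.2‖ ^ N + 1)) (fun s _ => hG.contDiffAt) (fun s hs => by
      have h2 := h (x := s * t) (by
        rw [dist_zero_right, Real.norm_eq_abs, abs_mul, abs_of_nonneg hs.1]
        exact (mul_le_of_le_one_left (abs_nonneg _) hs.2).trans_lt ht)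
      rw [dist_eq_norm] at h2
      simpa [smul_smul] using h2.le)
  have hs : ∀ j, (iteratedFDeriv ℝ j G (p.1, 0)) (fun _ => ((0 : Y), t • p.2)) =
      t ^ j * (iteratedFDeriv ℝ j G (p.1, 0)) (fun _ => ((0 : Y), p.2)) := by
    intro j
    have := (iteratedFDeriv ℝ j G (p.1, 0)).map_smul_univ (fun _ => t) (fun _ => ((0 : Y), p.2))
    simpa using this
  have he : ∑ k ∈ Finset.range (N + 1), (k.factorial : ℝ)⁻¹ *
      (iteratedFDeriv ℝ k G (p.1, 0)) (fun _ => ((0 : Y), t • p.2)) =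
      ∑ j ∈ Finset.range (N + 1), t ^ j * fibreCoeff G j p := by
    refine Finset.sum_congr rfl fun j _ => ?_
    rw [hs, fibreCoeff]; ring
  rw [he] at key
  simp only [Prod.mk_add_mk, add_zero, zero_add, Prod.norm_mk, norm_zero, norm_smul] at key
  rw [Real.norm_eq_abs]
  refine key.trans ?_
  rw [max_eq_right (by positivity), mul_pow, norm_pow, div_mul_eq_mul_div, div_le_iff₀ (by positivity)]
  have : 0 ≤ ‖t‖ ^ N := by positivity
  nlinarith [mul_nonneg hε.le this]

/-- The uniform companion of the pointwise estimate. As long as `tζ` stays in the ball of radius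
`ρ`, the top derivative is evaluated on a compact set, so its oscillation is at most twice its
maximum. -/
theorem exists_abs_fibre_taylor_le [ProperSpace Z] (hK : IsCompact K) (ρ : ℝ) {G : Y × Z → ℝ}
    {N : ℕ} (hG : ContDiff ℝ N G) :
    ∃ C : ℝ, 0 ≤ C ∧ ∀ p : Y × Z, p.1 ∈ K → ∀ t : ℝ, |t| * ‖p.2‖ ≤ ρ →
      |G (p.1, t • p.2) - ∑ j ∈ Finset.range (N + 1), t ^ j * fibreCoeff G j p| ≤
        C * (1 + ‖p.2‖) ^ N * |t| ^ N := by
  have hc : Continuous (iteratedFDeriv ℝ N G) := hG.continuous_iteratedFDeriv le_rfl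
  obtain ⟨C, hC⟩ := (hK.prod (isCompact_closedBall (0 : Z) ρ)).exists_bound_of_continuousOn
    (f := iteratedFDeriv ℝ N G) hc.continuousOn
  refine ⟨2 * max C 0, by positivity, fun p hp t ht => ?_⟩
  have hbd : ∀ s ∈ Set.Icc (0 : ℝ) 1, ‖iteratedFDeriv ℝ N G (p.1, (s * t) • p.2)‖ ≤ max C 0 := by
    intro s hs
    refine (hC (p.1, (s * t) • p.2) ⟨hp, ?_⟩).trans (le_max_left _ _)
    simp only [mem_closedBall_zero_iff, norm_smul, norm_mul, Real.norm_eq_abs, abs_of_nonneg hs.1]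
    rw [mul_assoc]
    exact (mul_le_of_le_one_left (by positivity) hs.2).trans ht
  have key := abs_sub_taylor_le (f := G) (x := (p.1, (0 : Z))) (y := ((0 : Y), t • p.2)) (N := N)
    (ε := 2 * max C 0) (fun s _ => hG.contDiffAt) (fun s hs => by
      have h1 := hbd s hs
      have h2 := hbd 0 (by simp)
      simp only [zero_mul, zero_smul] at h2
      refine (norm_sub_le _ _).trans ?_
      simp only [Prod.smul_mk, smul_zero, Prod.mk_add_mk, add_zero, zero_add, smul_smul]
      linarith)
  have hs : ∀ j, (iteratedFDeriv ℝ j G (p.1, 0)) (fun _ => ((0 : Y), t • p.2)) =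
      t ^ j * (iteratedFDeriv ℝ j G (p.1, 0)) (fun _ => ((0 : Y), p.2)) := by
    intro j
    have := (iteratedFDeriv ℝ j G (p.1, 0)).map_smul_univ (fun _ => t) (fun _ => ((0 : Y), p.2))
    simpa using this
  have he : ∑ k ∈ Finset.range (N + 1), (k.factorial : ℝ)⁻¹ *
      (iteratedFDeriv ℝ k G (p.1, 0)) (fun _ => ((0 : Y), t • p.2)) =
      ∑ j ∈ Finset.range (N + 1), t ^ j * fibreCoeff G j p := by
    refine Finset.sum_congr rfl fun j _ => ?_
    rw [hs, fibreCoeff]; ring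
  rw [he] at key
  simp only [Prod.mk_add_mk, add_zero, zero_add, Prod.norm_mk, norm_zero, norm_smul] at key
  refine key.trans ?_
  rw [max_eq_right (a := 0) (b := ‖t‖ * ‖p.2‖) (by positivity), mul_pow, Real.norm_eq_abs,
    mul_comm (|t| ^ N), ← mul_assoc]
  gcongr
  linarith

end DominatedTaylor


/-! ### Expansion of the rescaled Laplace integrand -/

/-- For `x ≥ 0` or `|x| ≤ 1` this is the usual bound by `|x|^(n+1) e^|x|`; for `x ≤ -1` the
exponential and every term of the sum are at most `|x|^(n+1)`. The factor `1 + e^x`, in place of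
`e^|x|`, is what remains integrable: times `e^(-q)` with `x = q - Φ/t²` it becomes `e^(-q) +
e^(-Φ/t²)`, and both terms are Gaussian. -/
theorem abs_exp_sub_sum_le (n : ℕ) (x : ℝ) :
    |Real.exp x - ∑ i ∈ Finset.range (n + 1), x ^ i / (i.factorial : ℝ)| ≤
      ((n : ℝ) + 5) * |x| ^ (n + 1) * (1 + Real.exp x) := by
  have h0 : |Real.exp x - ∑ i ∈ Finset.range (n + 1), x ^ i / (i.factorial : ℝ)| ≤
      |x| ^ (n + 1) * Real.exp |x| := by
    have := Complex.norm_exp_sub_sum_le_norm_mul_exp (x : ℂ) (n + 1)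
    have e : Complex.exp (x : ℂ) - ∑ i ∈ Finset.range (n + 1), (x : ℂ) ^ i / (i.factorial : ℂ) =
      ((Real.exp x - ∑ i ∈ Finset.range (n + 1), x ^ i / (i.factorial : ℝ) : ℝ) : ℂ) := by
      push_cast; rfl
    rw [e] at this
    simpa only [Complex.norm_real, Real.norm_eq_abs] using this
  have hn : (0 : ℝ) ≤ n := Nat.cast_nonneg n
  have he := Real.exp_pos x
  rcases le_total 0 x with hx | hx
  · refine h0.trans ?_
    rw [abs_of_nonneg hx]
    have : 0 ≤ x ^ (n + 1) := by positivity
    calc x ^ (n + 1) * Real.exp x ≤ 1 * x ^ (n + 1) * (1 + Real.exp x) := by nlinarith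
      _ ≤ _ := by gcongr; linarith
  · have hpos : 0 ≤ |x| ^ (n + 1) := by positivity
    rcases le_total |x| 1 with h1 | h1
    · refine h0.trans ?_
      have h3 : Real.exp |x| ≤ 3 := (Real.exp_le_exp.2 h1).trans Real.exp_one_lt_three.le
      calc |x| ^ (n + 1) * Real.exp |x| ≤ |x| ^ (n + 1) * 3 := by gcongr
        _ = 3 * |x| ^ (n + 1) * 1 := by ring
        _ ≤ _ := by gcongr <;> linarith
    · have hS : |∑ i ∈ Finset.range (n + 1), x ^ i / (i.factorial : ℝ)| ≤
          (n + 1) * |x| ^ (n + 1) := by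
        calc _ ≤ ∑ i ∈ Finset.range (n + 1), |x ^ i / (i.factorial : ℝ)| :=
              Finset.abs_sum_le_sum_abs _ _
          _ ≤ ∑ i ∈ Finset.range (n + 1), |x| ^ (n + 1) := by
              refine Finset.sum_le_sum fun i hi => ?_
              rw [abs_div, abs_pow, Nat.abs_cast]
              refine (div_le_self (by positivity) (by exact_mod_cast i.factorial_pos)).trans ?_
              exact pow_le_pow_right₀ h1 (Finset.mem_range.1 hi).le
          _ = _ := by simp
      have h4 : Real.exp x ≤ |x| ^ (n + 1) :=
        (Real.exp_le_one_iff.2 hx).trans (one_le_pow₀ h1)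
      calc _ ≤ |Real.exp x| + |∑ i ∈ Finset.range (n + 1), x ^ i / (i.factorial : ℝ)| := abs_sub _ _
        _ ≤ |x| ^ (n + 1) + (n + 1) * |x| ^ (n + 1) := by rw [abs_of_pos he]; gcongr
        _ = (n + 2) * |x| ^ (n + 1) * 1 := by ring
        _ ≤ _ := by gcongr <;> linarith

section Phase

variable {Y Z : Type*} [NormedAddCommGroup Y] [NormedAddCommGroup Z] {K : Set Y} {n : ℕ} {ρ : ℝ}

theorem polyVal_sum_C_mul_X_pow (a : ℕ → polyGrowth (Z := Z) K) (n : ℕ) (p : Y × Z) (t : ℝ) :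
    polyVal (∑ j ∈ Finset.range n, Polynomial.C (a j) * Polynomial.X ^ j) p t =
      ∑ j ∈ Finset.range n, t ^ j * (a j).1 p := by
  simp only [polyVal, Polynomial.eval_finsetSum, Polynomial.eval_mul, Polynomial.eval_C,
    Polynomial.eval_pow, Polynomial.eval_X, AddSubmonoidClass.coe_finsetSum, Finset.sum_apply]
  refine Finset.sum_congr rfl fun j _ => ?_
  simp [mul_comm]

variable [NormedSpace ℝ Y] [NormedSpace ℝ Z]

theorem exists_hasDominatedTaylor_fibre [ProperSpace Z] (hK : IsCompact K) (ρ : ℝ)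
    {G : Y × Z → ℝ} (hG : ContDiff ℝ n G) :
    ∃ P, HasDominatedTaylor K n ρ (fun p t => G (p.1, t • p.2)) P := by
  set a : ℕ → polyGrowth (Z := Z) K := fun j =>
    if h : j ≤ n then ⟨fibreCoeff G j, fibreCoeff_mem hK hG h⟩ else 0
  have ha : ∀ p : Y × Z, ∀ t : ℝ, ∑ j ∈ Finset.range (n + 1), t ^ j * (a j).1 p =
      ∑ j ∈ Finset.range (n + 1), t ^ j * fibreCoeff G j p := fun p t =>
    Finset.sum_congr rfl fun j hj => by
      simp only [a, dif_pos (Nat.lt_succ_iff.1 (Finset.mem_range.1 hj))]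
  refine ⟨∑ j ∈ Finset.range (n + 1), Polynomial.C (a j) * Polynomial.X ^ j, fun p _ => ?_, ?_⟩
  · simp only [polyVal_sum_C_mul_X_pow, ha]
    exact fibre_taylor_isLittleO hG p
  · obtain ⟨C, hC, h⟩ := exists_abs_fibre_taylor_le hK ρ hG
    refine ⟨C, n, hC, fun p hp t _ _ ht => ?_⟩
    rw [polyVal_sum_C_mul_X_pow, ha]
    exact h p hp t ht

variable {Φ : Y × Z → ℝ}

theorem fibreCoeff_zero (h0 : ∀ y, Φ (y, 0) = 0) (p : Y × Z) : fibreCoeff Φ 0 p = 0 := by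
  simp [fibreCoeff, h0]

/-- The points of the zero section are minima of `Φ`, so the gradient vanishes there. -/
theorem fibreCoeff_one (h0 : ∀ y, Φ (y, 0) = 0) (hpos : ∀ p, 0 ≤ Φ p) (p : Y × Z) :
    fibreCoeff Φ 1 p = 0 := by
  have hmin : IsLocalMin Φ (p.1, 0) := Eventually.of_forall fun q => by rw [h0]; exact hpos q
  simp [fibreCoeff, iteratedFDeriv_one_apply, hmin.fderiv_eq_zero]

/-- As the orders zero and one vanish, division by `t²` turns the expansion of `Φ` of order `n + 2`
into an expansion of order `n`. This is why the phase needs two more derivatives than the amplitude.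
-/
theorem div_sq_sub_sum (h0 : ∀ y, Φ (y, 0) = 0) (hpos : ∀ p, 0 ≤ Φ p) (p : Y × Z) {t : ℝ}
    (ht : t ≠ 0) (n : ℕ) :
    Φ (p.1, t • p.2) / t ^ 2 - ∑ j ∈ Finset.range (n + 1), t ^ j * fibreCoeff Φ (j + 2) p =
      (Φ (p.1, t • p.2) - ∑ j ∈ Finset.range (n + 2 + 1), t ^ j * fibreCoeff Φ j p) / t ^ 2 := by
  rw [Finset.sum_range_succ' _ (n + 2), Finset.sum_range_succ' _ (n + 1), fibreCoeff_zero h0,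
    fibreCoeff_one h0 hpos, mul_zero, mul_zero, add_zero, add_zero, sub_div, Finset.sum_div]
  congr 1
  refine Finset.sum_congr rfl fun j _ => ?_
  rw [add_assoc j 1 1, pow_add]
  field_simp

theorem tendsto_div_sq (hΦ : ContDiff ℝ 2 Φ) (h0 : ∀ y, Φ (y, 0) = 0) (hpos : ∀ p, 0 ≤ Φ p)
    (p : Y × Z) :
    Tendsto (fun t : ℝ => Φ (p.1, t • p.2) / t ^ 2) (𝓝[≠] 0) (𝓝 (fibreCoeff Φ 2 p)) := by
  have h := (fibre_taylor_isLittleO (N := 2) hΦ p).tendsto_div_nhds_zero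
  have h' : Tendsto (fun t : ℝ => Φ (p.1, t • p.2) / t ^ 2 - fibreCoeff Φ 2 p) (𝓝[≠] 0) (𝓝 0) := by
    refine h.congr' ?_
    filter_upwards [self_mem_nhdsWithin] with t ht
    have := div_sq_sub_sum h0 hpos p ht 0
    simp only [Finset.range_one, Finset.sum_singleton, pow_zero, one_mul, zero_add] at this
    rw [this]
  simpa using h'.add_const (fibreCoeff Φ 2 p)

theorem le_fibreCoeff_two (hΦ : ContDiff ℝ 2 Φ) (h0 : ∀ y, Φ (y, 0) = 0) {c : ℝ} (hc : 0 ≤ c)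
    (hle : ∀ p, c * ‖p.2‖ ^ 2 ≤ Φ p) (p : Y × Z) : c * ‖p.2‖ ^ 2 ≤ fibreCoeff Φ 2 p := by
  have hpos : ∀ p, 0 ≤ Φ p := fun p => (by positivity : 0 ≤ c * ‖p.2‖ ^ 2).trans (hle p)
  refine ge_of_tendsto (tendsto_div_sq hΦ h0 hpos p) ?_
  filter_upwards [self_mem_nhdsWithin] with t ht
  have ht' : 0 < t ^ 2 := by have : t ≠ 0 := ht; positivity
  rw [le_div_iff₀ ht']
  have := hle (p.1, t • p.2)
  simp only [norm_smul, mul_pow, Real.norm_eq_abs, sq_abs] at this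
  linarith

theorem exists_hasDominatedTaylor_div_sq [ProperSpace Z] (hK : IsCompact K) (ρ : ℝ)
    (hΦ : ContDiff ℝ (n + 2 : ℕ) Φ) (h0 : ∀ y, Φ (y, 0) = 0) (hpos : ∀ p, 0 ≤ Φ p) :
    ∃ P, HasDominatedTaylor K n ρ (fun p t => Φ (p.1, t • p.2) / t ^ 2) P := by
  set a : ℕ → polyGrowth (Z := Z) K := fun j =>
    if h : j ≤ n then ⟨fibreCoeff Φ (j + 2), fibreCoeff_mem hK hΦ (by omega)⟩ else 0
  have ha : ∀ p : Y × Z, ∀ t : ℝ, ∑ j ∈ Finset.range (n + 1), t ^ j * (a j).1 p =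
      ∑ j ∈ Finset.range (n + 1), t ^ j * fibreCoeff Φ (j + 2) p := fun p t =>
    Finset.sum_congr rfl fun j hj => by
      simp only [a, dif_pos (Nat.lt_succ_iff.1 (Finset.mem_range.1 hj))]
  refine ⟨∑ j ∈ Finset.range (n + 1), Polynomial.C (a j) * Polynomial.X ^ j, fun p _ => ?_, ?_⟩
  · simp only [polyVal_sum_C_mul_X_pow, ha]
    have h := (fibre_taylor_isLittleO hΦ p).mul_isBigO
      (isBigO_refl (fun t : ℝ => (t ^ 2)⁻¹) (𝓝[≠] 0))
    refine h.congr' ?_ ?_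
    · filter_upwards [self_mem_nhdsWithin] with t ht
      rw [div_sq_sub_sum h0 hpos p ht, div_eq_mul_inv]
    · filter_upwards [self_mem_nhdsWithin] with t ht
      have : t ≠ 0 := ht
      field_simp
      ring
  · obtain ⟨C, hC, h⟩ := exists_abs_fibre_taylor_le hK ρ hΦ
    refine ⟨C, n + 2, hC, fun p hp t ht0 _ ht => ?_⟩
    rw [polyVal_sum_C_mul_X_pow, ha, div_sq_sub_sum h0 hpos p ht0, abs_div, abs_pow,
      div_le_iff₀ (by positivity)]
    refine (h p hp t ht).trans_eq (by ring)

/-- For `n ≥ 1` the phase is of class `C³`, so the difference is `O(t)` and its `n`-th power is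
`O(t^n)`. For `n = 0` there may be no third derivative, but then the power is `1`; stating the bound
for the power covers both cases. -/
theorem exists_abs_div_sq_sub_pow_le [ProperSpace Z] (hK : IsCompact K) (ρ : ℝ)
    (hΦ : ContDiff ℝ (n + 2 : ℕ) Φ) (h0 : ∀ y, Φ (y, 0) = 0) (hpos : ∀ p, 0 ≤ Φ p) :
    ∃ C : ℝ, ∃ l : ℕ, 0 ≤ C ∧ ∀ p : Y × Z, p.1 ∈ K → ∀ t : ℝ, t ≠ 0 → |t| ≤ 1 → |t| * ‖p.2‖ ≤ ρ →
      |Φ (p.1, t • p.2) / t ^ 2 - fibreCoeff Φ 2 p| ^ n ≤ C * (1 + ‖p.2‖) ^ l * |t| ^ n := by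
  rcases Nat.eq_zero_or_pos n with rfl | hn
  · exact ⟨1, 0, zero_le_one, fun p _ t _ _ _ => by simp⟩
  · have hΦ3 : ContDiff ℝ (3 : ℕ) Φ := hΦ.of_le (by exact_mod_cast (by omega : 3 ≤ n + 2))
    obtain ⟨C, hC, h⟩ := exists_abs_fibre_taylor_le hK ρ hΦ3
    obtain ⟨-, C', l', hC', h'⟩ := fibreCoeff_mem (Z := Z) hK hΦ3 le_rfl
    have key : ∀ p : Y × Z, p.1 ∈ K → ∀ t : ℝ, t ≠ 0 → |t| ≤ 1 → |t| * ‖p.2‖ ≤ ρ →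
        |Φ (p.1, t • p.2) / t ^ 2 - fibreCoeff Φ 2 p| ≤ (C + C') * (1 + ‖p.2‖) ^ (3 + l') * |t| := by
      intro p hp t ht0 ht1 ht
      have h1 : (1 : ℝ) ≤ 1 + ‖p.2‖ := by linarith [norm_nonneg p.2]
      have e := div_sq_sub_sum h0 hpos p ht0 1
      simp only [Finset.sum_range_succ, Finset.range_zero, Finset.sum_empty, pow_zero, one_mul,
        pow_one, zero_add, Nat.reduceAdd] at e
      have hR := h p hp t ht
      simp only [Finset.sum_range_succ, Finset.range_zero, Finset.sum_empty, pow_zero, one_mul,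
        pow_one, zero_add, Nat.reduceAdd] at hR
      have e' : Φ (p.1, t • p.2) / t ^ 2 - fibreCoeff Φ 2 p = t * fibreCoeff Φ 3 p +
          (Φ (p.1, t • p.2) - (fibreCoeff Φ 0 p + t * fibreCoeff Φ 1 p + t ^ 2 * fibreCoeff Φ 2 p +
            t ^ 3 * fibreCoeff Φ 3 p)) / t ^ 2 := by rw [← e]; ring
      rw [e']
      calc _ ≤ |t * fibreCoeff Φ 3 p| + |(Φ (p.1, t • p.2) - (fibreCoeff Φ 0 p +
            t * fibreCoeff Φ 1 p + t ^ 2 * fibreCoeff Φ 2 p + t ^ 3 * fibreCoeff Φ 3 p)) / t ^ 2| :=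
            abs_add_le _ _
        _ ≤ |t| * (C' * (1 + ‖p.2‖) ^ l') + C * (1 + ‖p.2‖) ^ 3 * |t| := by
            refine add_le_add ?_ ?_
            · rw [abs_mul]; gcongr; exact h' p hp
            · rw [abs_div, abs_pow, div_le_iff₀ (by positivity)]
              exact hR.trans_eq (by ring)
        _ ≤ |t| * (C' * (1 + ‖p.2‖) ^ (3 + l')) + C * (1 + ‖p.2‖) ^ (3 + l') * |t| := by
            gcongr <;> omega
        _ = _ := by ring
    refine ⟨(C + C') ^ n, (3 + l') * n, by positivity, fun p hp t ht0 ht1 ht => ?_⟩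
    rw [pow_mul, ← mul_pow, ← mul_pow]
    exact pow_le_pow_left₀ (abs_nonneg _) (key p hp t ht0 ht1 ht) n

/-- The Laplace integrand after the scaling `z = t ζ`. -/
noncomputable def scaledIntegrand (b Φ : Y × Z → ℝ) (p : Y × Z) (t : ℝ) : ℝ :=
  b (p.1, t • p.2) * Real.exp (-(Φ (p.1, t • p.2) / t ^ 2))

/-- With `X = Φ/t² - q`, where `q` is the second fibre coefficient, one has `e^(-Φ/t²) = e^(-q)
e^(-X)`, and `e^(-X)` is replaced by its exponential sum up to order `n`. The sum has a dominated
Taylor expansion because `X` has one. The remainder is controlled by `|X|^(n+1)` times two Gaussian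
factors, since both `q` and `Φ/t²` are at least `c‖ζ‖²`. -/
theorem scaledIntegrand_taylor [ProperSpace Z] (hK : IsCompact K) (hρ : 0 < ρ) {b : Y × Z → ℝ}
    (hb : ContDiff ℝ n b) (hbρ : ∀ y z, ρ < ‖z‖ → b (y, z) = 0)
    (hΦ : ContDiff ℝ (n + 2 : ℕ) Φ) (h0 : ∀ y, Φ (y, 0) = 0) {c : ℝ} (hc : 0 ≤ c)
    (hle : ∀ p, c * ‖p.2‖ ^ 2 ≤ Φ p) :
    ∃ P : Polynomial (polyGrowth (Z := Z) K),
      (∀ p : Y × Z, p.1 ∈ K → (fun t => scaledIntegrand b Φ p t -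
        Real.exp (-fibreCoeff Φ 2 p) * polyVal P p t) =o[𝓝[≠] 0] fun t : ℝ => t ^ n) ∧
      ∃ C : ℝ, ∃ l : ℕ, 0 ≤ C ∧ ∀ p : Y × Z, p.1 ∈ K → ∀ t : ℝ, t ≠ 0 → |t| ≤ 1 →
        |scaledIntegrand b Φ p t - Real.exp (-fibreCoeff Φ 2 p) * polyVal P p t| ≤
          C * (1 + ‖p.2‖) ^ l * Real.exp (-(c * ‖p.2‖ ^ 2)) * |t| ^ n := by
  have hpos : ∀ p, 0 ≤ Φ p := fun p => (by positivity : 0 ≤ c * ‖p.2‖ ^ 2).trans (hle p)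
  have hΦ2 : ContDiff ℝ 2 Φ := hΦ.of_le (by exact_mod_cast (by omega : 2 ≤ n + 2))
  set q : Y × Z → ℝ := fibreCoeff Φ 2 with hq
  have hqc : ∀ p, c * ‖p.2‖ ^ 2 ≤ q p := le_fibreCoeff_two hΦ2 h0 hc hle
  set X : Y × Z → ℝ → ℝ := fun p t => Φ (p.1, t • p.2) / t ^ 2 - q p with hX
  obtain ⟨PQ, hPQ⟩ := exists_hasDominatedTaylor_div_sq (n := n) hK ρ hΦ h0 hpos
  obtain ⟨Pb, hPb⟩ := exists_hasDominatedTaylor_fibre hK ρ hb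
  have hqm : (fun p => -q p) ∈ polyGrowth (Z := Z) K :=
    Subalgebra.neg_mem _ (fibreCoeff_mem (Z := Z) hK (N := 2) (by exact_mod_cast hΦ2) le_rfl)
  have hXT : ∃ P, HasDominatedTaylor K n ρ X P := by
    refine ⟨_, (hPQ.add (HasDominatedTaylor.of_mem ⟨_, hqm⟩))⟩
  obtain ⟨PX, hPX⟩ := hXT
  obtain ⟨PS, hPS⟩ : ∃ P, HasDominatedTaylor K n ρ
      (fun p t => ∑ i ∈ Finset.range (n + 1), (-X p t) ^ i / (i.factorial : ℝ)) P := by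
    refine HasDominatedTaylor.exists_sum _ fun i _ => ?_
    obtain ⟨R, hR⟩ := hPX.exists_pow i
    obtain ⟨R', hR'⟩ := HasDominatedTaylor.const (Z := Z) (K := K) (n := n) (ρ := ρ)
      ((-1) ^ i / (i.factorial : ℝ))
    refine ⟨R' * R, ?_⟩
    convert hR'.mul hR using 3 with p t
    rw [neg_pow]; ring
  have hPbS := hPb.mul hPS
  set S : Y × Z → ℝ → ℝ := fun p t =>
    ∑ i ∈ Finset.range (n + 1), (-X p t) ^ i / (i.factorial : ℝ) with hS
  have hsplit : ∀ p t, scaledIntegrand b Φ p t - Real.exp (-q p) * polyVal (Pb * PS) p t =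
      Real.exp (-q p) * (b (p.1, t • p.2) * S p t - polyVal (Pb * PS) p t) +
        b (p.1, t • p.2) * (Real.exp (-q p) * (Real.exp (-X p t) - S p t)) := by
    intro p t
    have : Real.exp (-(Φ (p.1, t • p.2) / t ^ 2)) = Real.exp (-q p) * Real.exp (-X p t) := by
      rw [← Real.exp_add]; congr 1; simp only [hX]; ring
    rw [scaledIntegrand, this]; ring
  have hrem : ∀ p t, |Real.exp (-q p) * (Real.exp (-X p t) - S p t)| ≤
      ((n : ℝ) + 5) * |X p t| ^ (n + 1) *
        (Real.exp (-q p) + Real.exp (-(Φ (p.1, t • p.2) / t ^ 2))) := by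
    intro p t
    rw [abs_mul, abs_of_pos (Real.exp_pos _)]
    calc _ ≤ Real.exp (-q p) * (((n : ℝ) + 5) * |-X p t| ^ (n + 1) * (1 + Real.exp (-X p t))) := by
          gcongr; exact abs_exp_sub_sum_le n _
      _ = ((n : ℝ) + 5) * |X p t| ^ (n + 1) *
            (Real.exp (-q p) + Real.exp (-q p) * Real.exp (-X p t)) := by rw [abs_neg]; ring
      _ = _ := by
          rw [← Real.exp_add]; congr 4; simp only [hX]; ring
  obtain ⟨C₁, l₁, hC₁, h₁⟩ := exists_abs_div_sq_sub_pow_le (n := n) hK ρ hΦ h0 hpos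
  obtain ⟨C₂, l₂, hC₂, h₂⟩ := hPX.exists_abs_le
  obtain ⟨C₃, l₃, hC₃, h₃⟩ := hPb.exists_abs_le
  refine ⟨Pb * PS, fun p hp => ?_, ?_⟩
  · have e1 := (hPbS.1 p hp).const_mul_left (Real.exp (-q p))
    -- `|X|^n` is `O(t^n)`, and the remaining factor `|X|` tends to zero. Nothing better is
    -- available when `n = 0`, where `Φ` is only of class `C²`.
    have hXn : (fun t => |X p t| ^ (n + 1)) =o[𝓝[≠] 0] fun t : ℝ => t ^ n := by
      have hX0 : Tendsto (X p) (𝓝[≠] 0) (𝓝 0) := by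
        have := (tendsto_div_sq hΦ2 h0 hpos p).sub_const (q p)
        rwa [← hq, sub_self] at this
      have hXO : (fun t => |X p t| ^ n) =O[𝓝[≠] 0] fun t : ℝ => t ^ n := by
        have hev : ∀ᶠ t : ℝ in 𝓝[≠] 0, t ≠ 0 ∧ |t| ≤ 1 ∧ |t| * ‖p.2‖ ≤ ρ := by
          have a1 : ∀ᶠ t : ℝ in 𝓝 0, |t| < 1 :=
            (continuous_abs.tendsto' 0 0 abs_zero).eventually_lt_const one_pos
          have a2 : ∀ᶠ t : ℝ in 𝓝 0, |t| * ‖p.2‖ < ρ :=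
            ((continuous_abs.mul continuous_const).tendsto' 0 0 (by simp)).eventually_lt_const hρ
          filter_upwards [self_mem_nhdsWithin, mem_nhdsWithin_of_mem_nhds a1,
            mem_nhdsWithin_of_mem_nhds a2] with t b1 b2 b3
          exact ⟨b1, le_of_lt b2, le_of_lt b3⟩
        refine IsBigO.of_bound (C₁ * (1 + ‖p.2‖) ^ l₁) ?_
        filter_upwards [hev] with t ht
        rw [norm_pow, norm_pow, Real.norm_eq_abs, Real.norm_eq_abs, abs_abs]
        exact h₁ p hp t ht.1 ht.2.1 ht.2.2
      have hX1 : (fun t => |X p t|) =o[𝓝[≠] 0] fun _ : ℝ => (1 : ℝ) :=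
        (isLittleO_one_iff ℝ).2 (by simpa using hX0.abs)
      simpa [pow_succ] using hXO.mul_isLittleO hX1
    have e2 : (fun t => b (p.1, t • p.2) * (Real.exp (-q p) * (Real.exp (-X p t) - S p t)))
        =o[𝓝[≠] 0] fun t : ℝ => t ^ n := by
      have hbO : (fun t : ℝ => b (p.1, t • p.2)) =O[𝓝[≠] 0] fun _ : ℝ => (1 : ℝ) := by
        have hcb := hb.continuous
        have : Continuous fun t : ℝ => b (p.1, t • p.2) := by fun_prop
        exact ((this.tendsto 0).mono_left nhdsWithin_le_nhds).isBigO_one ℝ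
      have hO : (fun t => Real.exp (-q p) * (Real.exp (-X p t) - S p t)) =O[𝓝[≠] 0]
          fun t => |X p t| ^ (n + 1) := by
        refine IsBigO.of_bound (((n : ℝ) + 5) * 2) ?_
        refine Eventually.of_forall fun t => ?_
        have b1 : Real.exp (-q p) ≤ 1 := Real.exp_le_one_iff.2 (by
          have := hqc p
          have : 0 ≤ c * ‖p.2‖ ^ 2 := by positivity
          linarith)
        have b2 : Real.exp (-(Φ (p.1, t • p.2) / t ^ 2)) ≤ 1 := Real.exp_le_one_iff.2 (by
          have := hpos (p.1, t • p.2)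
          have : 0 ≤ Φ (p.1, t • p.2) / t ^ 2 := by positivity
          linarith)
        rw [Real.norm_eq_abs, norm_pow, Real.norm_eq_abs, abs_abs]
        refine (hrem p t).trans ?_
        calc _ ≤ ((n : ℝ) + 5) * |X p t| ^ (n + 1) * (1 + 1) := by gcongr
          _ = _ := by ring
      simpa using hbO.mul_isLittleO (hO.trans_isLittleO hXn)
    exact (e1.add e2).congr_left fun t => (hsplit p t).symm
  · obtain ⟨C₄, l₄, hC₄, h₄⟩ := exists_abs_polyVal_le (Pb * PS)
    obtain ⟨-, C₅, l₅, hC₅, h₅⟩ := hPbS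
    set l := l₁ + l₂ + l₃ + l₄ + l₅ + n with hl
    -- The three summands bound the Taylor remainder of the exponential sum, the remainder of the
    -- exponential series, and the polynomial off the support of the amplitude.
    set C := C₅ + C₃ * (((n : ℝ) + 5) * (C₁ * C₂) * 2) + C₄ * (ρ⁻¹) ^ n with hCdef
    refine ⟨C, l, by positivity, fun p hp t ht0 ht1 => ?_⟩
    have g1 : (1 : ℝ) ≤ 1 + ‖p.2‖ := by linarith [norm_nonneg p.2]
    have hpw : ∀ i, i ≤ l → (1 + ‖p.2‖) ^ i ≤ (1 + ‖p.2‖) ^ l := fun i hi => pow_le_pow_right₀ g1 hi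
    have eq1 : Real.exp (-q p) ≤ Real.exp (-(c * ‖p.2‖ ^ 2)) :=
      Real.exp_le_exp.2 (by linarith [hqc p])
    have eq2 : Real.exp (-(Φ (p.1, t • p.2) / t ^ 2)) ≤ Real.exp (-(c * ‖p.2‖ ^ 2)) := by
      refine Real.exp_le_exp.2 (neg_le_neg ?_)
      have ht' : 0 < t ^ 2 := by positivity
      rw [le_div_iff₀ ht']
      have := hle (p.1, t • p.2)
      simp only [norm_smul, mul_pow, Real.norm_eq_abs, sq_abs] at this
      linarith
    set e := Real.exp (-(c * ‖p.2‖ ^ 2)) with he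
    have he0 : 0 < e := Real.exp_pos _
    by_cases ht : |t| * ‖p.2‖ ≤ ρ
    · rw [hsplit]
      have b1 : |Real.exp (-q p) * (b (p.1, t • p.2) * S p t - polyVal (Pb * PS) p t)| ≤
          C₅ * (1 + ‖p.2‖) ^ l * e * |t| ^ n := by
        rw [abs_mul, abs_of_pos (Real.exp_pos _)]
        calc _ ≤ e * (C₅ * (1 + ‖p.2‖) ^ l₅ * |t| ^ n) := by
              gcongr; exact h₅ p hp t ht0 ht1 ht
          _ ≤ e * (C₅ * (1 + ‖p.2‖) ^ l * |t| ^ n) := by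
              gcongr
              omega
          _ = _ := by ring
      have b2 : |b (p.1, t • p.2) * (Real.exp (-q p) * (Real.exp (-X p t) - S p t))| ≤
          C₃ * (((n : ℝ) + 5) * (C₁ * C₂) * 2) * (1 + ‖p.2‖) ^ l * e * |t| ^ n := by
        rw [abs_mul]
        calc _ ≤ (C₃ * (1 + ‖p.2‖) ^ l₃) * (((n : ℝ) + 5) * |X p t| ^ (n + 1) *
              (Real.exp (-q p) + Real.exp (-(Φ (p.1, t • p.2) / t ^ 2)))) := by
              gcongr
              · exact h₃ p hp t ht0 ht1 ht
              · exact hrem p t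
          _ ≤ (C₃ * (1 + ‖p.2‖) ^ l₃) * (((n : ℝ) + 5) *
              ((C₁ * (1 + ‖p.2‖) ^ l₁ * |t| ^ n) * (C₂ * (1 + ‖p.2‖) ^ l₂)) * (e + e)) := by
              rw [pow_succ]
              gcongr
              · exact h₁ p hp t ht0 ht1 ht
              · exact h₂ p hp t ht0 ht1 ht
          _ = C₃ * (((n : ℝ) + 5) * (C₁ * C₂) * 2) * (1 + ‖p.2‖) ^ (l₁ + l₂ + l₃) * e * |t| ^ n := by
              ring
          _ ≤ _ := by
              have := hpw (l₁ + l₂ + l₃) (by omega)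
              gcongr _ * ?_ * _ * _
      calc _ ≤ _ := abs_add_le _ _
        _ ≤ C₅ * (1 + ‖p.2‖) ^ l * e * |t| ^ n +
          C₃ * (((n : ℝ) + 5) * (C₁ * C₂) * 2) * (1 + ‖p.2‖) ^ l * e * |t| ^ n := add_le_add b1 b2
        _ ≤ C₅ * (1 + ‖p.2‖) ^ l * e * |t| ^ n +
          C₃ * (((n : ℝ) + 5) * (C₁ * C₂) * 2) * (1 + ‖p.2‖) ^ l * e * |t| ^ n +
          C₄ * (ρ⁻¹) ^ n * (1 + ‖p.2‖) ^ l * e * |t| ^ n := le_add_of_nonneg_right (by positivity)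
        _ = _ := by rw [hCdef]; ring
    -- Off the support only the polynomial is left. The factor `|t|^n` is gained from `1 ≤ (|t| ‖ζ‖
    -- / ρ)^n`, at the cost of `n` more powers of `‖ζ‖`.
    · push Not at ht
      have hz : scaledIntegrand b Φ p t = 0 := by
        rw [scaledIntegrand, hbρ, zero_mul]
        rwa [norm_smul]
      rw [hz, zero_sub, abs_neg, abs_mul, abs_of_pos (Real.exp_pos _)]
      have hone : 1 ≤ (ρ⁻¹ * (|t| * ‖p.2‖)) ^ n := by
        refine one_le_pow₀ ?_
        rw [inv_mul_eq_div, one_le_div hρ]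
        exact ht.le
      calc _ ≤ e * (C₄ * (1 + ‖p.2‖) ^ l₄) := by
            gcongr; exact h₄ p hp t ht1
        _ ≤ e * (C₄ * (1 + ‖p.2‖) ^ l₄) * (ρ⁻¹ * (|t| * ‖p.2‖)) ^ n :=
            le_mul_of_one_le_right (by positivity) hone
        _ ≤ e * (C₄ * (1 + ‖p.2‖) ^ l₄) * (ρ⁻¹ * (|t| * (1 + ‖p.2‖))) ^ n := by
            gcongr; linarith
        _ = C₄ * (ρ⁻¹) ^ n * (1 + ‖p.2‖) ^ (l₄ + n) * e * |t| ^ n := by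
            rw [mul_pow, mul_pow]; ring
        _ ≤ C₄ * (ρ⁻¹) ^ n * (1 + ‖p.2‖) ^ l * e * |t| ^ n := by
            have := hpw (l₄ + n) (by omega)
            gcongr _ * ?_ * _ * _
        _ ≤ C * (1 + ‖p.2‖) ^ l * e * |t| ^ n := by
            gcongr
            rw [hCdef]
            exact le_add_of_nonneg_left (by positivity)

end Phase


/-! ### Laplace's method on a product space -/

/-- `W l = ∑_{i ≤ r} c_i l ^ (-i) + o(l ^ (-r))` as `l → ∞`. -/
def HasAsymptotics (r : ℕ) (c : ℕ → ℝ) (W : ℝ → ℝ) : Prop :=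
  (fun l => W l - ∑ i ∈ Finset.range (r + 1), c i * (l⁻¹) ^ i) =o[atTop] fun l : ℝ => (l⁻¹) ^ r

theorem exists_pow_mul_exp_le {c : ℝ} (hc : 0 < c) (l : ℕ) :
    ∃ C : ℝ, ∀ x : ℝ, 0 ≤ x →
      (1 + x) ^ l * Real.exp (-(c * x ^ 2)) ≤ C * Real.exp (-(c / 2) * x ^ 2) := by
  -- From `(1 + x)^l ≤ l! e^(1+x)` and `x ≤ 1/(2c) + c x²/2`.
  refine ⟨l.factorial * Real.exp (1 + 1 / (2 * c)), fun x hx => ?_⟩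
  have h1 := Real.pow_div_factorial_le_exp (1 + x) (by linarith) l
  rw [div_le_iff₀ (by positivity)] at h1
  calc _ ≤ Real.exp (1 + x) * l.factorial * Real.exp (-(c * x ^ 2)) := by gcongr
    _ = l.factorial * (Real.exp (1 + x) * Real.exp (-(c * x ^ 2))) := by ring
    _ ≤ l.factorial * (Real.exp (1 + 1 / (2 * c)) * Real.exp (-(c / 2) * x ^ 2)) := by
        rw [← Real.exp_add, ← Real.exp_add]
        refine mul_le_mul_of_nonneg_left (Real.exp_le_exp.2 ?_) (by positivity)
        have : x ≤ 1 / (2 * c) + c / 2 * x ^ 2 := by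
          have h := sq_nonneg (c * x - 1)
          have : 1 / (2 * c) + c / 2 * x ^ 2 - x = (c * x - 1) ^ 2 / (2 * c) := by
            field_simp; ring
          have h2 : 0 ≤ (c * x - 1) ^ 2 / (2 * c) := by positivity
          linarith
        linarith
    _ = _ := by ring

theorem integrable_pow_mul_gaussian {k : ℕ} {c : ℝ} (hc : 0 < c) (l : ℕ) :
    Integrable (fun z : E k => (1 + ‖z‖) ^ l * Real.exp (-(c * ‖z‖ ^ 2))) := by
  obtain ⟨C, hC⟩ := exists_pow_mul_exp_le hc l
  have hg : Integrable (fun z : E k => Real.exp (-(c / 2) * ‖z‖ ^ 2)) := by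
    have := (GaussianFourier.integrable_cexp_neg_mul_sq_norm_add (V := E k) (b := ((c / 2 : ℝ) : ℂ))
      (by simpa using hc) 0 0).norm
    refine this.congr (Eventually.of_forall fun z => ?_)
    simp only [inner_zero_left, Complex.ofReal_zero, mul_zero, add_zero]
    rw [Complex.norm_exp]
    congr 1
    norm_cast
  refine (hg.const_mul C).mono' (by fun_prop) (Eventually.of_forall fun z => ?_)
  rw [Real.norm_of_nonneg (by positivity)]
  exact hC _ (norm_nonneg z)

theorem sum_range_two_mul (f : ℕ → ℝ) (M : ℕ) :
    ∑ j ∈ Finset.range (2 * M), f j = ∑ i ∈ Finset.range M, (f (2 * i) + f (2 * i + 1)) := by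
  induction M with
  | zero => simp
  | succ M ih =>
    rw [mul_add, mul_one, Finset.sum_range_succ, Finset.sum_range_succ, ih, Finset.sum_range_succ]
    ring

/-- The even part of a polynomial expansion of an even function. -/
theorem hasAsymptotics_of_even {W : ℝ → ℝ} {w : ℕ → ℝ} {D r : ℕ} (hW : ∀ t, W (-t) = W t)
    (hw : ∀ j, D ≤ j → w j = 0)
    (h : (fun t => W t - ∑ j ∈ Finset.range D, w j * t ^ j) =o[𝓝[≠] 0] fun t : ℝ => t ^ (2 * r)) :
    HasAsymptotics r (fun i => w (2 * i)) (fun l => W (√l)⁻¹) := by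
  have hneg : Tendsto (fun t : ℝ => -t) (𝓝[≠] 0) (𝓝[≠] 0) := by
    refine tendsto_nhdsWithin_iff.2 ⟨?_, ?_⟩
    · simpa using ((continuous_neg (G := ℝ)).tendsto 0).mono_left nhdsWithin_le_nhds
    · filter_upwards [self_mem_nhdsWithin] with t ht
      simpa using ht
  -- Large enough both to contain all nonzero coefficients and to reach beyond order `r`.
  set M := D + r + 1 with hM
  have hsum : ∀ t : ℝ, ∑ j ∈ Finset.range D, w j * t ^ j =
      ∑ j ∈ Finset.range (2 * M), w j * t ^ j := fun t => by
    refine Finset.sum_subset (Finset.range_mono (by omega)) fun j _ hj => ?_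
    rw [hw j (by simpa using hj), zero_mul]
  have h2 : (fun t => W t - ∑ j ∈ Finset.range D, w j * (-t) ^ j) =o[𝓝[≠] 0]
      fun t : ℝ => t ^ (2 * r) := by
    refine (h.comp_tendsto hneg).congr (fun t => ?_) (fun t => ?_)
    · simp only [Function.comp, hW]
    · simp only [Function.comp, pow_mul, neg_sq]
  -- Averaging the expansions at `t` and `-t` cancels the odd powers.
  have h3 : (fun t => W t - ∑ i ∈ Finset.range M, w (2 * i) * (t ^ 2) ^ i) =o[𝓝[≠] 0]
      fun t : ℝ => t ^ (2 * r) := by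
    refine ((h.add h2).const_mul_left (1 / 2)).congr_left fun t => ?_
    rw [hsum, hsum, sum_range_two_mul, sum_range_two_mul]
    have : ∑ i ∈ Finset.range M, (w (2 * i) * t ^ (2 * i) + w (2 * i + 1) * t ^ (2 * i + 1)) +
        ∑ i ∈ Finset.range M, (w (2 * i) * (-t) ^ (2 * i) + w (2 * i + 1) * (-t) ^ (2 * i + 1)) =
        2 * ∑ i ∈ Finset.range M, w (2 * i) * (t ^ 2) ^ i := by
      rw [← Finset.sum_add_distrib, Finset.mul_sum]
      refine Finset.sum_congr rfl fun i _ => ?_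
      rw [pow_succ (-t), pow_succ t, pow_mul, pow_mul, neg_sq]; ring
    linarith
  have ht : Tendsto (fun l : ℝ => (√l)⁻¹) atTop (𝓝[≠] 0) := by
    refine tendsto_nhdsWithin_iff.2 ⟨tendsto_inv_atTop_zero.comp Real.tendsto_sqrt_atTop, ?_⟩
    filter_upwards [eventually_gt_atTop 0] with l hl
    have : √l ≠ 0 := (Real.sqrt_pos.2 hl).ne'
    simpa using this
  have hsq : ∀ᶠ l : ℝ in atTop, ((√l)⁻¹) ^ 2 = l⁻¹ := by
    filter_upwards [eventually_gt_atTop 0] with l hl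
    rw [inv_pow, Real.sq_sqrt hl.le]
  have h4 : (fun l : ℝ => W (√l)⁻¹ - ∑ i ∈ Finset.range M, w (2 * i) * (l⁻¹) ^ i) =o[atTop]
      fun l : ℝ => (l⁻¹) ^ r := by
    refine (h3.comp_tendsto ht).congr' ?_ ?_
    · filter_upwards [hsq] with l hl
      simp only [Function.comp, hl]
    · filter_upwards [hsq] with l hl
      simp only [Function.comp, pow_mul, hl]
  have h5 : (fun l : ℝ => ∑ i ∈ Finset.Ico (r + 1) M, w (2 * i) * (l⁻¹) ^ i) =o[atTop]
      fun l : ℝ => (l⁻¹) ^ r := by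
    refine IsLittleO.fun_sum fun i hi => ?_
    have hi' : r < i := (Finset.mem_Ico.1 hi).1
    exact ((isLittleO_pow_pow hi').comp_tendsto tendsto_inv_atTop_zero).const_mul_left _
  refine (h4.add h5).congr_left fun l => ?_
  rw [← Finset.sum_range_add_sum_Ico _ (by omega : r + 1 ≤ M)]
  ring

theorem continuous_scaledIntegrand {Y Z : Type*} [NormedAddCommGroup Y] [NormedAddCommGroup Z]
    [NormedSpace ℝ Z] {b Φ : Y × Z → ℝ} (hb : Continuous b)
    (hΦ : Continuous Φ) (t : ℝ) : Continuous fun p => scaledIntegrand b Φ p t := by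
  unfold scaledIntegrand; fun_prop

theorem integral_scaledIntegrand {m k : ℕ} {b Φ : E m × E k → ℝ} (hb : Continuous b)
    (hbc : HasCompactSupport b) (hΦ : Continuous Φ) {t : ℝ} (ht : 0 < t)
    (hint : Integrable fun p => scaledIntegrand b Φ p t) :
    ∫ p, scaledIntegrand b Φ p t = (t ^ k)⁻¹ * ∫ p, b p * Real.exp (-(Φ p / t ^ 2)) := by
  have hf : Integrable fun p : E m × E k => b p * Real.exp (-(Φ p / t ^ 2)) :=
    Continuous.integrable_of_hasCompactSupport (by fun_prop) (hbc.mul_right)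
  rw [Measure.volume_eq_prod, integral_prod _ hf, integral_prod _ hint, ← integral_const_mul]
  refine integral_congr_ae (Eventually.of_forall fun y => ?_)
  have := Measure.integral_comp_smul (volume : Measure (E k))
    (fun z => b (y, z) * Real.exp (-(Φ (y, z) / t ^ 2))) t
  simp only [finrank_euclideanSpace, Fintype.card_fin, smul_eq_mul] at this
  rw [abs_of_pos (by positivity)] at this
  exact this

/-- **Laplace's method** for a phase that is minimal on a linear subspace. -/
theorem exists_hasAsymptotics_laplace {m k r : ℕ} {b Φ : E m × E k → ℝ}
    (hb : ContDiff ℝ (2 * r : ℕ) b) (hbc : HasCompactSupport b)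
    (hΦ : ContDiff ℝ (2 * r + 2 : ℕ) Φ) (h0 : ∀ y, Φ (y, 0) = 0) {c : ℝ} (hc : 0 < c)
    (hle : ∀ p, c * ‖p.2‖ ^ 2 ≤ Φ p) :
    Integrable (fun p : E m × E k => b (p.1, 0) * Real.exp (-fibreCoeff Φ 2 p)) ∧
    ∃ a : ℕ → ℝ, a 0 = ∫ p : E m × E k, b (p.1, 0) * Real.exp (-fibreCoeff Φ 2 p) ∧
      HasAsymptotics r a fun l => l ^ ((k : ℝ) / 2) * ∫ p, b p * Real.exp (-(l * Φ p)) := by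
  set K : Set (E m) := Prod.fst '' tsupport b with hKdef
  have hK : IsCompact K := hbc.isCompact.image continuous_fst
  obtain ⟨ρ, hρ, hρb⟩ : ∃ ρ : ℝ, 0 < ρ ∧ ∀ p ∈ tsupport b, ‖p‖ ≤ ρ :=
    hbc.isCompact.isBounded.exists_pos_norm_le
  have hbK : ∀ p : E m × E k, p.1 ∉ K → b p = 0 := fun p hp => by
    by_contra h
    exact hp ⟨p, subset_tsupport _ h, rfl⟩
  have hbρ : ∀ (y : E m) (z : E k), ρ < ‖z‖ → b (y, z) = 0 := fun y z hz => by
    by_contra h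
    have := hρb (y, z) (subset_tsupport _ h)
    exact absurd ((norm_snd_le (y, z)).trans this) (not_le.2 hz)
  have hbcont := hb.continuous
  have hΦcont := hΦ.continuous
  have hpos : ∀ p, 0 ≤ Φ p := fun p => (by positivity : 0 ≤ c * ‖p.2‖ ^ 2).trans (hle p)
  have hΦ2 : ContDiff ℝ 2 Φ := hΦ.of_le (by exact_mod_cast (by omega : 2 ≤ 2 * r + 2))
  obtain ⟨P, hP, C, l, hC, hD⟩ := scaledIntegrand_taylor (n := 2 * r) hK hρ hb hbρ hΦ h0 hc.le hle
  set q : E m × E k → ℝ := fibreCoeff Φ 2 with hq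
  have hqc : ∀ p, c * ‖p.2‖ ^ 2 ≤ q p := le_fibreCoeff_two hΦ2 h0 hc.le hle
  have hqcont : Continuous q :=
    (fibreCoeff_mem (Z := E k) hK (N := 2) (by exact_mod_cast hΦ2) le_rfl).1
  -- The dominating functions decay only in the fibre direction, so the base variable is confined to
  -- the compact set `K`.
  set μ : Measure (E m × E k) := volume.restrict (K ×ˢ Set.univ) with hμ
  have hmem : ∀ᵐ p ∂μ, p.1 ∈ K := by
    filter_upwards [ae_restrict_mem (hK.measurableSet.prod MeasurableSet.univ)] with p hp
    exact hp.1
  have hdom : ∀ l : ℕ, Integrable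
      (fun p : E m × E k => (1 + ‖p.2‖) ^ l * Real.exp (-(c * ‖p.2‖ ^ 2))) μ := by
    intro l
    rw [hμ, Measure.volume_eq_prod, ← Measure.prod_restrict, Measure.restrict_univ]
    have : IsFiniteMeasure ((volume : Measure (E m)).restrict K) :=
      isFiniteMeasure_restrict.2 hK.measure_ne_top
    simpa using (integrable_const (1 : ℝ)).mul_prod (integrable_pow_mul_gaussian (k := k) hc l)
  have hcoef : ∀ a : polyGrowth (Z := E k) K, Integrable (fun p => Real.exp (-q p) * a.1 p) μ := by
    rintro ⟨a, ha, C', l', hC', ha'⟩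
    refine ((hdom l').const_mul C').mono'
      ((Real.continuous_exp.comp hqcont.neg).mul ha).aestronglyMeasurable ?_
    filter_upwards [hmem] with p hp
    rw [norm_mul, Real.norm_of_nonneg (Real.exp_pos _).le, Real.norm_eq_abs]
    calc _ ≤ Real.exp (-(c * ‖p.2‖ ^ 2)) * (C' * (1 + ‖p.2‖) ^ l') := by
          gcongr
          · exact hqc p
          · exact ha' p hp
      _ = _ := by ring
  have hpoly : ∀ t, Integrable (fun p => Real.exp (-q p) * polyVal P p t) μ := fun t =>
    hcoef (P.eval (algebraMap ℝ (polyGrowth (Z := E k) K) t))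
  have hpolyint : ∀ t, ∫ p, Real.exp (-q p) * polyVal P p t ∂μ =
      ∑ j ∈ Finset.range (P.natDegree + 1), (∫ p, Real.exp (-q p) * (P.coeff j).1 p ∂μ) * t ^ j := by
    intro t
    simp_rw [← integral_mul_const]
    rw [← integral_finsetSum _ fun j _ => (hcoef _).mul_const _]
    refine integral_congr_ae (Eventually.of_forall fun p => ?_)
    simp only [polyVal_eq_sum, Finset.mul_sum, mul_assoc]
  have hsc : ∀ t, Continuous fun p => scaledIntegrand b Φ p t :=
    continuous_scaledIntegrand hbcont hΦcont
  have hRint : ∀ t : ℝ, t ≠ 0 → |t| ≤ 1 → Integrable (fun p => scaledIntegrand b Φ p t -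
      Real.exp (-q p) * polyVal P p t) μ := by
    intro t ht0 ht1
    refine (((hdom l).const_mul C).mul_const (|t| ^ (2 * r))).mono'
      ((hsc t).aestronglyMeasurable.sub (hpoly t).1) ?_
    filter_upwards [hmem] with p hp
    exact (hD p hp t ht0 ht1).trans_eq (by ring)
  have hscint : ∀ t : ℝ, t ≠ 0 → |t| ≤ 1 → Integrable (fun p => scaledIntegrand b Φ p t) μ :=
    fun t ht0 ht1 => ((hRint t ht0 ht1).add (hpoly t)).congr
      (Eventually.of_forall fun p => by simp)
  have hzero : ∀ t, ∀ p ∉ K ×ˢ (Set.univ : Set (E k)), scaledIntegrand b Φ p t = 0 := by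
    intro t p hp
    rw [scaledIntegrand, hbK (p.1, t • p.2) fun h => hp ⟨h, trivial⟩, zero_mul]
  have hfull : ∀ t, ∫ p, scaledIntegrand b Φ p t ∂μ = ∫ p, scaledIntegrand b Φ p t := fun t =>
    setIntegral_eq_integral_of_forall_compl_eq_zero (hzero t)
  have hfullint : ∀ t : ℝ, t ≠ 0 → |t| ≤ 1 → Integrable (fun p => scaledIntegrand b Φ p t) :=
    fun t ht0 ht1 => (integrableOn_iff_integrable_of_support_subset
      (Function.support_subset_iff'.2 (hzero t))).1 (hscint t ht0 ht1)
  set W : ℝ → ℝ := fun t => ∫ p, scaledIntegrand b Φ p t with hWdef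
  -- The reflection `ζ ↦ -ζ` of the fibre exchanges `t` and `-t`.
  have hWeven : ∀ t, W (-t) = W t := by
    intro t
    have := ((MeasurePreserving.id (volume : Measure (E m))).prod
      (Measure.measurePreserving_neg (volume : Measure (E k)))).integral_comp
      ((MeasurableEquiv.refl (E m)).prodCongr (MeasurableEquiv.neg (E k))).measurableEmbedding
      (fun p => scaledIntegrand b Φ p t)
    rw [hWdef]
    simp only
    rw [Measure.volume_eq_prod, ← this]
    refine integral_congr_ae (Eventually.of_forall fun p => ?_)
    simp [scaledIntegrand]
  have hlo : (fun t => W t - ∑ j ∈ Finset.range (P.natDegree + 1),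
      (∫ p, Real.exp (-q p) * (P.coeff j).1 p ∂μ) * t ^ j) =o[𝓝[≠] 0] fun t : ℝ => t ^ (2 * r) := by
    have hev : ∀ᶠ t : ℝ in 𝓝[≠] 0, t ≠ 0 ∧ |t| ≤ 1 := by
      have a1 : ∀ᶠ t : ℝ in 𝓝 0, |t| < 1 :=
        (continuous_abs.tendsto' 0 0 abs_zero).eventually_lt_const one_pos
      filter_upwards [self_mem_nhdsWithin, mem_nhdsWithin_of_mem_nhds a1] with t b1 b2
      exact ⟨b1, le_of_lt b2⟩
    have hne : ∀ᶠ t : ℝ in 𝓝[≠] 0, t ^ (2 * r) = 0 → W t - ∑ j ∈ Finset.range (P.natDegree + 1),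
      (∫ p, Real.exp (-q p) * (P.coeff j).1 p ∂μ) * t ^ j = 0 := by
      filter_upwards [hev] with t ht h
      exact absurd h (pow_ne_zero _ ht.1)
    rw [isLittleO_iff_tendsto' hne]
    have hlim : Tendsto (fun t => ∫ p, (scaledIntegrand b Φ p t -
        Real.exp (-q p) * polyVal P p t) / t ^ (2 * r) ∂μ) (𝓝[≠] 0) (𝓝 (∫ _, (0 : ℝ) ∂μ)) := by
      refine tendsto_integral_filter_of_dominated_convergence
        (fun p => C * ((1 + ‖p.2‖) ^ l * Real.exp (-(c * ‖p.2‖ ^ 2)))) ?_ ?_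
        ((hdom l).const_mul C) ?_
      · filter_upwards [hev] with t ht
        exact ((hRint t ht.1 ht.2).div_const _).1
      · filter_upwards [hev] with t ht
        filter_upwards [hmem] with p hp
        have : t ≠ 0 := ht.1
        rw [norm_div, norm_pow, Real.norm_eq_abs, Real.norm_eq_abs, div_le_iff₀ (by positivity)]
        exact (hD p hp t ht.1 ht.2).trans_eq (by ring)
      · filter_upwards [hmem] with p hp
        exact (hP p hp).tendsto_div_nhds_zero
    rw [integral_zero] at hlim
    refine hlim.congr' ?_
    filter_upwards [hev] with t ht
    rw [integral_div, integral_sub (hscint t ht.1 ht.2) (hpoly t), hpolyint, hfull]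
  -- The polynomial was only obtained abstractly; its constant term is found by letting `t → 0` in
  -- the pointwise expansion.
  have hcoeff0 : ∀ p : E m × E k, p.1 ∈ K → (P.coeff 0).1 p = b (p.1, 0) := by
    intro p hp
    have hz : Tendsto (fun t => scaledIntegrand b Φ p t - Real.exp (-q p) * polyVal P p t) (𝓝[≠] 0)
        (𝓝 0) := by
      have hn : (fun t : ℝ => t ^ (2 * r)) =O[𝓝[≠] 0] fun _ : ℝ => (1 : ℝ) :=
        ((((continuous_id (X := ℝ)).pow _).tendsto 0).mono_left nhdsWithin_le_nhds).isBigO_one ℝ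
      exact (isLittleO_one_iff ℝ).1 ((hP p hp).trans_isBigO hn)
    have h1 : Tendsto (fun t => scaledIntegrand b Φ p t) (𝓝[≠] 0)
        (𝓝 (b (p.1, 0) * Real.exp (-q p))) := by
      refine Tendsto.mul ?_ (Real.continuous_exp.tendsto _ |>.comp
        (tendsto_div_sq hΦ2 h0 hpos p).neg)
      have : Continuous fun t : ℝ => b (p.1, t • p.2) := by fun_prop
      exact (this.tendsto' 0 _ (by simp)).mono_left nhdsWithin_le_nhds
    have h2 : Tendsto (fun t => Real.exp (-q p) * polyVal P p t) (𝓝[≠] 0)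
        (𝓝 (Real.exp (-q p) * (P.coeff 0).1 p)) := by
      refine Tendsto.const_mul _ ?_
      refine ((continuous_polyVal P p).tendsto' 0 _ ?_).mono_left nhdsWithin_le_nhds
      rw [polyVal_eq_sum, Finset.sum_range_succ']
      simp
    have h3 := tendsto_nhds_unique hz (h1.sub h2)
    have he := (Real.exp_pos (-q p)).ne'
    have : Real.exp (-q p) * ((P.coeff 0).1 p - b (p.1, 0)) = 0 := by linarith
    exact sub_eq_zero.1 ((mul_eq_zero.1 this).resolve_left he)
  have hzero' : ∀ p ∉ K ×ˢ (Set.univ : Set (E k)), b (p.1, 0) * Real.exp (-q p) = 0 := by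
    intro p hp
    rw [hbK (p.1, 0) fun h => hp ⟨h, trivial⟩, zero_mul]
  have hae0 : (fun p => Real.exp (-q p) * (P.coeff 0).1 p) =ᵐ[μ]
      fun p => b (p.1, 0) * Real.exp (-q p) := by
    filter_upwards [hmem] with p hp
    rw [hcoeff0 p hp, mul_comm]
  refine ⟨(integrableOn_iff_integrable_of_support_subset
      (Function.support_subset_iff'.2 hzero')).1 ((hcoef (P.coeff 0)).congr hae0),
    fun i => ∫ p, Real.exp (-q p) * (P.coeff (2 * i)).1 p ∂μ, ?_, ?_⟩
  · simp only [mul_zero]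
    rw [integral_congr_ae hae0]
    exact setIntegral_eq_integral_of_forall_compl_eq_zero hzero'
  · have := hasAsymptotics_of_even (D := P.natDegree + 1)
      (w := fun j => ∫ p, Real.exp (-q p) * (P.coeff j).1 p ∂μ) hWeven (fun j hj => by
        simp [Polynomial.coeff_eq_zero_of_natDegree_lt (Nat.lt_of_succ_le hj)]) hlo
    refine IsLittleO.congr' this ?_ EventuallyEq.rfl
    filter_upwards [eventually_ge_atTop 1] with l hl
    have hl0 : 0 < l := by linarith
    have hs : 0 < (√l)⁻¹ := inv_pos.2 (Real.sqrt_pos.2 hl0)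
    have hs1 : (√l)⁻¹ ≤ 1 := inv_le_one_of_one_le₀ (Real.one_le_sqrt.2 hl)
    simp only [hWdef]
    rw [integral_scaledIntegrand hbcont hbc hΦcont hs
      (hfullint _ hs.ne' (by rwa [abs_of_pos hs]))]
    congr 2
    · rw [inv_pow, inv_inv, Real.sqrt_eq_rpow, ← Real.rpow_natCast, ← Real.rpow_mul hl0.le]
      congr 1; ring
    · refine integral_congr_ae (Eventually.of_forall fun p => ?_)
      simp only [inv_pow, Real.sq_sqrt hl0.le, div_inv_eq_mul, mul_comm]


/-! ### The area formula for immersions -/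

section Area

open scoped NNReal ENNReal

/-- The hypothesis forces `f` to factor through `g` on `B`, even if `g` is not injective, by a
`K`-Lipschitz map from `g '' B` onto `f '' B`. -/
theorem euclideanHausdorffMeasure_image_le {X Y Z : Type*} [EMetricSpace Y]
    [MeasurableSpace Y] [BorelSpace Y] [EMetricSpace Z] [MeasurableSpace Z] [BorelSpace Z]
    {f : X → Y} {g : X → Z} {B : Set X} {K : ℝ≥0} (m : ℕ)
    (h : ∀ x ∈ B, ∀ y ∈ B, edist (f x) (f y) ≤ K * edist (g x) (g y)) :
    μHE[m] (f '' B) ≤ (K : ℝ≥0∞) ^ m * μHE[m] (g '' B) := by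
  rcases B.eq_empty_or_nonempty with rfl | ⟨x₀, hx₀⟩
  · simp
  have : Nonempty X := ⟨x₀⟩
  set i := Function.invFunOn g B
  have hi : ∀ x ∈ B, i (g x) ∈ B ∧ g (i (g x)) = g x := fun x hx =>
    ⟨Function.invFunOn_mem ⟨x, hx, rfl⟩, Function.invFunOn_eq ⟨x, hx, rfl⟩⟩
  have hlip : LipschitzOnWith K (f ∘ i) (g '' B) := by
    rintro _ ⟨x, hx, rfl⟩ _ ⟨y, hy, rfl⟩
    have := h _ (hi x hx).1 _ (hi y hy).1
    rwa [(hi x hx).2, (hi y hy).2] at this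
  have himage : (f ∘ i) '' (g '' B) = f '' B := by
    rw [Set.image_image]
    refine Set.image_congr fun x hx => ?_
    have := h _ (hi x hx).1 _ hx
    rw [(hi x hx).2, edist_self, mul_zero, nonpos_iff_eq_zero, edist_eq_zero] at this
    exact this
  rw [← himage, Measure.euclideanHausdorffMeasure_def, Measure.euclideanHausdorffMeasure_def,
    Measure.smul_apply, Measure.smul_apply, mul_smul_comm]
  gcongr
  have := hlip.hausdorffMeasure_image_le (d := m) (Nat.cast_nonneg m)
  simpa using this

theorem continuous_normDet {m d : ℕ} :
    Continuous fun L : E m →L[ℝ] E d => L.toLinearMap.normDet := by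
  have h : (fun L : E m →L[ℝ] E d => L.toLinearMap.normDet) =
      fun L : E m →L[ℝ] E d => √((ContinuousLinearMap.adjoint L ∘L L).det) := by
    ext L
    have := L.normDet_sq
    simp only [RCLike.ofReal_real_eq_id, id] at this
    rw [← this, Real.sqrt_sq (LinearMap.normDet_nonneg _)]
  rw [h]
  have h1 : Continuous fun L : E m →L[ℝ] E d => ContinuousLinearMap.adjoint L :=
    (ContinuousLinearMap.adjoint (𝕜 := ℝ) (E := E m) (F := E d)).continuous
  exact Real.continuous_sqrt.comp
    (ContinuousLinearMap.continuous_det.comp (h1.clm_comp continuous_id))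

/-- Near `y₀` the map `φ` and its derivative `L` at `y₀` change distances by the same amount up to a
factor `s`, and `L` scales the measure by exactly its Jacobian. Of the `m + 1` factors `s`, `m` come
from the Lipschitz comparison and one from the variation of the Jacobian. -/
theorem exists_area_le {m d : ℕ} {φ : E m → E d} {y₀ : E m} (hφ : ContDiffAt ℝ 1 φ y₀)
    (hL : Function.Injective (fderiv ℝ φ y₀)) {s : ℝ} (hs : 1 < s) :
    ∃ V ∈ 𝓝 y₀, ∀ B ⊆ V, MeasurableSet B →
      μHE[m] (φ '' B) ≤ ENNReal.ofReal s ^ (m + 1) *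
        ∫⁻ y in B, ENNReal.ofReal (fderiv ℝ φ y).toLinearMap.normDet ∧
      ∫⁻ y in B, ENNReal.ofReal (fderiv ℝ φ y).toLinearMap.normDet ≤
        ENNReal.ofReal s ^ (m + 1) * μHE[m] (φ '' B) := by
  set L := fderiv ℝ φ y₀ with hLdef
  set J : E m → ℝ := fun y => (fderiv ℝ φ y).toLinearMap.normDet with hJ
  have hs0 : 0 < s := by linarith
  have hJ0 : 0 < J y₀ := by
    refine lt_of_le_of_ne (LinearMap.normDet_nonneg _) (Ne.symm ?_)
    exact ((LinearMap.normDet_ne_zero_tfae L.toLinearMap).out 4 0).1 hL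
  have hJc : ContinuousAt J y₀ := by
    have : ContinuousAt (fderiv ℝ φ) y₀ := (hφ.fderiv_right (m := 0) (by norm_num)).continuousAt
    exact continuous_normDet.continuousAt.comp this
  obtain ⟨κ, hκ, hanti⟩ : ∃ κ : ℝ, 0 < κ ∧ ∀ x, κ * ‖x‖ ≤ ‖L x‖ := by
    obtain ⟨K, hK, h⟩ := L.toLinearMap.exists_antilipschitzWith (LinearMap.ker_eq_bot.2 hL)
    refine ⟨(K : ℝ)⁻¹, by positivity, fun x => ?_⟩
    have := h.le_mul_dist x 0
    rw [inv_mul_le_iff₀ (by positivity)]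
    simpa using this
  -- Makes the linearization error at most `(s - 1)‖L x‖` and at most `(1 - s⁻¹)‖L x‖`, as the upper
  -- and the lower comparison require.
  set c := κ * min (s - 1) (1 - s⁻¹) with hc
  have hs1 : s⁻¹ < 1 := inv_lt_one_of_one_lt₀ hs
  have hc0 : 0 < c := mul_pos hκ (lt_min (by linarith) (by linarith))
  have hstrict : HasStrictFDerivAt φ L y₀ := hφ.hasStrictFDerivAt (by norm_num)
  obtain ⟨V₁, hV₁, hV₁L⟩ := hstrict.approximates_deriv_on_nhds (c := ⟨c, hc0.le⟩) (Or.inr hc0)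
  have hJ1 : ∀ᶠ y in 𝓝 y₀, J y₀ < s * J y :=
    ((hJc.const_mul s).tendsto).eventually_const_lt (by show J y₀ < s * J y₀; nlinarith)
  have hJ2 : ∀ᶠ y in 𝓝 y₀, J y < s * J y₀ :=
    hJc.tendsto.eventually_lt_const (by nlinarith)
  have hmul : ENNReal.ofReal s = ((Real.toNNReal s : ℝ≥0) : ℝ≥0∞) := rfl
  have hdist : ∀ x y : E m, edist (L x) (L y) = ENNReal.ofReal ‖L (x - y)‖ := fun x y => by
    rw [edist_dist, dist_eq_norm, map_sub]
  refine ⟨V₁ ∩ {y | J y₀ < s * J y ∧ J y < s * J y₀}, inter_mem hV₁ (hJ1.and hJ2),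
    fun B hB hBm => ?_⟩
  have hup : ∀ x ∈ B, ∀ y ∈ B, edist (φ x) (φ y) ≤ (Real.toNNReal s : ℝ≥0) * edist (L x) (L y) := by
    intro x hx y hy
    rw [hdist, edist_dist, ← hmul, ← ENNReal.ofReal_mul hs0.le, dist_eq_norm]
    refine ENNReal.ofReal_le_ofReal ?_
    have h1 : ‖φ x - φ y - L (x - y)‖ ≤ c * ‖x - y‖ := hV₁L x (hB hx).1 y (hB hy).1
    have h2 : c * ‖x - y‖ ≤ (s - 1) * ‖L (x - y)‖ := by
      calc c * ‖x - y‖ ≤ κ * (s - 1) * ‖x - y‖ := by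
            rw [hc]; gcongr; exact min_le_left _ _
        _ = (s - 1) * (κ * ‖x - y‖) := by ring
        _ ≤ _ := mul_le_mul_of_nonneg_left (hanti _) (by linarith)
    have h3 := norm_add_le (φ x - φ y - L (x - y)) (L (x - y))
    rw [sub_add_cancel] at h3
    linarith
  have hdown : ∀ x ∈ B, ∀ y ∈ B, edist (L x) (L y) ≤
      (Real.toNNReal s : ℝ≥0) * edist (φ x) (φ y) := by
    intro x hx y hy
    rw [hdist, edist_dist, ← hmul, ← ENNReal.ofReal_mul hs0.le, dist_eq_norm]
    refine ENNReal.ofReal_le_ofReal ?_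
    have h1 : ‖φ x - φ y - L (x - y)‖ ≤ c * ‖x - y‖ := hV₁L x (hB hx).1 y (hB hy).1
    have h2 : c * ‖x - y‖ ≤ (1 - s⁻¹) * ‖L (x - y)‖ := by
      calc c * ‖x - y‖ ≤ κ * (1 - s⁻¹) * ‖x - y‖ := by
            rw [hc]; gcongr; exact min_le_right _ _
        _ = (1 - s⁻¹) * (κ * ‖x - y‖) := by ring
        _ ≤ _ := mul_le_mul_of_nonneg_left (hanti _) (by linarith)
    have h3 := norm_sub_le (φ x - φ y) (φ x - φ y - L (x - y))
    rw [sub_sub_cancel] at h3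
    have h4 : s⁻¹ * ‖L (x - y)‖ ≤ ‖φ x - φ y‖ := by linarith
    rwa [inv_mul_le_iff₀ hs0] at h4
  have hlin : μHE[m] (L '' B) = ENNReal.ofReal (J y₀) * volume B := by
    have := L.toLinearMap.euclideanHausdorffMeasure_image_eq_normDet_mul_volume B
    rw [finrank_euclideanSpace, Fintype.card_fin] at this
    exact this
  have hconst : ∀ a : ℝ≥0∞, ∫⁻ _ in B, a = a * volume B := fun a => by simp
  refine ⟨?_, ?_⟩
  · refine (euclideanHausdorffMeasure_image_le m hup).trans ?_
    rw [hlin, ← hmul, pow_succ, mul_assoc]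
    refine mul_le_mul_right ?_ _
    rw [← hconst, ← lintegral_const_mul' _ _ ENNReal.ofReal_ne_top]
    refine setLIntegral_mono' hBm fun y hy => ?_
    rw [← ENNReal.ofReal_mul hs0.le]
    exact ENNReal.ofReal_le_ofReal (hB hy).2.1.le
  · have h1 := euclideanHausdorffMeasure_image_le m hdown
    rw [hlin, ← hmul] at h1
    calc ∫⁻ y in B, ENNReal.ofReal (J y) ≤ ∫⁻ y in B, ENNReal.ofReal s * ENNReal.ofReal (J y₀) := by
          refine setLIntegral_mono' hBm fun y hy => ?_
          rw [← ENNReal.ofReal_mul hs0.le]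
          exact ENNReal.ofReal_le_ofReal (hB hy).2.2.le
      _ = ENNReal.ofReal s * (ENNReal.ofReal (J y₀) * volume B) := by rw [hconst, mul_assoc]
      _ ≤ ENNReal.ofReal s * (ENNReal.ofReal s ^ m * μHE[m] (φ '' B)) := by gcongr
      _ = _ := by rw [pow_succ]; ring

/-- The area formula for an injective immersion. -/
theorem euclideanHausdorffMeasure_image {m d : ℕ} {φ : E m → E d} {U : Set (E m)} (hU : IsOpen U)
    (hφ : ContDiffOn ℝ 1 φ U) (hinj : Set.InjOn φ U)
    (hL : ∀ y ∈ U, Function.Injective (fderiv ℝ φ y)) {B : Set (E m)} (hBU : B ⊆ U)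
    (hB : MeasurableSet B) :
    μHE[m] (φ '' B) = ∫⁻ y in B, ENNReal.ofReal (fderiv ℝ φ y).toLinearMap.normDet := by
  set J : E m → ℝ≥0∞ := fun y => ENNReal.ofReal (fderiv ℝ φ y).toLinearMap.normDet with hJ
  have hmeas : ∀ C ⊆ U, MeasurableSet C → MeasurableSet (φ '' C) := fun C hC hCm =>
    hCm.image_of_continuousOn_injOn (hφ.continuousOn.mono hC) (hinj.mono hC)
  have key : ∀ s : ℝ, 1 < s → μHE[m] (φ '' B) ≤ ENNReal.ofReal s ^ (m + 1) * ∫⁻ y in B, J y ∧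
      ∫⁻ y in B, J y ≤ ENNReal.ofReal s ^ (m + 1) * μHE[m] (φ '' B) := by
    intro s hs
    choose! V hV hVB using fun y (hy : y ∈ U) =>
      exists_area_le (hφ.contDiffAt (hU.mem_nhds hy)) (hL y hy) hs
    obtain ⟨t, htU, htc, ht⟩ := TopologicalSpace.countable_cover_nhdsWithin
      (f := fun y => interior (V y)) (s := U)
      (fun y hy => mem_nhdsWithin_of_mem_nhds (interior_mem_nhds.2 (hV y hy)))
    rcases t.eq_empty_or_nonempty with rfl | hne
    · have : B = ∅ := Set.subset_eq_empty (hBU.trans ht) (by simp)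
      simp [this]
    obtain ⟨f, hf⟩ := htc.exists_eq_range hne
    -- A countable subcover made disjoint; injectivity of `φ` keeps the images disjoint, so the
    -- local inequalities add up.
    set D : ℕ → Set (E m) := disjointed fun n => interior (V (f n)) with hD
    have hDm : ∀ n, MeasurableSet (D n) :=
      MeasurableSet.disjointed fun n => isOpen_interior.measurableSet
    have hcover : B = ⋃ n, B ∩ D n := by
      rw [← Set.inter_iUnion, hD, iUnion_disjointed, eq_comm, Set.inter_eq_left]
      refine (hBU.trans ht).trans ?_
      rw [hf]
      simp
    have hdisj : Pairwise (Function.onFun Disjoint fun n => B ∩ D n) := fun i j hij =>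
      ((disjoint_disjointed _ hij).mono Set.inter_subset_right Set.inter_subset_right)
    have hint : ∫⁻ y in B, J y = ∑' n, ∫⁻ y in B ∩ D n, J y := by
      conv_lhs => rw [hcover]
      exact lintegral_iUnion (fun n => hB.inter (hDm n)) hdisj _
    have hmu : μHE[m] (φ '' B) = ∑' n, μHE[m] (φ '' (B ∩ D n)) := by
      conv_lhs => rw [hcover, Set.image_iUnion]
      refine measure_iUnion (fun i j hij => ?_) fun n =>
        hmeas _ (Set.inter_subset_left.trans hBU) (hB.inter (hDm n))
      exact Set.disjoint_image_image fun x hx y hy hxy => by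
        have := hinj (hBU hx.1) (hBU hy.1) hxy
        exact (hdisj hij).ne_of_mem hx hy this
    have hloc : ∀ n, _ := fun n => hVB (f n) (htU (hf ▸ Set.mem_range_self n)) (B ∩ D n)
      (fun x hx => interior_subset (disjointed_subset (fun n => interior (V (f n))) n hx.2)) (hB.inter (hDm n))
    rw [hint, hmu, ← ENNReal.tsum_mul_left, ← ENNReal.tsum_mul_left]
    exact ⟨ENNReal.tsum_le_tsum fun n => (hloc n).1, ENNReal.tsum_le_tsum fun n => (hloc n).2⟩
  -- The distortion `s` was arbitrary; equality follows by letting it decrease to `1`.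
  have hlim : ∀ a : ℝ≥0∞, Tendsto (fun s : ℝ => ENNReal.ofReal s ^ (m + 1) * a) (𝓝[>] 1) (𝓝 a) := by
    intro a
    have h1 : Tendsto (fun s : ℝ => ENNReal.ofReal s ^ (m + 1)) (𝓝[>] 1) (𝓝 1) := by
      have : Continuous fun s : ℝ => ENNReal.ofReal s ^ (m + 1) :=
        (ENNReal.continuous_pow _).comp ENNReal.continuous_ofReal
      simpa using (this.tendsto 1).mono_left nhdsWithin_le_nhds
    simpa using ENNReal.Tendsto.mul_const h1 (Or.inl one_ne_zero) (b := a)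
  refine le_antisymm ?_ ?_
  · exact ge_of_tendsto (hlim _) (by filter_upwards [self_mem_nhdsWithin] with s hs using (key s hs).1)
  · exact ge_of_tendsto (hlim _) (by filter_upwards [self_mem_nhdsWithin] with s hs using (key s hs).2)

theorem restrict_image_eq_map {m d : ℕ} {φ : E m → E d} {U : Set (E m)} (hU : IsOpen U)
    (hφ : ContDiffOn ℝ 1 φ U) (hinj : Set.InjOn φ U)
    (hL : ∀ y ∈ U, Function.Injective (fderiv ℝ φ y)) :
    (μHE[m] : Measure (E d)).restrict (φ '' U) = Measure.map φ ((volume.restrict U).withDensity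
      fun y => ENNReal.ofReal (fderiv ℝ φ y).toLinearMap.normDet) := by
  have hφm : AEMeasurable φ (volume.restrict U) :=
    hφ.continuousOn.aemeasurable hU.measurableSet
  have hφm' : AEMeasurable φ ((volume.restrict U).withDensity
      fun y => ENNReal.ofReal (fderiv ℝ φ y).toLinearMap.normDet) :=
    hφm.mono_ac (withDensity_absolutelyContinuous _ _)
  ext S hS
  have hpre : MeasurableSet (U ∩ φ ⁻¹' S) := by
    have h := (continuousOn_iff_continuous_domRestrict.1 hφ.continuousOn).measurable hS
    have h' := hU.measurableSet.subtype_image h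
    rwa [Set.domRestrict_eq, Set.preimage_comp, Subtype.image_preimage_coe] at h'
  have himg : S ∩ φ '' U = φ '' (U ∩ φ ⁻¹' S) := by
    rw [Set.image_inter_preimage, Set.inter_comm]
  rw [Measure.restrict_apply hS, himg,
    euclideanHausdorffMeasure_image hU hφ hinj hL Set.inter_subset_left hpre,
    Measure.map_apply_of_aemeasurable hφm' hS]
  have hnull : NullMeasurableSet (φ ⁻¹' S) (volume.restrict U) := hφm.nullMeasurableSet_preimage hS
  rw [withDensity_apply₀ _ hnull, Measure.restrict_restrict₀ hnull, Set.inter_comm]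

end Area


/-! ### The density of a homogeneous function of a Gaussian vector -/

section Density

open scoped NNReal ENNReal

/-- The density of the standard Gaussian law on `ℝ^d`. -/
noncomputable def gaussianDensity (d : ℕ) (x : E d) : ℝ :=
  (2 * Real.pi) ^ (-(d : ℝ) / 2) * Real.exp (-‖x‖ ^ 2 / 2)

theorem gaussianDensity_nonneg {d : ℕ} (x : E d) : 0 ≤ gaussianDensity d x := by
  unfold gaussianDensity; positivity

theorem measurable_gaussianDensity (d : ℕ) : Measurable (gaussianDensity d) := by
  unfold gaussianDensity; fun_prop

theorem integrable_gaussianDensity (d : ℕ) : Integrable (gaussianDensity d) := by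
  have := (integrable_pow_mul_gaussian (k := d) (c := 1 / 2) (by norm_num) 0).const_mul
    ((2 * Real.pi) ^ (-(d : ℝ) / 2))
  refine this.congr (Eventually.of_forall fun x => ?_)
  simp only [gaussianDensity, pow_zero, one_mul]
  congr 2; ring

/-- Both measures are finite and have the same characteristic function. -/
theorem stdGaussian_eq_withDensity (d : ℕ) :
    stdGaussian (E d) = volume.withDensity fun x => ENNReal.ofReal (gaussianDensity d x) := by
  have hfin : IsFiniteMeasure
      ((volume : Measure (E d)).withDensity fun x => ENNReal.ofReal (gaussianDensity d x)) :=
    isFiniteMeasure_withDensity_ofReal (integrable_gaussianDensity d).2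
  refine Measure.ext_of_charFun ?_
  ext t
  rw [charFun_stdGaussian, charFun_apply, integral_withDensity_eq_integral_toReal_smul
    (measurable_gaussianDensity d).ennreal_ofReal (Eventually.of_forall fun _ => ENNReal.ofReal_lt_top)]
  have h := GaussianFourier.integral_cexp_neg_mul_sq_norm_add (V := E d) (b := (1 / 2 : ℂ))
    (by norm_num) Complex.I t
  have hpi : (0 : ℝ) < 2 * Real.pi := by positivity
  have e : ∀ x : E d, (ENNReal.ofReal (gaussianDensity d x)).toReal •
      Complex.exp (inner ℝ x t * Complex.I) = (((2 * Real.pi) ^ (-(d : ℝ) / 2) : ℝ) : ℂ) *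
        Complex.exp (-(1 / 2 : ℂ) * ‖x‖ ^ 2 + Complex.I * inner ℝ t x) := by
    intro x
    rw [ENNReal.toReal_ofReal (gaussianDensity_nonneg x), gaussianDensity, Complex.real_smul,
      Complex.exp_add]
    push_cast
    rw [real_inner_comm, mul_assoc]
    congr 3
    · ring
    · ring
  simp_rw [e]
  rw [integral_const_mul, h, finrank_euclideanSpace, Fintype.card_fin]
  have e2 : ((Real.pi : ℂ) / (1 / 2)) ^ ((d : ℂ) / 2) =
      (((2 * Real.pi) ^ ((d : ℝ) / 2) : ℝ) : ℂ) := by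
    rw [Complex.ofReal_cpow hpi.le]
    push_cast
    congr 1
    ring
  rw [e2, ← mul_assoc, ← Complex.ofReal_mul, ← Real.rpow_add hpi,
    show -(d : ℝ) / 2 + (d : ℝ) / 2 = 0 by ring, Real.rpow_zero, Complex.ofReal_one, one_mul]
  congr 1
  rw [Complex.I_sq]; ring

theorem map_eq_withDensity {d : ℕ} {Ω : Type*} [MeasurableSpace Ω] {P : Measure Ω}
    {η : Ω → E d} (hη : ∀ i, HasLaw (fun ω => η ω i) (gaussianReal 0 1) P)
    (hind : iIndepFun (fun i ω => η ω i) P) :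
    AEMeasurable η P ∧
      P.map η = volume.withDensity fun x => ENNReal.ofReal (gaussianDensity d x) := by
  have : IsProbabilityMeasure P := hind.isProbabilityMeasure
  have hm : ∀ i, AEMeasurable (fun ω => η ω i) P := fun i => (hη i).aemeasurable
  have hpi : AEMeasurable (fun ω i => η ω i) P := aemeasurable_pi_lambda _ hm
  have hηe : η = fun ω => WithLp.toLp 2 (fun i => η ω i) := rfl
  have htl : Measurable (WithLp.toLp 2 : (Fin d → ℝ) → E d) := by fun_prop
  have hmap := (iIndepFun_iff_map_fun_eq_pi_map hm).1 hind
  simp_rw [(hη _).map_eq] at hmap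
  refine ⟨hηe ▸ htl.comp_aemeasurable hpi, ?_⟩
  rw [← stdGaussian_eq_withDensity, ← map_pi_eq_stdGaussian, ← hmap,
    AEMeasurable.map_map_of_aemeasurable htl.aemeasurable hpi]
  rfl

/-- Integration in polar coordinates. -/
theorem lintegral_eq_lintegral_sphere {d : ℕ} (hd : 0 < d) {f : E d → ℝ≥0∞} (hf : Measurable f) :
    ∫⁻ x, f x = ∫⁻ v : Metric.sphere (0 : E d) 1, (∫⁻ t in Set.Ioi (0 : ℝ),
      ENNReal.ofReal (t ^ (d - 1)) * f (t • (v : E d))) ∂(volume : Measure (E d)).toSphere := by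
  have : Nontrivial (E d) := by
    have : Nonempty (Fin d) := ⟨⟨0, hd⟩⟩
    infer_instance
  have h1 : ∫⁻ x, f x = ∫⁻ x : ({(0 : E d)}ᶜ : Set (E d)), f (x : E d)
      ∂((volume : Measure (E d)).comap Subtype.val) := by
    rw [lintegral_subtype_comap (measurableSet_singleton _).compl f, restrict_compl_singleton]
  have h2 := (volume : Measure (E d)).measurePreserving_homeomorphUnitSphereProd.lintegral_comp_emb
    (Homeomorph.measurableEmbedding _)
    (fun p => f ((p.2 : ℝ) • (p.1 : E d)))
  have h3 : ∀ x : ({(0 : E d)}ᶜ : Set (E d)), f (((homeomorphUnitSphereProd (E d) x).2 : ℝ) •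
      ((homeomorphUnitSphereProd (E d) x).1 : E d)) = f x := by
    intro x
    have hx : ‖(x : E d)‖ ≠ 0 := norm_ne_zero_iff.2 x.2
    simp [homeomorphUnitSphereProd, smul_smul, hx]
  simp_rw [h3] at h2
  have hm : Measurable fun p : Metric.sphere (0 : E d) 1 × Set.Ioi (0 : ℝ) =>
      f ((p.2 : ℝ) • (p.1 : E d)) := by
    refine hf.comp ?_
    fun_prop
  rw [h1, h2, lintegral_prod _ hm.aemeasurable]
  refine lintegral_congr fun v => ?_
  rw [finrank_euclideanSpace, Fintype.card_fin, Measure.volumeIoiPow,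
    lintegral_withDensity_eq_lintegral_mul _ (by fun_prop) (by fun_prop),
    ← lintegral_subtype_comap measurableSet_Ioi]
  rfl

/-- `s ^ (d / α) exp (-s ^ (2 / α) / 2)` for `s = x / c`, `c > 0`. -/
noncomputable def radialKernel (d : ℕ) (α x c : ℝ) : ℝ :=
  if 0 < c then (x / c) ^ ((d : ℝ) / α) * Real.exp (-(x / c) ^ (2 / α) / 2) else 0

theorem measurable_radialKernel (d : ℕ) (α : ℝ) :
    Measurable fun p : ℝ × ℝ => radialKernel d α p.1 p.2 := by
  unfold radialKernel
  refine Measurable.ite (measurableSet_lt measurable_const measurable_snd) ?_ measurable_const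
  fun_prop

theorem radialKernel_nonneg {d : ℕ} {α x c : ℝ} (hx : 0 < x) : 0 ≤ radialKernel d α x c := by
  unfold radialKernel
  split_ifs with h
  · positivity
  · exact le_rfl

/-- In terms of `w = (x/c)^(2/α)` the kernel is `w^(d/2) e^(-w/2)`, which is bounded on the
half-line. A bound uniform in `x` and `c` gives integrability over the sphere and dominated
convergence in `x`. -/
theorem exists_radialKernel_le (d : ℕ) (α : ℝ) :
    ∃ C, ∀ x c : ℝ, 0 < x → radialKernel d α x c ≤ C := by
  refine ⟨2 ^ d * d.factorial * Real.exp (1 / 2), fun x c hx => ?_⟩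
  unfold radialKernel
  split_ifs with h
  · have hs : 0 < x / c := by positivity
    set w := (x / c) ^ (2 / α) with hw
    have hw0 : 0 < w := by positivity
    have e : (x / c) ^ ((d : ℝ) / α) = w ^ ((d : ℝ) / 2) := by
      rw [hw, ← Real.rpow_mul hs.le]; congr 1; ring
    have h1 := Real.pow_div_factorial_le_exp ((1 + w) / 2) (by positivity) d
    rw [div_le_iff₀ (by positivity), div_pow, div_le_iff₀ (by positivity)] at h1
    have h2 : w ^ ((d : ℝ) / 2) ≤ (1 + w) ^ d := by
      calc w ^ ((d : ℝ) / 2) ≤ (1 + w) ^ ((d : ℝ) / 2) := by gcongr; linarith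
        _ ≤ (1 + w) ^ (d : ℝ) := by
            refine Real.rpow_le_rpow_of_exponent_le (by linarith) ?_
            linarith [(Nat.cast_nonneg d : (0 : ℝ) ≤ d)]
        _ = _ := Real.rpow_natCast _ _
    rw [e]
    calc _ ≤ Real.exp ((1 + w) / 2) * d.factorial * 2 ^ d * Real.exp (-w / 2) := by
          gcongr; exact h2.trans h1
      _ = 2 ^ d * d.factorial * (Real.exp ((1 + w) / 2) * Real.exp (-w / 2)) := by ring
      _ = _ := by rw [← Real.exp_add]; congr 2; ring
  · positivity

/-- The density on `(0, ∞)` of a homogeneous function of a standard Gaussian vector. -/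
noncomputable def chaosDensity {d : ℕ} (g : E d → ℝ) (α x : ℝ) : ℝ :=
  (2 * Real.pi) ^ (-(d : ℝ) / 2) / (α * x) *
    ∫ v : Metric.sphere (0 : E d) 1, radialKernel d α x (g v) ∂(volume : Measure (E d)).toSphere

variable {d : ℕ} {g : E d → ℝ} {α : ℝ}

theorem integrable_radialKernel (hg : Measurable g) (α : ℝ) {x : ℝ} (hx : 0 < x) :
    Integrable (fun v : Metric.sphere (0 : E d) 1 => radialKernel d α x (g v))
      (volume : Measure (E d)).toSphere := by
  obtain ⟨C, hC⟩ := exists_radialKernel_le d α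
  refine (integrable_const C).mono' ?_ (Eventually.of_forall fun v => ?_)
  · exact ((measurable_radialKernel d α).comp
      (measurable_const.prodMk (hg.comp measurable_subtype_coe))).aestronglyMeasurable
  · rw [Real.norm_of_nonneg (radialKernel_nonneg hx)]
    exact hC x _ hx

theorem chaosDensity_nonneg (hα : 0 < α) {x : ℝ} (hx : 0 < x) : 0 ≤ chaosDensity g α x :=
  mul_nonneg (by positivity) (integral_nonneg fun _ => radialKernel_nonneg hx)

theorem measurable_chaosDensity (hg : Measurable g) (α : ℝ) : Measurable (chaosDensity g α) := by
  unfold chaosDensity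
  refine Measurable.mul (by fun_prop) ?_
  have h : Measurable fun p : ℝ × Metric.sphere (0 : E d) 1 => radialKernel d α p.1 (g p.2) :=
    (measurable_radialKernel d α).comp
      (measurable_fst.prodMk (hg.comp (measurable_subtype_coe.comp measurable_snd)))
  exact (h.stronglyMeasurable.integral_prod_right).measurable

theorem continuousOn_chaosDensity (hg : Measurable g) (hα : 0 < α) :
    ContinuousOn (chaosDensity g α) (Set.Ioi 0) := by
  unfold chaosDensity
  refine ContinuousOn.mul (continuousOn_const.div (by fun_prop) fun x hx => ?_) ?_
  · exact (mul_pos hα hx).ne'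
  obtain ⟨C, hC⟩ := exists_radialKernel_le d α
  refine continuousOn_of_dominated (bound := fun _ => C) (fun x hx => ?_) (fun x hx => ?_)
    (integrable_const C) (Eventually.of_forall fun v => ?_)
  · exact (integrable_radialKernel hg α hx).1
  · refine Eventually.of_forall fun v => ?_
    rw [Real.norm_of_nonneg (radialKernel_nonneg hx)]
    exact hC x _ hx
  · unfold radialKernel
    split_ifs with h
    · intro x hx
      have hs : 0 < x / g v := div_pos hx h
      have h1 : ContinuousAt (fun x => x / g v) x := by fun_prop
      refine ContinuousAt.continuousWithinAt (ContinuousAt.mul ?_ ?_)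
      · exact h1.rpow_const (Or.inl hs.ne')
      · exact Real.continuous_exp.continuousAt.comp
          ((h1.rpow_const (Or.inl hs.ne')).neg.div_const 2)
    · exact continuousOn_const

/-- The substitution `x = t^α c` on a single ray, where `c` is the value of `g` at its direction.
Rays with `c ≤ 0` never reach the positive set `B`, in agreement with the value zero of
`radialKernel`. -/
theorem lintegral_radial_eq (hα : 0 < α) (hd : 0 < d) (c : ℝ) {B : Set ℝ} (hB : MeasurableSet B)
    (hB0 : B ⊆ Set.Ioi 0) :
    ∫⁻ t in Set.Ioi (0 : ℝ), ENNReal.ofReal (t ^ (d - 1)) * (B.indicator 1 (t ^ α * c) *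
      ENNReal.ofReal ((2 * Real.pi) ^ (-(d : ℝ) / 2) * Real.exp (-t ^ 2 / 2))) =
    ∫⁻ x in B, ENNReal.ofReal ((2 * Real.pi) ^ (-(d : ℝ) / 2) / (α * x) * radialKernel d α x c) := by
  rcases le_or_gt c 0 with hc | hc
  · have h1 : ∫⁻ t in Set.Ioi (0 : ℝ), ENNReal.ofReal (t ^ (d - 1)) * (B.indicator 1 (t ^ α * c) *
      ENNReal.ofReal ((2 * Real.pi) ^ (-(d : ℝ) / 2) * Real.exp (-t ^ 2 / 2))) =
      ∫⁻ t in Set.Ioi (0 : ℝ), 0 := by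
      refine setLIntegral_congr_fun measurableSet_Ioi fun t ht => ?_
      have : t ^ α * c ∉ B := fun h => by
        have h' : 0 < t ^ α * c := hB0 h
        have := Real.rpow_pos_of_pos ht α
        nlinarith
      simp [this]
    rw [h1]
    simp [radialKernel, not_lt.2 hc]
  · set f : ℝ → ℝ := fun x => (x / c) ^ (1 / α) with hf
    have hder : ∀ x ∈ Set.Ioi (0 : ℝ), HasDerivWithinAt f (f x / (α * x)) (Set.Ioi 0) x := by
      intro x hx
      have hx0 : x ≠ 0 := (Set.mem_Ioi.1 hx).ne'
      have hs : 0 < x / c := div_pos hx hc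
      have h := ((hasDerivAt_id x).div_const c).rpow_const (p := 1 / α) (Or.inl hs.ne')
      refine (h.congr_deriv ?_).hasDerivWithinAt
      simp only [hf, id]
      rw [Real.rpow_sub_one hs.ne']
      field_simp
    have hinj : Set.InjOn f (Set.Ioi 0) := by
      intro x hx y hy hxy
      have hx' : 0 < x / c := div_pos hx hc
      have hy' : 0 < y / c := div_pos hy hc
      have := Real.rpow_left_injOn (x := 1 / α) (by positivity) hx'.le hy'.le hxy
      exact (div_left_inj' hc.ne').1 this
    have himg : f '' Set.Ioi 0 = Set.Ioi 0 := by
      ext t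
      constructor
      · rintro ⟨x, hx, rfl⟩
        exact Real.rpow_pos_of_pos (div_pos hx hc) _
      · intro ht
        have ht' : (0 : ℝ) < t := ht
        refine ⟨t ^ α * c, mul_pos (Real.rpow_pos_of_pos ht' _) hc, ?_⟩
        simp only [hf]
        rw [mul_div_cancel_right₀ _ hc.ne', ← Real.rpow_mul ht'.le, mul_one_div_cancel hα.ne',
          Real.rpow_one]
    rw [← himg, lintegral_image_eq_lintegral_abs_deriv_mul measurableSet_Ioi hder hinj]
    have hBi : ∫⁻ x in B, ENNReal.ofReal ((2 * Real.pi) ^ (-(d : ℝ) / 2) / (α * x) *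
        radialKernel d α x c) = ∫⁻ x in Set.Ioi 0, B.indicator (fun x => ENNReal.ofReal
          ((2 * Real.pi) ^ (-(d : ℝ) / 2) / (α * x) * radialKernel d α x c)) x := by
      rw [setLIntegral_indicator hB, Set.inter_eq_left.2 hB0]
    rw [hBi]
    refine setLIntegral_congr_fun measurableSet_Ioi fun x hx => ?_
    have hx0 : (0 : ℝ) < x := hx
    have hs : 0 < x / c := div_pos hx hc
    have hfp : 0 < f x := Real.rpow_pos_of_pos hs _
    have e1 : f x ^ α * c = x := by
      simp only [hf]
      rw [← Real.rpow_mul hs.le, one_div_mul_cancel hα.ne', Real.rpow_one, div_mul_cancel₀ _ hc.ne']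
    simp only [e1]
    by_cases hxB : x ∈ B
    · simp only [Set.indicator_of_mem hxB, Pi.one_apply, one_mul]
      rw [← ENNReal.ofReal_mul (by positivity), ← ENNReal.ofReal_mul (by positivity)]
      congr 1
      rw [abs_of_pos (by positivity), radialKernel, if_pos hc]
      have e2 : (x / c) ^ ((d : ℝ) / α) = f x ^ (d - 1) * f x := by
        rw [← pow_succ, Nat.sub_add_cancel hd, hf, ← Real.rpow_natCast, ← Real.rpow_mul hs.le]
        congr 1; ring
      have e3 : (x / c) ^ (2 / α) = f x ^ 2 := by
        rw [hf, ← Real.rpow_natCast, ← Real.rpow_mul hs.le]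
        congr 1; push_cast; ring
      rw [e2, e3]
      ring
    · simp [hxB]

/-- Polar coordinates, the radial substitution on each ray, and Tonelli to bring the integral over
`x` outside. -/
theorem withDensity_preimage_eq (hg : Measurable g) (hα : 0 < α) (hd : 0 < d)
    (hh : Homogeneous g α) {B : Set ℝ} (hB : MeasurableSet B) (hB0 : B ⊆ Set.Ioi 0) :
    (volume : Measure (E d)).withDensity (fun x => ENNReal.ofReal (gaussianDensity d x)) (g ⁻¹' B) =
      ∫⁻ x in B, ENNReal.ofReal (chaosDensity g α x) := by
  rw [withDensity_apply _ (hg hB), ← lintegral_indicator (hg hB)]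
  have hind : ∀ z, (g ⁻¹' B).indicator (fun x => ENNReal.ofReal (gaussianDensity d x)) z =
      B.indicator 1 (g z) * ENNReal.ofReal (gaussianDensity d z) := by
    intro z
    by_cases hz : g z ∈ B
    · rw [Set.indicator_of_mem (by exact hz), Set.indicator_of_mem hz]; simp
    · rw [Set.indicator_of_notMem (by exact hz), Set.indicator_of_notMem hz]; simp
  simp_rw [hind]
  have h1m : Measurable (B.indicator (1 : ℝ → ℝ≥0∞)) := measurable_one.indicator hB
  rw [lintegral_eq_lintegral_sphere hd
    (f := fun a => B.indicator 1 (g a) * ENNReal.ofReal (gaussianDensity d a))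
    ((h1m.comp hg).mul (measurable_gaussianDensity d).ennreal_ofReal)]
  have hinner : ∀ v : Metric.sphere (0 : E d) 1, ∫⁻ t in Set.Ioi (0 : ℝ),
      ENNReal.ofReal (t ^ (d - 1)) * (B.indicator 1 (g (t • (v : E d))) *
        ENNReal.ofReal (gaussianDensity d (t • (v : E d)))) =
      ∫⁻ x in B, ENNReal.ofReal ((2 * Real.pi) ^ (-(d : ℝ) / 2) / (α * x) *
        radialKernel d α x (g v)) := by
    intro v
    rw [← lintegral_radial_eq hα hd (g v) hB hB0]
    refine setLIntegral_congr_fun measurableSet_Ioi fun t ht => ?_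
    rw [hh t v ht, gaussianDensity, norm_smul, norm_eq_of_mem_sphere, mul_one, Real.norm_eq_abs,
      sq_abs]
  simp_rw [hinner]
  have hjm : Measurable fun p : Metric.sphere (0 : E d) 1 × ℝ =>
      ENNReal.ofReal ((2 * Real.pi) ^ (-(d : ℝ) / 2) / (α * p.2) * radialKernel d α p.2 (g p.1)) := by
    refine Measurable.ennreal_ofReal (Measurable.mul (by fun_prop) ?_)
    exact (measurable_radialKernel d α).comp
      (measurable_snd.prodMk (hg.comp (measurable_subtype_coe.comp measurable_fst)))
  rw [lintegral_lintegral_swap hjm.aemeasurable]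
  refine setLIntegral_congr_fun hB fun x hx => ?_
  have hx0 : 0 < x := hB0 hx
  rw [chaosDensity, ← integral_const_mul, ofReal_integral_eq_lintegral_ofReal
    ((integrable_radialKernel hg α hx0).const_mul _)]
  exact Eventually.of_forall fun v => mul_nonneg (by positivity) (radialKernel_nonneg hx0)

/-- The density off zero of a homogeneous function of a standard Gaussian vector. -/
noncomputable def chaosDensityOffZero (g : E d → ℝ) (α x : ℝ) : ℝ :=
  if 0 < x then chaosDensity g α x else if x < 0 then chaosDensity (fun v => -g v) α (-x) else 0

/-- The positive half-line is handled directly. On the negative half-line the same formula is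
applied to `-g`, which is homogeneous of the same order. The point `0` is excluded because `g(η)`
may have an atom there. -/
theorem isDensityOffZero (hg : Measurable g) (hα : 0 < α) (hd : 0 < d) (hh : Homogeneous g α)
    {Ω : Type*} [MeasurableSpace Ω] {P : Measure Ω} {η : Ω → E d}
    (hη : ∀ i, HasLaw (fun ω => η ω i) (gaussianReal 0 1) P)
    (hind : iIndepFun (fun i ω => η ω i) P) :
    IsDensityOffZero P (fun ω => g (η ω)) (chaosDensityOffZero g α) := by
  have hng : Measurable fun v => -g v := hg.neg
  have hnh : Homogeneous (fun v => -g v) α := fun t x ht => by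
    simp only [hh t x ht, mul_neg]
  obtain ⟨hηm, hmap⟩ := map_eq_withDensity hη hind
  refine ⟨?_, fun x => ?_, ?_, ?_⟩
  · exact Measurable.ite measurableSet_Ioi (measurable_chaosDensity hg α)
      (Measurable.ite measurableSet_Iio ((measurable_chaosDensity hng α).comp measurable_neg)
        measurable_const)
  · unfold chaosDensityOffZero
    split_ifs with h1 h2
    · exact chaosDensity_nonneg hα h1
    · exact chaosDensity_nonneg hα (neg_pos.2 h2)
    · exact le_rfl
  · refine (continuousOn_chaosDensity hg hα).congr fun x hx => ?_
    exact if_pos hx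
  · have hm : P.map (fun ω => g (η ω)) = (P.map η).map g :=
      (AEMeasurable.map_map_of_aemeasurable hg.aemeasurable hηm).symm
    rw [hm, hmap]
    set γ := (volume : Measure (E d)).withDensity fun x => ENNReal.ofReal (gaussianDensity d x)
    have hsplit : ∀ (ν : Measure ℝ) (S : Set ℝ), MeasurableSet S → ν {0} = 0 →
        ν S = ν (S ∩ Set.Ioi 0) + ν (S ∩ Set.Iio 0) := by
      intro ν S hS h0
      have h1 := measure_inter_add_sdiff (μ := ν) S (measurableSet_Ioi (a := (0 : ℝ)))
      have h2 := measure_inter_add_sdiff (μ := ν) (S \ Set.Ioi 0) (measurableSet_Iio (a := (0 : ℝ)))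
      have e1 : (S \ Set.Ioi 0) ∩ Set.Iio 0 = S ∩ Set.Iio (0 : ℝ) := by
        ext x; simp only [Set.mem_inter_iff, Set.mem_sdiff, Set.mem_Ioi, Set.mem_Iio]
        constructor
        · rintro ⟨⟨a, -⟩, b⟩; exact ⟨a, b⟩
        · rintro ⟨a, b⟩; exact ⟨⟨a, not_lt.2 b.le⟩, b⟩
      have e2 : ν ((S \ Set.Ioi 0) \ Set.Iio 0) = 0 := by
        refine measure_mono_null (fun x hx => ?_) h0
        simp only [Set.mem_sdiff, Set.mem_Ioi, Set.mem_Iio, not_lt] at hx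
        exact le_antisymm hx.1.2 hx.2
      rw [e1, e2, add_zero] at h2
      rw [← h1, ← h2]
    ext S hS
    rw [hsplit _ S hS (by simp [Measure.restrict_apply]), hsplit _ S hS
      ((withDensity_absolutelyContinuous _ _) (by simp))]
    have hP : MeasurableSet (S ∩ Set.Ioi 0) := hS.inter measurableSet_Ioi
    have hN : MeasurableSet (S ∩ Set.Iio 0) := hS.inter measurableSet_Iio
    have hP0 : S ∩ Set.Ioi 0 ⊆ ({0}ᶜ : Set ℝ) := fun x hx => ne_of_gt hx.2
    have hN0 : S ∩ Set.Iio 0 ⊆ ({0}ᶜ : Set ℝ) := fun x hx => ne_of_lt hx.2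
    rw [Measure.restrict_apply hP, Measure.restrict_apply hN,
      Set.inter_eq_left.2 hP0, Set.inter_eq_left.2 hN0,
      Measure.map_apply hg hP, Measure.map_apply hg hN,
      withDensity_apply _ hP, withDensity_apply _ hN]
    congr 1
    · rw [withDensity_preimage_eq hg hα hd hh hP Set.inter_subset_right]
      refine setLIntegral_congr_fun hP fun x hx => ?_
      simp only [chaosDensityOffZero, if_pos (Set.mem_Ioi.1 hx.2)]
    · have hN' : MeasurableSet (Neg.neg ⁻¹' (S ∩ Set.Iio 0)) := measurable_neg hN
      have hpre : g ⁻¹' (S ∩ Set.Iio 0) = (fun v => -g v) ⁻¹' (Neg.neg ⁻¹' (S ∩ Set.Iio 0)) := by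
        ext v; simp
      rw [hpre, withDensity_preimage_eq hng hα hd hnh hN' (fun x hx => by
        have : -x < 0 := hx.2
        exact neg_lt_zero.1 this)]
      refine Eq.trans ?_ ((Measure.measurePreserving_neg
        (volume : Measure ℝ)).setLIntegral_comp_preimage_emb
        (MeasurableEquiv.neg ℝ).measurableEmbedding
        (fun x => ENNReal.ofReal (chaosDensityOffZero g α x)) (S ∩ Set.Iio 0))
      refine setLIntegral_congr_fun hN' fun x hx => ?_
      have hx' : -x < 0 := hx.2
      simp only [chaosDensityOffZero, if_neg (not_lt.2 hx'.le), if_pos hx', neg_neg]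

end Density


/-! ### The phase and the amplitude of the Laplace integral -/

/-- A homogeneous function of positive order that is positive somewhere and of class `C^n` off the
origin. -/
structure IsRegularHomogeneous {d : ℕ} (n : ℕ) (g : E d → ℝ) (α : ℝ) : Prop where
  order_pos : 0 < α
  homogeneous : Homogeneous g α
  exists_pos : ∃ v, 0 < g v
  contDiffOn : ContDiffOn ℝ n g {0}ᶜ

/-- The cone on which the angular function is positive. -/
def positiveCone {d : ℕ} (g : E d → ℝ) : Set (E d) := {z | 0 < angular g z}

/-- The phase function of the Laplace integral: the logarithmic radius is an additional variable in
which the phase is quadratic. -/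
noncomputable def phase {d : ℕ} (g : E d → ℝ) (α : ℝ) (z : E d) : ℝ :=
  ((sphereMax g / angular g z) ^ (2 / α) - 1 + Real.log ‖z‖ ^ 2) / 2

/-- The amplitude of the Laplace integral. -/
noncomputable def amplitude {d : ℕ} (g : E d → ℝ) (α : ℝ) (z : E d) : ℝ :=
  (‖z‖ ^ d)⁻¹ * (sphereMax g / angular g z) ^ ((d : ℝ) / α)

namespace IsRegularHomogeneous

variable {d n : ℕ} {g : E d → ℝ} {α : ℝ} (hg : IsRegularHomogeneous n g α)
include hg

theorem apply_zero : g 0 = 0 := by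
  have h := hg.homogeneous 2 0 (by norm_num)
  rw [smul_zero] at h
  have h2 : (1 : ℝ) < 2 ^ α := Real.one_lt_rpow (by norm_num) hg.order_pos
  have h3 : (2 ^ α - 1) * g 0 = 0 := by linarith
  rcases mul_eq_zero.1 h3 with h4 | h4
  · linarith
  · exact h4

theorem measurable : Measurable g :=
  measurable_of_continuousOn_compl_singleton 0 hg.contDiffOn.continuousOn

theorem continuousOn_sphere : ContinuousOn g (Metric.sphere 0 1) :=
  hg.contDiffOn.continuousOn.mono fun v hv => by
    rw [Set.mem_compl_singleton_iff]
    rintro rfl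
    simp at hv

theorem le_sphereMax {v : E d} (hv : ‖v‖ = 1) : g v ≤ sphereMax g :=
  le_csSup ((isCompact_sphere 0 1).image_of_continuousOn hg.continuousOn_sphere).bddAbove
    ⟨v, by simpa using hv, rfl⟩

theorem eq_rpow_mul {v : E d} (hv : v ≠ 0) : g v = ‖v‖ ^ α * angular g v := by
  have h : 0 < ‖v‖ := norm_pos_iff.2 hv
  rw [angular, ← hg.homogeneous _ _ h, smul_smul, mul_inv_cancel₀ h.ne', one_smul]

theorem sphereMax_pos : 0 < sphereMax g := by
  obtain ⟨v, hv⟩ := hg.exists_pos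
  have hv0 : v ≠ 0 := by rintro rfl; rw [hg.apply_zero] at hv; exact lt_irrefl _ hv
  rw [hg.eq_rpow_mul hv0] at hv
  have h2 : 0 < angular g v := by
    by_contra h
    exact absurd hv (not_lt.2 (mul_nonpos_of_nonneg_of_nonpos (by positivity) (not_lt.1 h)))
  exact h2.trans_le (hg.le_sphereMax (by rw [norm_smul, norm_inv, norm_norm,
    inv_mul_cancel₀ (norm_ne_zero_iff.2 hv0)]))

theorem dim_pos : 0 < d := by
  obtain ⟨v, hv⟩ := hg.exists_pos
  rcases Nat.eq_zero_or_pos d with rfl | h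
  · rw [Subsingleton.elim v 0, hg.apply_zero] at hv
    exact absurd hv (lt_irrefl _)
  · exact h

theorem ne_zero {z : E d} (hz : z ∈ positiveCone g) : z ≠ 0 := by
  rintro rfl
  simp [positiveCone, angular, hg.apply_zero] at hz

theorem contDiffAt_angular {z : E d} (hz : z ≠ 0) : ContDiffAt ℝ n (angular g) z := by
  have h : 0 < ‖z‖ := norm_pos_iff.2 hz
  have h1 : ContDiffAt ℝ n (fun z : E d => ‖z‖⁻¹ • z) z :=
    ((contDiffAt_norm ℝ hz).inv h.ne').smul contDiffAt_id
  refine ContDiffAt.comp z (g := g) (f := fun z : E d => ‖z‖⁻¹ • z) ?_ h1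
  refine (hg.contDiffOn _ ?_).contDiffAt (isOpen_compl_singleton.mem_nhds ?_) <;>
  simp [hz]

theorem isOpen_positiveCone : IsOpen (positiveCone g) := by
  rw [isOpen_iff_mem_nhds]
  intro z hz
  exact (hg.contDiffAt_angular (hg.ne_zero hz)).continuousAt.eventually (lt_mem_nhds hz)

theorem angular_le {z : E d} (hz : z ≠ 0) : angular g z ≤ sphereMax g :=
  hg.le_sphereMax (by rw [norm_smul, norm_inv, norm_norm, inv_mul_cancel₀ (norm_ne_zero_iff.2 hz)])

theorem one_le_div {z : E d} (hz : z ∈ positiveCone g) : 1 ≤ sphereMax g / angular g z :=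
  (one_le_div₀ hz).2 (hg.angular_le (hg.ne_zero hz))

theorem phase_nonneg {z : E d} (hz : z ∈ positiveCone g) : 0 ≤ phase g α z := by
  have h1 := Real.one_le_rpow (hg.one_le_div hz) (z := 2 / α) (by have := hg.order_pos; positivity)
  have h2 := sq_nonneg (Real.log ‖z‖)
  rw [phase]
  linarith

/-- Both summands of the phase are nonnegative: one vanishes only where the angular function is
maximal, the other only at radius one. -/
theorem phase_eq_zero_iff {z : E d} (hz : z ∈ positiveCone g) :
    phase g α z = 0 ↔ z ∈ maxSet g := by
  have hα := hg.order_pos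
  have h0 := hg.sphereMax_pos
  have h1 := Real.one_le_rpow (hg.one_le_div hz) (z := 2 / α) (by positivity)
  have h2 := sq_nonneg (Real.log ‖z‖)
  have hz0 : 0 < ‖z‖ := norm_pos_iff.2 (hg.ne_zero hz)
  constructor
  · intro h
    rw [phase] at h
    have h3 : Real.log ‖z‖ ^ 2 = 0 := by linarith
    have h4 : (sphereMax g / angular g z) ^ (2 / α) = 1 := by linarith
    have h5 : ‖z‖ = 1 := Real.eq_one_of_pos_of_log_eq_zero hz0 (by simpa using h3)
    refine ⟨by simpa using h5, ?_⟩
    have h6 : sphereMax g / angular g z = 1 := by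
      rcases (hg.one_le_div hz).eq_or_lt with h7 | h7
      · exact h7.symm
      · exact absurd h4 (Real.one_lt_rpow h7 (by positivity)).ne'
    rw [div_eq_one_iff_eq (ne_of_gt hz), angular, h5] at h6
    simpa using h6.symm
  · rintro ⟨h3, h4⟩
    rw [mem_sphere_zero_iff_norm] at h3
    simp [phase, angular, h3, h4, div_self h0.ne']

theorem maxSet_subset : maxSet g ⊆ positiveCone g := by
  rintro z ⟨h3, h4⟩
  rw [mem_sphere_zero_iff_norm] at h3
  simp [positiveCone, angular, h3, h4, hg.sphereMax_pos]

theorem amplitude_eq_one {z : E d} (hz : z ∈ maxSet g) : amplitude g α z = 1 := by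
  obtain ⟨h3, h4⟩ := hz
  rw [mem_sphere_zero_iff_norm] at h3
  simp [amplitude, angular, h3, h4, div_self hg.sphereMax_pos.ne']

theorem amplitude_nonneg {z : E d} (hz : z ∈ positiveCone g) : 0 ≤ amplitude g α z := by
  have := hg.one_le_div hz
  rw [amplitude]
  positivity

theorem contDiffOn_rpow (β : ℝ) :
    ContDiffOn ℝ n (fun z => (sphereMax g / angular g z) ^ β) (positiveCone g) := fun z hz =>
  ((contDiffAt_const.div (hg.contDiffAt_angular (hg.ne_zero hz)) (ne_of_gt hz)).rpow_const_of_ne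
    (by have := hg.one_le_div hz; positivity)).contDiffWithinAt

theorem contDiffOn_phase : ContDiffOn ℝ n (phase g α) (positiveCone g) := by
  refine (((hg.contDiffOn_rpow _).sub contDiffOn_const).add fun z hz => ?_).div_const 2
  have hz0 := hg.ne_zero hz
  exact (((contDiffAt_norm ℝ hz0).log (norm_ne_zero_iff.2 hz0)).pow 2).contDiffWithinAt

theorem contDiffOn_amplitude : ContDiffOn ℝ n (amplitude g α) (positiveCone g) := by
  refine ContDiffOn.mul (fun z hz => ?_) (hg.contDiffOn_rpow _)
  have hz0 := hg.ne_zero hz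
  exact (((contDiffAt_norm ℝ hz0).pow d).inv
    (pow_ne_zero _ (norm_ne_zero_iff.2 hz0))).contDiffWithinAt

theorem isCompact_maxSet : IsCompact (maxSet g) := by
  refine (isCompact_sphere (0 : E d) 1).of_isClosed_subset ?_ fun v hv => hv.1
  exact hg.continuousOn_sphere.preimage_isClosed_of_isClosed Metric.isClosed_sphere
    (isClosed_singleton (x := sphereMax g))

end IsRegularHomogeneous

/-- With `t = e^s` the measure `dt/t` becomes `ds`, and the integral is Gaussian. -/
theorem lintegral_exp_log_sq {l : ℝ} (hl : 0 < l) :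
    ∫⁻ t in Set.Ioi (0 : ℝ), ENNReal.ofReal (t⁻¹ * Real.exp (-(l * Real.log t ^ 2 / 2))) =
      ENNReal.ofReal (√(2 * Real.pi / l)) := by
  have himg : Real.exp '' Set.univ = Set.Ioi 0 := by rw [Set.image_univ, Real.range_exp]
  rw [← himg, lintegral_image_eq_lintegral_abs_deriv_mul MeasurableSet.univ
    (fun x _ => (Real.hasDerivAt_exp x).hasDerivWithinAt) Real.exp_injective.injOn,
    Measure.restrict_univ]
  have h : ∀ x : ℝ, ENNReal.ofReal |Real.exp x| * ENNReal.ofReal ((Real.exp x)⁻¹ *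
      Real.exp (-(l * Real.log (Real.exp x) ^ 2 / 2))) =
      ENNReal.ofReal (Real.exp (-(l / 2) * x ^ 2)) := by
    intro x
    rw [← ENNReal.ofReal_mul (abs_nonneg _), abs_of_pos (Real.exp_pos x), ← mul_assoc,
      mul_inv_cancel₀ (Real.exp_pos x).ne', one_mul, Real.log_exp]
    congr 2; ring
  simp_rw [h]
  rw [← ofReal_integral_eq_lintegral_ofReal (integrable_exp_neg_mul_sq (by positivity))
    (Eventually.of_forall fun x => (Real.exp_pos _).le), integral_gaussian]
  congr 2
  field_simp

namespace IsRegularHomogeneous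

variable {d n : ℕ} {g : E d → ℝ} {α : ℝ} (hg : IsRegularHomogeneous n g α)
include hg

theorem measurable_angular : Measurable (angular g) :=
  hg.measurable.comp (by fun_prop)

/-- The artificial radius is integrated out. The factor `‖z‖^(-d)` of the amplitude turns the polar
Jacobian `t^(d-1) dt` into `dt/t`, so the radial integral is the same for all directions of the
cone. What remains is the spherical integral of the radial kernel, normalized by its value at the
maximum. -/
theorem lintegral_amplitude_mul_exp {x : ℝ} (hx : 0 < x) :
    ∫⁻ z in positiveCone g, ENNReal.ofReal (amplitude g α z *
        Real.exp (-((x / sphereMax g) ^ (2 / α) * phase g α z))) =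
      ENNReal.ofReal (√(2 * Real.pi / (x / sphereMax g) ^ (2 / α)) *
        ((x / sphereMax g) ^ (-(d : ℝ) / α) * Real.exp ((x / sphereMax g) ^ (2 / α) / 2) *
        ∫ v : Metric.sphere (0 : E d) 1, radialKernel d α x (g v)
          ∂(volume : Measure (E d)).toSphere)) := by
  have hα := hg.order_pos
  have hG := hg.sphereMax_pos
  have hxG : 0 < x / sphereMax g := by positivity
  set l := (x / sphereMax g) ^ (2 / α) with hl
  have hl0 : 0 < l := by positivity
  have hmW : MeasurableSet (positiveCone g) := hg.isOpen_positiveCone.measurableSet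
  have hm : Measurable fun z => ENNReal.ofReal (amplitude g α z * Real.exp (-(l * phase g α z))) := by
    have := hg.measurable_angular
    unfold amplitude phase
    fun_prop
  rw [← lintegral_indicator hmW, lintegral_eq_lintegral_sphere hg.dim_pos (hm.indicator hmW)]
  have key : ∀ v : Metric.sphere (0 : E d) 1, (∫⁻ t in Set.Ioi (0 : ℝ),
      ENNReal.ofReal (t ^ (d - 1)) * (positiveCone g).indicator (fun z => ENNReal.ofReal
        (amplitude g α z * Real.exp (-(l * phase g α z)))) (t • (v : E d))) =
      ENNReal.ofReal (√(2 * Real.pi / l)) * ENNReal.ofReal (((x / sphereMax g) ^ (-(d : ℝ) / α) *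
        Real.exp (l / 2)) * radialKernel d α x (g v)) := by
    intro v
    have hv : ‖(v : E d)‖ = 1 := norm_eq_of_mem_sphere v
    have hang : ∀ t ∈ Set.Ioi (0 : ℝ), angular g (t • (v : E d)) = g v := by
      intro t ht
      rw [angular, norm_smul, hv, mul_one, Real.norm_of_nonneg (le_of_lt ht), smul_smul,
        inv_mul_cancel₀ (ne_of_gt ht), one_smul]
    by_cases hgv : 0 < g v
    · have hc : ∀ t ∈ Set.Ioi (0 : ℝ), ENNReal.ofReal (t ^ (d - 1)) *
          (positiveCone g).indicator (fun z => ENNReal.ofReal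
          (amplitude g α z * Real.exp (-(l * phase g α z)))) (t • (v : E d)) =
          ENNReal.ofReal (((x / sphereMax g) ^ (-(d : ℝ) / α) *
            Real.exp (l / 2)) * radialKernel d α x (g v)) *
          ENNReal.ofReal (t⁻¹ * Real.exp (-(l * Real.log t ^ 2 / 2))) := by
        intro t ht
        have ht0 : 0 < t := ht
        have hmem : t • (v : E d) ∈ positiveCone g := by
          rw [positiveCone, Set.mem_ofPred_eq, hang t ht]; exact hgv
        rw [Set.indicator_of_mem hmem, ← ENNReal.ofReal_mul (by positivity), ← ENNReal.ofReal_mul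
          (mul_nonneg (by positivity) (radialKernel_nonneg hx))]
        congr 1
        rw [amplitude, phase, hang t ht, norm_smul, hv, mul_one, Real.norm_of_nonneg ht0.le,
          radialKernel, if_pos hgv]
        have e0 : x / g v = (x / sphereMax g) * (sphereMax g / g v) := by field_simp
        have hq : 0 < sphereMax g / g v := by positivity
        have e1 : (x / g v) ^ ((d : ℝ) / α) = (x / sphereMax g) ^ ((d : ℝ) / α) *
            (sphereMax g / g v) ^ ((d : ℝ) / α) := by
          rw [e0, Real.mul_rpow hxG.le hq.le]
        have e2 : (x / g v) ^ (2 / α) = l * (sphereMax g / g v) ^ (2 / α) := by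
          rw [e0, Real.mul_rpow hxG.le hq.le]
        have e3 : (x / sphereMax g) ^ (-(d : ℝ) / α) * (x / sphereMax g) ^ ((d : ℝ) / α) = 1 := by
          rw [← Real.rpow_add hxG, neg_div, neg_add_cancel, Real.rpow_zero]
        have e4 : t ^ (d - 1) * (t ^ d)⁻¹ = t⁻¹ := by
          obtain ⟨j, hj⟩ := Nat.exists_eq_succ_of_ne_zero hg.dim_pos.ne'
          rw [hj, Nat.succ_eq_add_one, Nat.add_sub_cancel, pow_succ]
          field_simp
        rw [e1, e2]
        set q := (sphereMax g / g v) ^ (2 / α)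
        have e5 : Real.exp (-(l * ((q - 1 + Real.log t ^ 2) / 2))) =
            Real.exp (l / 2) * Real.exp (-(l * q) / 2) *
              Real.exp (-(l * Real.log t ^ 2 / 2)) := by
          rw [← Real.exp_add, ← Real.exp_add]; congr 1; ring
        rw [e5]
        linear_combination ((sphereMax g / g v) ^ ((d : ℝ) / α) * Real.exp (l / 2) *
          Real.exp (-(l * q) / 2) * Real.exp (-(l * Real.log t ^ 2 / 2))) * e4 -
          (t⁻¹ * (sphereMax g / g v) ^ ((d : ℝ) / α) * Real.exp (l / 2) *
          Real.exp (-(l * q) / 2) * Real.exp (-(l * Real.log t ^ 2 / 2))) * e3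
      rw [setLIntegral_congr_fun measurableSet_Ioi hc, lintegral_const_mul' _ _
        ENNReal.ofReal_ne_top, lintegral_exp_log_sq hl0, mul_comm]
    · have hc : ∀ t ∈ Set.Ioi (0 : ℝ), ENNReal.ofReal (t ^ (d - 1)) *
          (positiveCone g).indicator (fun z => ENNReal.ofReal
          (amplitude g α z * Real.exp (-(l * phase g α z)))) (t • (v : E d)) = 0 := by
        intro t ht
        rw [Set.indicator_of_notMem, mul_zero]
        rw [positiveCone, Set.mem_ofPred_eq, hang t ht]; exact hgv
      rw [setLIntegral_congr_fun measurableSet_Ioi hc, radialKernel, if_neg hgv]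
      simp
  simp_rw [key]
  rw [lintegral_const_mul' _ _ ENNReal.ofReal_ne_top, ← ofReal_integral_eq_lintegral_ofReal
    ((integrable_radialKernel hg.measurable α hx).const_mul _)
    (Eventually.of_forall fun v => mul_nonneg (by positivity) (radialKernel_nonneg hx)),
    integral_const_mul, ← ENNReal.ofReal_mul (by positivity)]

theorem integrableOn_amplitude_mul_exp {l : ℝ} (hl : 0 < l) :
    IntegrableOn (fun z => amplitude g α z * Real.exp (-(l * phase g α z))) (positiveCone g) := by
  have hα := hg.order_pos
  have hG := hg.sphereMax_pos
  -- Every `l > 0` is `(x / ĝ) ^ (2 / α)` for this `x`; finiteness is then read off from the polar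
  -- identity.
  have hx : 0 < sphereMax g * l ^ (α / 2) := by positivity
  have hxl : (sphereMax g * l ^ (α / 2) / sphereMax g) ^ (2 / α) = l := by
    rw [mul_div_cancel_left₀ _ hG.ne', ← Real.rpow_mul hl.le]
    field_simp
    exact Real.rpow_one l
  have h := hg.lintegral_amplitude_mul_exp hx
  rw [hxl] at h
  refine ⟨?_, ?_⟩
  · refine ContinuousOn.aestronglyMeasurable ?_ hg.isOpen_positiveCone.measurableSet
    exact hg.contDiffOn_amplitude.continuousOn.mul (Real.continuous_exp.comp_continuousOn
      (continuousOn_const.mul hg.contDiffOn_phase.continuousOn).neg)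
  · rw [hasFiniteIntegral_iff_ofReal, h]
    · exact ENNReal.ofReal_lt_top
    · exact (ae_restrict_mem hg.isOpen_positiveCone.measurableSet).mono fun z hz =>
        mul_nonneg (hg.amplitude_nonneg hz) (Real.exp_pos _).le

theorem chaosDensity_eq {x : ℝ} (hx : 0 < x) :
    chaosDensity g α x = (2 * Real.pi) ^ (-((d : ℝ) + 1) / 2) / (α * x) *
      (x / sphereMax g) ^ (((d : ℝ) + 1) / α) * Real.exp (-(x / sphereMax g) ^ (2 / α) / 2) *
      ∫ z in positiveCone g, amplitude g α z *
        Real.exp (-((x / sphereMax g) ^ (2 / α) * phase g α z)) := by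
  have hα := hg.order_pos
  have hG := hg.sphereMax_pos
  have hxG : 0 < x / sphereMax g := by positivity
  have h := hg.lintegral_amplitude_mul_exp hx
  have hI : 0 ≤ ∫ v : Metric.sphere (0 : E d) 1, radialKernel d α x (g v)
      ∂(volume : Measure (E d)).toSphere := integral_nonneg fun _ => radialKernel_nonneg hx
  have hint := hg.integrableOn_amplitude_mul_exp (l := (x / sphereMax g) ^ (2 / α)) (by positivity)
  rw [← ofReal_integral_eq_lintegral_ofReal hint, ENNReal.ofReal_eq_ofReal_iff] at h
  · rw [h, chaosDensity]
    set I := ∫ v : Metric.sphere (0 : E d) 1, radialKernel d α x (g v)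
      ∂(volume : Measure (E d)).toSphere
    set s := x / sphereMax g
    have e1 : √(2 * Real.pi / s ^ (2 / α)) = (2 * Real.pi) ^ (1 / 2 : ℝ) * s ^ (-(1 / α)) := by
      rw [Real.sqrt_eq_rpow, Real.div_rpow (by positivity) (by positivity), ← Real.rpow_mul hxG.le,
        Real.rpow_neg hxG.le, div_eq_mul_inv]
      congr 3; ring
    have e2 : (2 * Real.pi) ^ (-((d : ℝ) + 1) / 2) * (2 * Real.pi) ^ (1 / 2 : ℝ) =
        (2 * Real.pi) ^ (-(d : ℝ) / 2) := by
      rw [← Real.rpow_add (by positivity)]; congr 1; ring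
    have e3 : s ^ (((d : ℝ) + 1) / α) * s ^ (-(1 / α)) * s ^ (-(d : ℝ) / α) = 1 := by
      rw [← Real.rpow_add hxG, ← Real.rpow_add hxG, ← Real.rpow_zero s]; congr 1; ring
    have e4 : Real.exp (-s ^ (2 / α) / 2) * Real.exp (s ^ (2 / α) / 2) = 1 := by
      rw [← Real.exp_add, ← Real.exp_zero]; congr 1; ring
    rw [e1, ← e2]
    generalize (2 * Real.pi) ^ (-((d : ℝ) + 1) / 2) = P, (2 * Real.pi) ^ (1 / 2 : ℝ) = H,
      s ^ (((d : ℝ) + 1) / α) = s₁, s ^ (-(1 / α)) = s₂, s ^ (-(d : ℝ) / α) = s₃,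
      Real.exp (-s ^ (2 / α) / 2) = y₁, Real.exp (s ^ (2 / α) / 2) = y₂ at e3 e4 ⊢
    linear_combination -(P * H * I / (α * x)) * (y₁ * y₂ * e3 + e4)
  · exact integral_nonneg_of_ae ((ae_restrict_mem hg.isOpen_positiveCone.measurableSet).mono
      fun z hz => mul_nonneg (hg.amplitude_nonneg hz) (Real.exp_pos _).le)
  · positivity
  · exact (ae_restrict_mem hg.isOpen_positiveCone.measurableSet).mono fun z hz =>
        mul_nonneg (hg.amplitude_nonneg hz) (Real.exp_pos _).le

end IsRegularHomogeneous


/-! ### Jacobians and Gaussian integrals in the normal directions -/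

section LinearAlgebra

variable {d m k : ℕ}

/-- The identification of `ℝ^d` with `ℝ^m × ℝ^k` along an orthonormal basis. -/
noncomputable def prodEquiv (β : OrthonormalBasis (Fin m ⊕ Fin k) ℝ (E d)) : E d ≃L[ℝ] E m × E k :=
  (β.equiv ((EuclideanSpace.basisFun (Fin m) ℝ).prod (EuclideanSpace.basisFun (Fin k) ℝ))
    (Equiv.refl _)).toContinuousLinearEquiv.trans (WithLp.prodContinuousLinearEquiv 2 ℝ (E m) (E k))

theorem prodEquiv_apply (β : OrthonormalBasis (Fin m ⊕ Fin k) ℝ (E d)) (i : Fin m ⊕ Fin k) :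
    prodEquiv β (β i) = Sum.elim (fun i => (EuclideanSpace.basisFun (Fin m) ℝ i, (0 : E k)))
      (fun i => ((0 : E m), EuclideanSpace.basisFun (Fin k) ℝ i)) i := by
  unfold prodEquiv
  simp only [ContinuousLinearEquiv.trans_apply, LinearIsometryEquiv.coe_toContinuousLinearEquiv,
    OrthonormalBasis.equiv_apply_basis, Equiv.refl_apply, OrthonormalBasis.prod_apply]
  rcases i with i | i <;> rfl

theorem measurePreserving_prodEquiv (β : OrthonormalBasis (Fin m ⊕ Fin k) ℝ (E d)) :
    MeasurePreserving (prodEquiv β) :=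
  (WithLp.volume_preserving_ofLp (E m) (E k)).comp (LinearIsometryEquiv.measurePreserving
    (β.equiv ((EuclideanSpace.basisFun (Fin m) ℝ).prod (EuclideanSpace.basisFun (Fin k) ℝ))
    (Equiv.refl _)))

/-- The coordinates, along the second part of an orthonormal basis, of a linear map on the second
factor. -/
noncomputable def normalMatrix (β : OrthonormalBasis (Fin m ⊕ Fin k) ℝ (E d))
    (L : E m × E k →L[ℝ] E d) : Matrix (Fin k) (Fin k) ℝ :=
  Matrix.of fun i j => inner ℝ (β (Sum.inr i)) (L (0, EuclideanSpace.basisFun (Fin k) ℝ j))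

theorem normalMatrix_mulVec (β : OrthonormalBasis (Fin m ⊕ Fin k) ℝ (E d))
    (L : E m × E k →L[ℝ] E d) (ζ : E k) (i : Fin k) :
    (normalMatrix β L).mulVec ζ.ofLp i = inner ℝ (β (Sum.inr i)) (L (0, ζ)) := by
  conv_rhs => rw [← (EuclideanSpace.basisFun (Fin k) ℝ).sum_repr ζ]
  have h : ((0 : E m), ∑ j, (EuclideanSpace.basisFun (Fin k) ℝ).repr ζ j •
      EuclideanSpace.basisFun (Fin k) ℝ j) = ∑ j, (EuclideanSpace.basisFun (Fin k) ℝ).repr ζ j •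
      ((0 : E m), EuclideanSpace.basisFun (Fin k) ℝ j) := by
    rw [Prod.ext_iff, Prod.fst_sum, Prod.snd_sum]
    simp
  rw [h, map_sum, inner_sum]
  simp only [map_smul, inner_smul_right]
  rw [Matrix.mulVec, dotProduct]
  refine Finset.sum_congr rfl fun j _ => ?_
  rw [normalMatrix, Matrix.of_apply, mul_comm]
  rfl

/-- With respect to `β₀` and `β` the map is block triangular, because it sends the first factor into
the span of the first part of `β`. The determinant of the first block is, up to sign, the Jacobian
of the restriction, by its Gram matrix. The basis `β₀` only identifies the two spaces, while `β` is
adapted to the image. -/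
theorem abs_det_comp_prodEquiv (β₀ β : OrthonormalBasis (Fin m ⊕ Fin k) ℝ (E d))
    (L : E m × E k →L[ℝ] E d) (h : ∀ i η, inner ℝ (β (Sum.inr i)) (L (η, 0)) = 0) :
    |(L.comp (prodEquiv β₀ : E d →L[ℝ] E m × E k)).det| =
      (L.comp (ContinuousLinearMap.inl ℝ (E m) (E k))).toLinearMap.normDet *
        |(normalMatrix β L).det| := by
  set F := L.comp (prodEquiv β₀ : E d →L[ℝ] E m × E k) with hF
  have h1 := F.toLinearMap.normDet_eq_norm_det
  rw [Real.norm_eq_abs] at h1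
  have h2 := F.toLinearMap.normDet_eq_norm_det_toMatrix β₀ β
  set P : Matrix (Fin m) (Fin m) ℝ := Matrix.of fun i j =>
    inner ℝ (β (Sum.inl i)) (L (EuclideanSpace.basisFun (Fin m) ℝ j, 0)) with hP
  set R : Matrix (Fin m) (Fin k) ℝ := Matrix.of fun i j =>
    inner ℝ (β (Sum.inl i)) (L (0, EuclideanSpace.basisFun (Fin k) ℝ j)) with hR
  have h3 : F.toLinearMap.toMatrix β₀.toBasis β.toBasis =
      Matrix.fromBlocks P R 0 (normalMatrix β L) := by
    ext i j
    rw [LinearMap.toMatrix_apply]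
    have hc : F.toLinearMap (β₀.toBasis j) = L (prodEquiv β₀ (β₀ j)) := by
      simp [hF]
    rw [hc, prodEquiv_apply, OrthonormalBasis.coe_toBasis_repr_apply,
      OrthonormalBasis.repr_apply_apply]
    rcases i with i | i <;> rcases j with j | j
    · rfl
    · rfl
    · exact h i _
    · rfl
  have h4 : (L.comp (ContinuousLinearMap.inl ℝ (E m) (E k))).toLinearMap.normDet = |P.det| := by
    have h5 := (L.comp (ContinuousLinearMap.inl ℝ (E m) (E k))).toLinearMap.normDet_sq_eq_det_gram
      (EuclideanSpace.basisFun (Fin m) ℝ)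
    have h6 : Matrix.gram ℝ (fun j => (L.comp (ContinuousLinearMap.inl ℝ (E m) (E k))).toLinearMap
        (EuclideanSpace.basisFun (Fin m) ℝ j)) = P.transpose * P := by
      ext i j
      rw [Matrix.gram_apply, ← β.sum_inner_mul_inner, Fintype.sum_sum_type, Matrix.mul_apply]
      have h0 : ∀ x j, inner ℝ (β (Sum.inr x))
          ((L.comp (ContinuousLinearMap.inl ℝ (E m) (E k))).toLinearMap
          (EuclideanSpace.basisFun (Fin m) ℝ j)) = 0 := fun x j => h x _
      simp only [h0, mul_zero, Finset.sum_const_zero, add_zero]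
      refine Finset.sum_congr rfl fun x _ => ?_
      rw [real_inner_comm]
      rfl
    rw [h6, Matrix.det_mul, Matrix.det_transpose] at h5
    simp only [RCLike.ofReal_real_eq_id, id] at h5
    rw [← Real.sqrt_sq (LinearMap.normDet_nonneg _), h5, ← sq, Real.sqrt_sq_eq_abs]
  have h7 : F.det = LinearMap.det F.toLinearMap := rfl
  rw [h7, ← h1, h2, h3, Matrix.det_fromBlocks_zero₂₁, norm_mul, h4]
  rfl

/-- The substitution `y = Bζ` diagonalizes the form and leaves a product of one-dimensional Gaussian
integrals. -/
theorem integral_exp_neg_sum_sq {μ : Fin k → ℝ} (hμ : ∀ i, 0 < μ i) {B : Matrix (Fin k) (Fin k) ℝ}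
    (hB : B.det ≠ 0) :
    ∫ ζ : E k, Real.exp (-((∑ i, μ i * (B.mulVec ζ.ofLp i) ^ 2) / 2)) =
      (2 * Real.pi) ^ ((k : ℝ) / 2) * (∏ i, μ i) ^ (-(1 / 2) : ℝ) * |B.det|⁻¹ := by
  have e1 : ∫ ζ : E k, Real.exp (-((∑ i, μ i * (B.mulVec ζ.ofLp i) ^ 2) / 2)) =
      ∫ x : Fin k → ℝ, Real.exp (-((∑ i, μ i * (B.mulVec x i) ^ 2) / 2)) :=
    (PiLp.volume_preserving_ofLp (Fin k)).integral_comp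
      (MeasurableEquiv.toLp 2 (Fin k → ℝ)).symm.measurableEmbedding
      (fun x => Real.exp (-((∑ i, μ i * (B.mulVec x i) ^ 2) / 2)))
  have e2 : ∫ x : Fin k → ℝ, Real.exp (-((∑ i, μ i * (B.mulVec x i) ^ 2) / 2)) =
      ∫ y, Real.exp (-((∑ i, μ i * (y i) ^ 2) / 2)) ∂(Measure.map (Matrix.toLin' B) volume) := by
    rw [integral_map (LinearMap.continuous_of_finiteDimensional _).aemeasurable
      (Continuous.aestronglyMeasurable (by fun_prop))]
    rfl
  rw [e1, e2, Real.map_matrix_volume_pi_eq_smul_volume_pi hB, integral_smul_measure]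
  have e3 : ∀ y : Fin k → ℝ, Real.exp (-((∑ i, μ i * (y i) ^ 2) / 2)) =
      ∏ i, Real.exp (-(μ i / 2) * y i ^ 2) := by
    intro y
    rw [← Real.exp_sum, Finset.sum_div, ← Finset.sum_neg_distrib]
    congr 1
    refine Finset.sum_congr rfl fun i _ => ?_
    ring
  simp_rw [e3]
  rw [integral_fintype_prod_volume_eq_prod (fun i (y : ℝ) => Real.exp (-(μ i / 2) * y ^ 2))]
  simp_rw [integral_gaussian]
  have e4 : ∀ i, √(Real.pi / (μ i / 2)) = (2 * Real.pi) ^ (1 / 2 : ℝ) * (μ i) ^ (-(1 / 2) : ℝ) := by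
    intro i
    rw [Real.rpow_neg (hμ i).le, ← div_eq_mul_inv, ← Real.div_rpow (by positivity) (hμ i).le,
      Real.sqrt_eq_rpow]
    congr 1
    have := (hμ i).ne'
    field_simp
  simp_rw [e4]
  rw [Finset.prod_mul_distrib, Finset.prod_const, Finset.card_univ, Fintype.card_fin,
    Real.finsetProd_rpow _ _ (fun i _ => (hμ i).le), ← Real.rpow_natCast, ← Real.rpow_mul
    (by positivity), smul_eq_mul, ENNReal.toReal_ofReal (abs_nonneg _), abs_inv]
  rw [show (1 / 2 : ℝ) * k = k / 2 by ring]
  ring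

/-- The function `Φ` has a second order expansion at `v` by a quadratic form that vanishes on an
`m`-dimensional space and is positive on its orthogonal complement, with determinant `D` there. -/
def HasNormalHessian (m k : ℕ) (Φ : E d → ℝ) (v : E d) (D : ℝ) : Prop :=
  ∃ (β : OrthonormalBasis (Fin m ⊕ Fin k) ℝ (E d)) (μ : Fin k → ℝ), (∀ i, 0 < μ i) ∧
    ∏ i, μ i = D ∧
    (fun w => Φ (v + w) - (∑ i, μ i * inner ℝ (β (Sum.inr i)) w ^ 2) / 2) =o[𝓝 0]
      fun w => ‖w‖ ^ 2

/-- Pull-back of a second order expansion along a curve. -/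
theorem tendsto_div_sq_of_hasFDerivAt {Φ : E d → ℝ} {v : E d}
    {β : OrthonormalBasis (Fin m ⊕ Fin k) ℝ (E d)} {μ : Fin k → ℝ}
    (hq : (fun w => Φ (v + w) - (∑ i, μ i * inner ℝ (β (Sum.inr i)) w ^ 2) / 2) =o[𝓝 0]
      fun w => ‖w‖ ^ 2) {ψ : E m × E k → E d} {p : E m × E k} {L : E m × E k →L[ℝ] E d}
    (hψ : HasFDerivAt ψ L p) (hp : ψ p = v) (q : E m × E k) :
    Tendsto (fun t : ℝ => Φ (ψ (p + t • q)) / t ^ 2) (𝓝[≠] 0)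
      (𝓝 ((∑ i, μ i * inner ℝ (β (Sum.inr i)) (L q) ^ 2) / 2)) := by
  have hw : HasDerivAt (fun t : ℝ => ψ (p + t • q)) (L q) 0 := by
    have h1 : HasDerivAt (fun t : ℝ => p + t • q) q 0 := by
      simpa using ((hasDerivAt_id (0 : ℝ)).smul_const q).const_add p
    have h2 : HasFDerivAt ψ L (p + (0 : ℝ) • q) := by simpa using hψ
    exact h2.comp_hasDerivAt (0 : ℝ) h1
  have hs : Tendsto (fun t : ℝ => t⁻¹ • (ψ (p + t • q) - v)) (𝓝[≠] 0) (𝓝 (L q)) := by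
    have := hasDerivAt_iff_tendsto_slope.1 hw
    refine this.congr fun t => ?_
    simp [slope, hp]
  have hw0 : Tendsto (fun t : ℝ => ψ (p + t • q) - v) (𝓝[≠] 0) (𝓝 0) := by
    have h1 : Tendsto (fun t : ℝ => ψ (p + t • q) - v) (𝓝 0) (𝓝 (ψ (p + (0 : ℝ) • q) - v)) :=
      (hw.continuousAt.sub continuousAt_const)
    rw [zero_smul, add_zero, hp, sub_self] at h1
    exact h1.mono_left nhdsWithin_le_nhds
  have hbig : (fun t : ℝ => ‖ψ (p + t • q) - v‖ ^ 2) =O[𝓝[≠] 0] fun t : ℝ => t ^ 2 := by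
    refine IsBigO.pow ?_ 2
    have h1 : (fun t : ℝ => ψ (p + t • q) - v) =O[𝓝 0] fun t : ℝ => t := by
      simpa [hp] using hw.isBigO_sub
    exact (h1.mono nhdsWithin_le_nhds).norm_left
  have hlit := ((hq.comp_tendsto hw0).trans_isBigO hbig).tendsto_div_nhds_zero
  have hmain : Tendsto (fun t : ℝ => (∑ i, μ i * inner ℝ (β (Sum.inr i))
      (t⁻¹ • (ψ (p + t • q) - v)) ^ 2) / 2) (𝓝[≠] 0)
      (𝓝 ((∑ i, μ i * inner ℝ (β (Sum.inr i)) (L q) ^ 2) / 2)) := by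
    have hc : Continuous fun w : E d => (∑ i, μ i * inner ℝ (β (Sum.inr i)) w ^ 2) / 2 := by
      fun_prop
    exact (hc.tendsto _).comp hs
  have := hlit.add hmain
  rw [zero_add] at this
  refine this.congr' ?_
  filter_upwards [self_mem_nhdsWithin] with t ht
  have ht0 : t ≠ 0 := ht
  simp only [Function.comp_apply, inner_smul_right, mul_pow, add_sub_cancel]
  have e : ∑ i, μ i * ((t⁻¹) ^ 2 * inner ℝ (β (Sum.inr i)) (ψ (p + t • q) - v) ^ 2) =
      (∑ i, μ i * inner ℝ (β (Sum.inr i)) (ψ (p + t • q) - v) ^ 2) / t ^ 2 := by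
    rw [Finset.sum_div]
    refine Finset.sum_congr rfl fun i _ => ?_
    rw [inv_pow]; ring
  rw [e]
  field_simp
  ring

end LinearAlgebra


/-! ### The phase in a chart that straightens the minimum set -/

section Chart

variable {d m k : ℕ}

theorem contDiff_det (n : WithTop ℕ∞) : ContDiff ℝ n fun F : E d →L[ℝ] E d => F.det := by
  have h : (fun F : E d →L[ℝ] E d => F.det) = fun F : E d →L[ℝ] E d =>
      ∑ σ : Equiv.Perm (Fin d), (Equiv.Perm.sign σ : ℝ) * ∏ i,
        inner ℝ (EuclideanSpace.basisFun (Fin d) ℝ (σ i)) (F (EuclideanSpace.basisFun (Fin d) ℝ i)) := by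
    ext F
    have h1 : F.det = LinearMap.det F.toLinearMap := rfl
    rw [h1, ← LinearMap.det_toMatrix (EuclideanSpace.basisFun (Fin d) ℝ).toBasis,
      Matrix.det_apply']
    refine Finset.sum_congr rfl fun σ _ => ?_
    simp only [LinearMap.toMatrix_apply, OrthonormalBasis.coe_toBasis_repr_apply,
      OrthonormalBasis.repr_apply_apply, OrthonormalBasis.coe_toBasis,
      ContinuousLinearMap.coe_coe]
  rw [h]
  refine ContDiff.sum fun σ _ => contDiff_const.mul (contDiff_prod fun i _ => ?_)
  exact contDiff_const.inner ℝ (contDiff_id.clm_apply contDiff_const)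

theorem contDiff_bump_mul {Z : Type*} [NormedAddCommGroup Z] [NormedSpace ℝ Z]
    [FiniteDimensional ℝ Z] {n : ℕ∞} {p₀ : Z} (κ : ContDiffBump p₀) {f : Z → ℝ}
    (h : ∀ p ∈ Metric.closedBall p₀ κ.rOut, ContDiffAt ℝ n f p) :
    ContDiff ℝ n fun p => κ p * f p := by
  rw [contDiff_iff_contDiffAt]
  intro p
  by_cases hp : p ∈ Metric.closedBall p₀ κ.rOut
  · exact κ.contDiffAt.mul (h p hp)
  · have h1 : (fun p => κ p * f p) =ᶠ[𝓝 p] fun _ => (0 : ℝ) := by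
      filter_upwards [Metric.isClosed_closedBall.isOpen_compl.mem_nhds hp] with q hq
      rw [κ.zero_of_le_dist, zero_mul]
      rw [Set.mem_compl_iff, Metric.mem_closedBall, not_le] at hq
      exact hq.le
    exact contDiffAt_const.congr_of_eventuallyEq h1

/-- A positive definite form at `y₀` is bounded below on the compact unit sphere. Continuity of the
second derivative carries half of this bound to nearby base points and, by Taylor's formula, to `Φ`
itself. -/
theorem exists_mul_norm_sq_le {Φ : E m × E k → ℝ} (hΦ : ContDiff ℝ 2 Φ) (h0 : ∀ y, Φ (y, 0) = 0)
    (hpos : ∀ p, 0 ≤ Φ p) {y₀ : E m} (hy : ∀ ζ, ζ ≠ 0 → 0 < fibreCoeff Φ 2 (y₀, ζ)) :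
    ∃ c, 0 < c ∧ ∃ ρ, 0 < ρ ∧ ∀ p ∈ Metric.ball (y₀, (0 : E k)) ρ, c * ‖p.2‖ ^ 2 ≤ Φ p := by
  have hcont : Continuous fun ζ => fibreCoeff Φ 2 (y₀, ζ) := by
    unfold fibreCoeff
    refine continuous_const.mul ((iteratedFDeriv ℝ 2 Φ (y₀, 0)).cont.comp ?_)
    fun_prop
  obtain ⟨c, hc, hcle⟩ := (isCompact_sphere (0 : E k) 1).exists_forall_le' hcont.continuousOn
    (a := 0) fun ζ hζ => hy ζ (by rintro rfl; simp at hζ)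
  have hhom : ∀ (t : ℝ) (y : E m) ζ, fibreCoeff Φ 2 (y, t • ζ) = t ^ 2 * fibreCoeff Φ 2 (y, ζ) := by
    intro t y ζ
    unfold fibreCoeff
    have h1 : (fun _ : Fin 2 => ((0 : E m), t • ζ)) = fun i : Fin 2 =>
        (fun _ => t) i • (fun _ : Fin 2 => ((0 : E m), ζ)) i := by
      ext i <;> simp
    simp only
    rw [h1, ContinuousMultilinearMap.map_smul_univ]
    simp
    ring
  have hcle' : ∀ ζ, c * ‖ζ‖ ^ 2 ≤ fibreCoeff Φ 2 (y₀, ζ) := by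
    intro ζ
    by_cases hζ : ζ = 0
    · have := hhom 0 y₀ 0
      simp at this
      simp [hζ, this]
    · have h1 := hcle (‖ζ‖⁻¹ • ζ) (by
        simp [norm_smul, inv_mul_cancel₀ (norm_ne_zero_iff.2 hζ)])
      have h2 : ζ = ‖ζ‖ • (‖ζ‖⁻¹ • ζ) := by
        rw [smul_smul, mul_inv_cancel₀ (norm_ne_zero_iff.2 hζ), one_smul]
      rw [h2, hhom, ← h2, mul_comm]
      gcongr
  have hDc : Continuous (iteratedFDeriv ℝ 2 Φ) := hΦ.continuous_iteratedFDeriv le_rfl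
  -- Moving the form from `y₀` to `y` costs at most `c/8`, and the Taylor remainder at most `c/8 +
  -- c/8`; more than `c/2` is left.
  obtain ⟨ρ, hρ, hball⟩ := Metric.continuousAt_iff.1 (hDc.continuousAt (x := (y₀, (0 : E k))))
    (c / 8) (by positivity)
  refine ⟨c / 2, by positivity, ρ, hρ, fun p hp => ?_⟩
  obtain ⟨y, z⟩ := p
  have hyz : dist y y₀ < ρ ∧ ‖z‖ < ρ := by
    simpa [Prod.dist_eq] using hp
  have hmem : ∀ s ∈ Set.Icc (0 : ℝ) 1, dist ((y, (0 : E k)) + s • ((0 : E m), z)) (y₀, 0) < ρ := by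
    intro s hs
    simp only [Prod.smul_mk, smul_zero, Prod.mk_add_mk, add_zero, zero_add, Prod.dist_eq,
      dist_zero_right, norm_smul, Real.norm_of_nonneg hs.1]
    refine max_lt hyz.1 (lt_of_le_of_lt ?_ hyz.2)
    exact mul_le_of_le_one_left (norm_nonneg _) hs.2
  have hy0 := hmem 0 (by simp)
  rw [zero_smul, add_zero] at hy0
  have hT := abs_sub_taylor_le (f := Φ) (x := (y, (0 : E k))) (y := ((0 : E m), z)) (N := 2)
    (ε := c / 4) (fun s _ => hΦ.contDiffAt) (fun s hs => by
      have e1 := hball (hmem s hs)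
      have e2 := hball hy0
      rw [← dist_eq_norm]
      linarith [dist_triangle_right (iteratedFDeriv ℝ 2 Φ ((y, (0 : E k)) + s • ((0 : E m), z)))
        (iteratedFDeriv ℝ 2 Φ (y, 0)) (iteratedFDeriv ℝ 2 Φ (y₀, 0))])
  have hmin : fderiv ℝ Φ (y, 0) = 0 :=
    IsLocalMin.fderiv_eq_zero (Eventually.of_forall fun q => by rw [h0]; exact hpos q)
  have hz : ‖((0 : E m), z)‖ = ‖z‖ := by simp [Prod.norm_def]
  rw [Finset.sum_range_succ, Finset.sum_range_succ, Finset.sum_range_one,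
    iteratedFDeriv_zero_apply, h0, iteratedFDeriv_one_apply, hmin, hz] at hT
  simp only [Prod.mk_add_mk, add_zero, zero_add, mul_zero, zero_apply] at hT
  have h3 : |fibreCoeff Φ 2 (y, z) - fibreCoeff Φ 2 (y₀, z)| ≤ c / 8 * ‖z‖ ^ 2 := by
    have e2 := (hball hy0).le
    rw [dist_eq_norm] at e2
    have e3 := (ContinuousMultilinearMap.le_opNorm (iteratedFDeriv ℝ 2 Φ (y, 0) -
      iteratedFDeriv ℝ 2 Φ (y₀, 0)) (fun _ => ((0 : E m), z))).trans
      (mul_le_mul_of_nonneg_right e2 (by positivity))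
    rw [Finset.prod_const, Finset.card_univ, Fintype.card_fin, hz, sub_apply,
      Real.norm_eq_abs] at e3
    unfold fibreCoeff
    rw [← mul_sub, abs_mul]
    refine (mul_le_mul_of_nonneg_left e3 (abs_nonneg _)).trans ?_
    rw [abs_of_pos (by positivity)]
    have : ((Nat.factorial 2 : ℕ) : ℝ)⁻¹ = 1 / 2 := by norm_num [Nat.factorial]
    rw [this]
    have := mul_nonneg hc.le (sq_nonneg ‖z‖)
    linarith
  have h4 : ((Nat.factorial 2 : ℕ) : ℝ)⁻¹ * iteratedFDeriv ℝ 2 Φ (y, 0) (fun _ => ((0 : E m), z)) =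
      fibreCoeff Φ 2 (y, z) := rfl
  rw [h4] at hT
  have h5 := (abs_le.1 hT).1
  have h6 := (abs_le.1 h3).1
  have h7 := hcle' z
  have := mul_nonneg hc.le (sq_nonneg ‖z‖)
  simp only
  linarith

/-- The second fibre coefficient of a function that is, near a point of the zero section, the
pull-back of a function with a normal Hessian. -/
theorem fibreCoeff_of_hasNormalHessian {Φ : E d → ℝ} {v : E d} {D : ℝ}
    (hD : HasNormalHessian m k Φ v D) {Ψ : E m × E k → ℝ} (hΨ : ContDiff ℝ 2 Ψ)
    (h0 : ∀ y, Ψ (y, 0) = 0) (hpos : ∀ p, 0 ≤ Ψ p) {ψ : E m × E k → E d} {y : E m}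
    {L : E m × E k →L[ℝ] E d} (hψ : HasFDerivAt ψ L (y, 0)) (hv : ψ (y, 0) = v)
    (heq : Ψ =ᶠ[𝓝 (y, 0)] Φ ∘ ψ) (β₀ : OrthonormalBasis (Fin m ⊕ Fin k) ℝ (E d))
    (hdet : (L.comp (prodEquiv β₀ : E d →L[ℝ] E m × E k)).det ≠ 0) :
    (∀ ζ, ζ ≠ 0 → 0 < fibreCoeff Ψ 2 (y, ζ)) ∧
    0 < (L.comp (ContinuousLinearMap.inl ℝ (E m) (E k))).toLinearMap.normDet ∧ 0 < D ∧
    (∫ ζ, Real.exp (-fibreCoeff Ψ 2 (y, ζ))) *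
      |(L.comp (prodEquiv β₀ : E d →L[ℝ] E m × E k)).det| =
      (2 * Real.pi) ^ ((k : ℝ) / 2) * D ^ (-(1 / 2) : ℝ) *
        (L.comp (ContinuousLinearMap.inl ℝ (E m) (E k))).toLinearMap.normDet := by
  obtain ⟨β, μ, hμ, rfl, hq⟩ := hD
  have hlim := tendsto_div_sq_of_hasFDerivAt hq hψ hv
  have hline : ∀ q : E m × E k, ∀ᶠ t : ℝ in 𝓝[≠] 0, Φ (ψ ((y, 0) + t • q)) = Ψ ((y, 0) + t • q) := by
    intro q
    have h1 : Tendsto (fun t : ℝ => (y, (0 : E k)) + t • q) (𝓝[≠] 0) (𝓝 (y, 0)) := by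
      have : Continuous fun t : ℝ => (y, (0 : E k)) + t • q := by fun_prop
      have h2 := this.tendsto 0
      rw [zero_smul, add_zero] at h2
      exact h2.mono_left nhdsWithin_le_nhds
    exact (h1.eventually heq).mono fun t ht => ht.symm
  have hfib : ∀ ζ, fibreCoeff Ψ 2 (y, ζ) =
      (∑ i, μ i * inner ℝ (β (Sum.inr i)) (L (0, ζ)) ^ 2) / 2 := by
    intro ζ
    refine tendsto_nhds_unique (tendsto_div_sq hΨ h0 hpos (y, ζ)) ((hlim (0, ζ)).congr' ?_)
    filter_upwards [hline (0, ζ)] with t ht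
    rw [ht]
    simp
  -- `Ψ` vanishes along the zero section, so the quadratic form vanishes on `L (η, 0)`; as all `μ i`
  -- are positive, every normal component of `L (η, 0)` is zero.
  have htan : ∀ i η, inner ℝ (β (Sum.inr i)) (L (η, 0)) = 0 := by
    intro i η
    have h1 : (∑ i, μ i * inner ℝ (β (Sum.inr i)) (L (η, 0)) ^ 2) / 2 = 0 := by
      refine tendsto_nhds_unique (hlim (η, 0)) (tendsto_const_nhds.congr' ?_)
      filter_upwards [hline (η, 0)] with t ht
      rw [ht]
      simp [h0]
    have h2 : ∑ i, μ i * inner ℝ (β (Sum.inr i)) (L (η, 0)) ^ 2 = 0 := by linarith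
    have h3 := (Finset.sum_eq_zero_iff_of_nonneg fun i _ =>
      mul_nonneg (hμ i).le (sq_nonneg _)).1 h2 i (Finset.mem_univ i)
    simpa [(hμ i).ne'] using h3
  have hprod := abs_det_comp_prodEquiv β₀ β L htan
  have hne : (L.comp (ContinuousLinearMap.inl ℝ (E m) (E k))).toLinearMap.normDet *
      |(normalMatrix β L).det| ≠ 0 := by
    rw [← hprod]
    exact abs_ne_zero.2 hdet
  have hB : (normalMatrix β L).det ≠ 0 := abs_ne_zero.1 (right_ne_zero_of_mul hne)
  refine ⟨fun ζ hζ => ?_, lt_of_le_of_ne (LinearMap.normDet_nonneg _)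
    (left_ne_zero_of_mul hne).symm, Finset.prod_pos fun i _ => hμ i, ?_⟩
  · rw [hfib]
    have h1 : (normalMatrix β L).mulVec ζ.ofLp ≠ 0 := by
      intro h
      exact hζ (by simpa using Matrix.eq_zero_of_mulVec_eq_zero hB h)
    obtain ⟨i, hi⟩ := Function.ne_iff.1 h1
    rw [normalMatrix_mulVec] at hi
    have h2 : 0 < ∑ i, μ i * inner ℝ (β (Sum.inr i)) (L (0, ζ)) ^ 2 := by
      refine Finset.sum_pos' (fun i _ => mul_nonneg (hμ i).le (sq_nonneg _))
        ⟨i, Finset.mem_univ i, ?_⟩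
      have : inner ℝ (β (Sum.inr i)) (L (0, ζ)) ≠ 0 := hi
      have := hμ i
      positivity
    linarith
  · have h1 : ∀ ζ, fibreCoeff Ψ 2 (y, ζ) =
        (∑ i, μ i * ((normalMatrix β L).mulVec ζ.ofLp i) ^ 2) / 2 := by
      intro ζ
      rw [hfib]
      simp_rw [normalMatrix_mulVec]
    simp_rw [h1]
    rw [integral_exp_neg_sum_sq hμ hB, hprod]
    have := abs_ne_zero.2 hB
    field_simp

-- The area formula for functions. Measurability is asked only on the image, since the integrand of
-- interest contains a normal determinant that is not assumed measurable elsewhere.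
open scoped ENNReal in
theorem integrableOn_image_iff_and_setIntegral_image {φ : E m → E d} {U : Set (E m)}
    (hU : IsOpen U) (hφ : ContDiffOn ℝ 1 φ U) (hinj : Set.InjOn φ U)
    (hL : ∀ y ∈ U, Function.Injective (fderiv ℝ φ y)) {h : E d → ℝ}
    (hm : AEStronglyMeasurable h (μHE[m].restrict (φ '' U))) :
    (IntegrableOn h (φ '' U) μHE[m] ↔
      IntegrableOn (fun y => (fderiv ℝ φ y).toLinearMap.normDet * h (φ y)) U) ∧
    ∫ z in φ '' U, h z ∂μHE[m] = ∫ y in U, (fderiv ℝ φ y).toLinearMap.normDet * h (φ y) := by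
  have hφm : AEMeasurable φ ((volume.restrict U).withDensity
      fun y => ENNReal.ofReal (fderiv ℝ φ y).toLinearMap.normDet) :=
    (hφ.continuousOn.aemeasurable hU.measurableSet).mono_ac (withDensity_absolutelyContinuous _ _)
  have hJm : Measurable fun y => ENNReal.ofReal (fderiv ℝ φ y).toLinearMap.normDet :=
    (continuous_normDet.measurable.comp (measurable_fderiv ℝ φ)).ennreal_ofReal
  have hlt : ∀ᵐ y ∂(volume.restrict U), ENNReal.ofReal (fderiv ℝ φ y).toLinearMap.normDet < ∞ :=
    Eventually.of_forall fun y => ENNReal.ofReal_lt_top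
  have htoReal : ∀ y, (ENNReal.ofReal (fderiv ℝ φ y).toLinearMap.normDet).toReal =
      (fderiv ℝ φ y).toLinearMap.normDet := fun y =>
    ENNReal.toReal_ofReal (LinearMap.normDet_nonneg _)
  rw [restrict_image_eq_map hU hφ hinj hL] at hm
  rw [IntegrableOn, restrict_image_eq_map hU hφ hinj hL]
  constructor
  · rw [integrable_map_measure hm hφm, integrable_withDensity_iff_integrable_smul' hJm hlt]
    simp only [htoReal, smul_eq_mul, Function.comp_apply, IntegrableOn]
  · rw [integral_map hφm hm, integral_withDensity_eq_integral_toReal_smul₀ hJm.aemeasurable hlt]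
    simp only [htoReal, smul_eq_mul]

end Chart


/-! ### Laplace's method near a point of the minimum set -/

section LocalLaplace

variable {d m k : ℕ}

/-- By the chain rule for `e ∘ e.symm = id` the derivative of the inverse chart is injective. -/
theorem det_fderiv_symm_comp_ne_zero {n : ℕ} (hn : n ≠ 0)
    {e : OpenPartialHomeomorph (E d) (E m × E k)}
    (he : ContDiffOn ℝ n e e.source) (he' : ContDiffOn ℝ n e.symm e.target)
    (T : E d ≃L[ℝ] E m × E k) {p : E m × E k} (hp : p ∈ e.target) :
    ((fderiv ℝ e.symm p).comp (T : E d →L[ℝ] E m × E k)).det ≠ 0 := by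
  have hn' : (n : WithTop ℕ∞) ≠ 0 := by exact_mod_cast hn
  have h1 : HasFDerivAt e.symm (fderiv ℝ e.symm p) p :=
    ((he'.contDiffAt (e.open_target.mem_nhds hp)).differentiableAt hn').hasFDerivAt
  have h2 : HasFDerivAt e (fderiv ℝ e (e.symm p)) (e.symm p) :=
    ((he.contDiffAt (e.open_source.mem_nhds (e.map_target hp))).differentiableAt hn').hasFDerivAt
  have h3 := h2.comp p h1
  have h4 : HasFDerivAt (e ∘ e.symm) (ContinuousLinearMap.id ℝ (E m × E k)) p := by
    refine (hasFDerivAt_id p).congr_of_eventuallyEq ?_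
    filter_upwards [e.open_target.mem_nhds hp] with q hq
    simp [e.right_inv hq]
  have h5 := h3.unique h4
  intro h0
  obtain ⟨x, hx, hx0⟩ := (Submodule.ne_bot_iff _).1
    (LinearMap.bot_lt_ker_of_det_eq_zero (f := ((fderiv ℝ e.symm p).comp
      (T : E d →L[ℝ] E m × E k)).toLinearMap) h0).ne'
  have h6 : fderiv ℝ e.symm p (T x) = 0 := hx
  have h7 := congrArg (fun F => F (T x)) h5
  simp only [ContinuousLinearMap.comp_apply, h6, map_zero, ContinuousLinearMap.id_apply] at h7
  exact hx0 (by simpa using h7.symm)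

/-- The change of variables formula concerns maps of one space to itself, so the inverse chart is
composed with the measure-preserving identification `prodEquiv β`. -/
theorem setIntegral_source_eq {n : ℕ} (hn : n ≠ 0) {e : OpenPartialHomeomorph (E d) (E m × E k)}
    (he' : ContDiffOn ℝ n e.symm e.target) (β : OrthonormalBasis (Fin m ⊕ Fin k) ℝ (E d))
    {B : Set (E m × E k)} (hB : MeasurableSet B) (hBe : B ⊆ e.target) (F : E d → ℝ) :
    ∫ z in e.symm '' B, F z = ∫ p in B,
      |((fderiv ℝ e.symm p).comp (prodEquiv β : E d →L[ℝ] E m × E k)).det| * F (e.symm p) := by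
  have hn' : (n : WithTop ℕ∞) ≠ 0 := by exact_mod_cast hn
  have himg : e.symm '' B = (e.symm ∘ prodEquiv β) '' (prodEquiv β ⁻¹' B) := by
    rw [Set.image_comp, Set.image_preimage_eq _ (prodEquiv β).surjective]
  rw [himg, integral_image_eq_integral_abs_det_fderiv_smul volume
    ((prodEquiv β).continuous.measurable hB)
    (f' := fun x => (fderiv ℝ e.symm (prodEquiv β x)).comp (prodEquiv β : E d →L[ℝ] E m × E k))]
  · exact (measurePreserving_prodEquiv β).setIntegral_preimage_emb
      (prodEquiv β).toHomeomorph.measurableEmbedding (fun p =>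
      |((fderiv ℝ e.symm p).comp (prodEquiv β : E d →L[ℝ] E m × E k)).det| * F (e.symm p)) B
  · intro x hx
    have h1 : HasFDerivAt e.symm (fderiv ℝ e.symm (prodEquiv β x)) (prodEquiv β x) :=
      ((he'.contDiffAt (e.open_target.mem_nhds (hBe hx))).differentiableAt hn').hasFDerivAt
    exact (h1.comp x (prodEquiv β).hasFDerivAt).hasFDerivWithinAt
  · refine Set.InjOn.comp (t := B) ?_ (prodEquiv β).injective.injOn fun x hx => hx
    exact e.symm.injOn.mono hBe

/-- The phase, pulled back by the inverse chart, vanishes on the zero section and is at least a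
multiple of `‖z‖²` near the given point. Once extended to the whole product space it falls under the
product case, with the Jacobian of the chart as part of the amplitude. For the leading coefficient,
`fibreCoeff_of_hasNormalHessian` evaluates the fibre integral, and the tangential Jacobian left over
is the area element of `M`. The bound for the distance to `M` serves later to compare two phases. -/
theorem exists_local_laplace {r : ℕ} {Φ a : E d → ℝ} {W M : Set (E d)} (hW : IsOpen W)
    (hΦ : ContDiffOn ℝ (2 * r + 2 : ℕ) Φ W) (ha : ContDiffOn ℝ (2 * r : ℕ) a W)
    (hpos : ∀ z ∈ W, 0 ≤ Φ z) (hMW : M ⊆ W) (hMm : MeasurableSet M) (hM0 : ∀ z ∈ M, Φ z = 0)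
    {D : E d → ℝ} (hD : ∀ v ∈ M, HasNormalHessian m k Φ v (D v))
    {e : OpenPartialHomeomorph (E d) (E m × E k)} (he : ContDiffOn ℝ (2 * r + 2 : ℕ) e e.source)
    (he' : ContDiffOn ℝ (2 * r + 2 : ℕ) e.symm e.target)
    (heM : ∀ w ∈ e.source, w ∈ M ↔ (e w).2 = 0) {v₀ : E d} (hv₀ : v₀ ∈ M) (hv₀e : v₀ ∈ e.source) :
    ∃ V, IsOpen V ∧ v₀ ∈ V ∧ V ⊆ W ∧ (∃ C, ∀ z ∈ V, Metric.infDist z M ^ 2 ≤ C * Φ z) ∧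
      ∀ θ : E d → ℝ, ContDiff ℝ (2 * r : ℕ) θ → tsupport θ ⊆ V →
      IntegrableOn (fun z => θ z * a z * D z ^ (-(1 / 2) : ℝ)) M μHE[m] ∧
      ∃ c : ℕ → ℝ, c 0 = (2 * Real.pi) ^ ((k : ℝ) / 2) *
          ∫ z in M, θ z * a z * D z ^ (-(1 / 2) : ℝ) ∂μHE[m] ∧
        HasAsymptotics r c fun l => l ^ ((k : ℝ) / 2) *
          ∫ z, θ z * a z * Real.exp (-(l * Φ z)) := by
  obtain ⟨β₀, -⟩ := hD v₀ hv₀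
  set ψ := e.symm with hψdef
  set Ω : Set (E m × E k) := e.target ∩ ψ ⁻¹' W with hΩdef
  have hΩo : IsOpen Ω := e.symm.isOpen_inter_preimage hW
  have hp₀2 : (e v₀).2 = 0 := (heM v₀ hv₀e).1 hv₀
  set y₀ := (e v₀).1 with hy₀
  have hp₀ : e v₀ = (y₀, 0) := by rw [← hp₀2]
  have hψp₀ : ψ (y₀, 0) = v₀ := by rw [← hp₀]; exact e.left_inv hv₀e
  have hp₀Ω : (y₀, (0 : E k)) ∈ Ω := by
    refine ⟨by rw [← hp₀]; exact e.map_source hv₀e, ?_⟩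
    rw [Set.mem_preimage, hψp₀]
    exact hMW hv₀
  have hψd : ∀ p ∈ e.target, ContDiffAt ℝ (2 * r + 2 : ℕ) ψ p := fun p hp =>
    he'.contDiffAt (e.open_target.mem_nhds hp)
  have hΦψ : ∀ p ∈ Ω, ContDiffAt ℝ (2 * r + 2 : ℕ) (Φ ∘ ψ) p := fun p hp =>
    (hΦ.contDiffAt (hW.mem_nhds hp.2)).comp p (hψd p hp.1)
  have hψM : ∀ y, (y, (0 : E k)) ∈ e.target → ψ (y, 0) ∈ M := fun y hy => by
    rw [heM _ (e.map_target hy), e.right_inv hy]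
  have hn2 : ((2 : ℕ) : WithTop ℕ∞) ≤ ((2 * r + 2 : ℕ) : WithTop ℕ∞) := by
    exact_mod_cast Nat.le_add_left 2 (2 * r)
  have hn0 : ((2 * r + 2 : ℕ) : WithTop ℕ∞) ≠ 0 := by exact_mod_cast Nat.succ_ne_zero (2 * r + 1)
  have hψL : ∀ p ∈ e.target, HasFDerivAt ψ (fderiv ℝ ψ p) p := fun p hp =>
    ((hψd p hp).differentiableAt hn0).hasFDerivAt
  have hdet : ∀ p ∈ e.target, ((fderiv ℝ ψ p).comp
      (prodEquiv β₀ : E d →L[ℝ] E m × E k)).det ≠ 0 := fun p hp =>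
    det_fderiv_symm_comp_ne_zero (Nat.succ_ne_zero _) he he' _ hp
  -- globalization of a function on `ℝ^m × ℝ^k` by means of a bump function
  have hglob : ∀ (κ : ContDiffBump (y₀, (0 : E k))) (G : E m × E k → ℝ),
      (∀ p ∈ Metric.closedBall (y₀, (0 : E k)) κ.rOut, ContDiffAt ℝ (2 * r + 2 : ℕ) G p) →
      ContDiff ℝ (2 * r + 2 : ℕ) fun p => κ p * G p + (1 - κ p) * ‖p.2‖ ^ 2 := by
    intro κ G hG
    refine (contDiff_bump_mul (n := (2 * r + 2 : ℕ)) κ hG).add ?_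
    exact (contDiff_const.sub κ.contDiff).mul (contDiff_snd.norm_sq ℝ)
  obtain ⟨ρ₁, hρ₁, hball₁⟩ := Metric.nhds_basis_closedBall.mem_iff.1 (hΩo.mem_nhds hp₀Ω)
  -- Outside the chart the pulled-back phase has no meaning; interpolating with `‖z‖²` keeps it
  -- smooth, nonnegative and zero on the zero section.
  let κ₁ : ContDiffBump (y₀, (0 : E k)) := ⟨ρ₁ / 2, ρ₁, by positivity, by linarith⟩
  set Φ₁ : E m × E k → ℝ := fun p => κ₁ p * (Φ ∘ ψ) p + (1 - κ₁ p) * ‖p.2‖ ^ 2 with hΦ₁def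
  have hΦ₁ : ContDiff ℝ (2 * r + 2 : ℕ) Φ₁ := hglob κ₁ _ fun p hp => hΦψ p (hball₁ hp)
  have hκ₁0 : ∀ p, p ∉ Ω → κ₁ p = 0 := fun p hp => by
    by_contra h
    have : p ∈ Function.support κ₁ := h
    rw [κ₁.support_eq] at this
    exact hp (hball₁ (Metric.ball_subset_closedBall this))
  have hΦ₁pos : ∀ p, 0 ≤ Φ₁ p := fun p => by
    refine add_nonneg ?_ (mul_nonneg (by linarith [κ₁.le_one (x := p)]) (sq_nonneg _))
    by_cases hp : p ∈ Ω
    · exact mul_nonneg κ₁.nonneg (hpos _ hp.2)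
    · rw [hκ₁0 p hp, zero_mul]
  have hΦ₁0 : ∀ y, Φ₁ (y, 0) = 0 := fun y => by
    simp only [hΦ₁def, Function.comp_apply, norm_zero, ne_eq, OfNat.ofNat_ne_zero,
      not_false_eq_true, zero_pow, mul_zero, add_zero]
    by_cases hp : (y, (0 : E k)) ∈ Ω
    · rw [hM0 _ (hψM y hp.1), mul_zero]
    · rw [hκ₁0 _ hp, zero_mul]
  have hΦ₁eq : ∀ p ∈ Metric.ball (y₀, (0 : E k)) (ρ₁ / 2), Φ₁ p = (Φ ∘ ψ) p := fun p hp => by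
    simp only [hΦ₁def, κ₁.one_of_mem_closedBall (Metric.ball_subset_closedBall hp)]
    ring
  obtain ⟨c, hc, ρ', hρ', hcle⟩ := exists_mul_norm_sq_le (hΦ₁.of_le hn2) hΦ₁0 hΦ₁pos
    (fibreCoeff_of_hasNormalHessian (hD v₀ hv₀) (hΦ₁.of_le hn2) hΦ₁0 hΦ₁pos
      (hψL _ hp₀Ω.1) hψp₀ (by
        filter_upwards [Metric.ball_mem_nhds (y₀, (0 : E k)) (half_pos hρ₁)] with p hp
        exact hΦ₁eq p hp) β₀ (hdet _ hp₀Ω.1)).1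
  set ρ := min ρ' (ρ₁ / 2) with hρdef
  have hρ : 0 < ρ := lt_min hρ' (half_pos hρ₁)
  -- The quadratic lower bound for `Φ₁` is only local. A second interpolation on the smaller ball
  -- makes it global.
  let κ : ContDiffBump (y₀, (0 : E k)) := ⟨ρ / 2, ρ, by positivity, by linarith⟩
  set Φ₂ : E m × E k → ℝ := fun p => κ p * Φ₁ p + (1 - κ p) * ‖p.2‖ ^ 2 with hΦ₂def
  have hΦ₂ : ContDiff ℝ (2 * r + 2 : ℕ) Φ₂ := hglob κ _ fun p _ => hΦ₁.contDiffAt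
  have hΦ₂0 : ∀ y, Φ₂ (y, 0) = 0 := fun y => by simp [hΦ₂def, hΦ₁0]
  have hΦ₂le : ∀ p, min c 1 * ‖p.2‖ ^ 2 ≤ Φ₂ p := fun p => by
    have h1 : κ p * (min c 1 * ‖p.2‖ ^ 2) ≤ κ p * Φ₁ p := by
      by_cases hp : p ∈ Metric.ball (y₀, (0 : E k)) ρ
      · refine mul_le_mul_of_nonneg_left ?_ κ.nonneg
        refine le_trans ?_ (hcle p (Metric.ball_subset_ball (min_le_left _ _) hp))
        gcongr
        exact min_le_left _ _
      · have : κ p = 0 := κ.zero_of_le_dist (not_lt.1 hp)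
        rw [this]; simp
    have h2 : (1 - κ p) * (min c 1 * ‖p.2‖ ^ 2) ≤ (1 - κ p) * ‖p.2‖ ^ 2 := by
      refine mul_le_mul_of_nonneg_left ?_ (by linarith [κ.le_one (x := p)])
      exact mul_le_of_le_one_left (sq_nonneg _) (min_le_right _ _)
    simp only [hΦ₂def]
    linarith
  have hc1 : 0 < min c 1 := lt_min hc one_pos
  have hΦ₂pos : ∀ p, 0 ≤ Φ₂ p := fun p => le_trans (by positivity) (hΦ₂le p)
  set B := Metric.ball (y₀, (0 : E k)) (ρ / 2) with hBdef
  have hρρ₁ : ρ ≤ ρ₁ / 2 := min_le_right _ _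
  have hcbΩ : Metric.closedBall (y₀, (0 : E k)) ρ ⊆ Ω :=
    (Metric.closedBall_subset_closedBall (by linarith)).trans hball₁
  have hBΩ : B ⊆ Ω := Metric.ball_subset_closedBall.trans
    ((Metric.closedBall_subset_closedBall (by linarith)).trans hcbΩ)
  have hΦ₂eq : ∀ p ∈ B, Φ₂ p = (Φ ∘ ψ) p := fun p hp => by
    simp only [hΦ₂def, κ.one_of_mem_closedBall (Metric.ball_subset_closedBall hp)]
    rw [hΦ₁eq p (Metric.ball_subset_ball (by linarith) hp)]
    ring
  set V := e.source ∩ e ⁻¹' B with hVdef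
  have hVB : V = ψ '' B := by
    ext z
    constructor
    · rintro ⟨hz1, hz2⟩
      exact ⟨e z, hz2, e.left_inv hz1⟩
    · rintro ⟨p, hp, rfl⟩
      have := (hBΩ hp).1
      exact ⟨e.map_target this, by rw [Set.mem_preimage, e.right_inv this]; exact hp⟩
  have hVo : IsOpen V := e.isOpen_inter_preimage Metric.isOpen_ball
  refine ⟨V, hVo, ⟨hv₀e, ?_⟩, ?_, ?_, fun θ hθ hθV => ?_⟩
  · rw [Set.mem_preimage, hp₀]
    exact Metric.mem_ball_self (by positivity)
  · rw [hVB]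
    rintro _ ⟨p, hp, rfl⟩
    exact (hBΩ hp).2
  -- The point of `M` over the same base point is at distance at most `K‖z‖`, by the mean value
  -- inequality, and `‖z‖²` is bounded by the phase.
  · have hfc : ContinuousOn (fderiv ℝ ψ) (Metric.closedBall (y₀, (0 : E k)) ρ) := fun p hp =>
      ((hψd p (hcbΩ hp).1).fderiv_right (m := 0) (by
        exact_mod_cast Nat.le_add_left 1 (2 * r + 1))).continuousAt.continuousWithinAt
    obtain ⟨K, hK⟩ := (isCompact_closedBall (y₀, (0 : E k)) ρ).exists_bound_of_continuousOn hfc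
    refine ⟨K ^ 2 / min c 1, ?_⟩
    rw [hVB]
    rintro _ ⟨p, hp, rfl⟩
    have hp' : (p.1, (0 : E k)) ∈ B := by
      rw [hBdef, Metric.mem_ball, Prod.dist_eq] at hp ⊢
      exact max_lt (lt_of_le_of_lt (le_max_left _ _) hp) (by simpa using by positivity)
    have hBcb : B ⊆ Metric.closedBall (y₀, (0 : E k)) ρ :=
      Metric.ball_subset_closedBall.trans (Metric.closedBall_subset_closedBall (by linarith))
    have h1 := (convex_ball (y₀, (0 : E k)) (ρ / 2)).norm_image_sub_le_of_norm_fderiv_le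
      (f := ψ) (𝕜 := ℝ) (fun q hq => (hψL q (hBΩ hq).1).differentiableAt)
      (fun q hq => hK q (hBcb hq)) hp' hp
    have h2 : ‖p - (p.1, (0 : E k))‖ = ‖p.2‖ := by
      rw [show p - (p.1, (0 : E k)) = (0, p.2) by ext <;> simp, Prod.norm_def]
      simp
    rw [h2] at h1
    have h3 : Metric.infDist (ψ p) M ≤ K * ‖p.2‖ :=
      (Metric.infDist_le_dist_of_mem (hψM p.1 (hBΩ hp').1)).trans (by rw [dist_eq_norm]; exact h1)
    have h4 := hΦ₂le p
    rw [hΦ₂eq p hp] at h4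
    calc Metric.infDist (ψ p) M ^ 2 ≤ (K * ‖p.2‖) ^ 2 :=
          pow_le_pow_left₀ Metric.infDist_nonneg h3 2
      _ = K ^ 2 / min c 1 * (min c 1 * ‖p.2‖ ^ 2) := by field_simp
      _ ≤ _ := by gcongr; exact h4
  have hθ0 : ∀ z, z ∉ V → θ z = 0 := fun z hz => by
    by_contra h
    exact hz (hθV (subset_tsupport _ h))
  set J : E m × E k → ℝ := fun p =>
    |((fderiv ℝ ψ p).comp (prodEquiv β₀ : E d →L[ℝ] E m × E k)).det| with hJdef
  -- The cutoff only serves global smoothness: `θ` is supported in `V`, and over `V` it equals one.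
  set b : E m × E k → ℝ := fun p => κ p * (θ (ψ p) * a (ψ p) * J p) with hbdef
  have hb : ContDiff ℝ (2 * r : ℕ) b := by
    refine contDiff_bump_mul (n := (2 * r : ℕ)) κ fun p hp => ?_
    have hpΩ := hcbΩ hp
    have hle : ((2 * r : ℕ) : WithTop ℕ∞) ≤ ((2 * r + 2 : ℕ) : WithTop ℕ∞) := by
      exact_mod_cast Nat.le_add_right _ _
    have hψ' : ContDiffAt ℝ (2 * r : ℕ) ψ p := (hψd p hpΩ.1).of_le hle
    refine ((hθ.contDiffAt.comp p hψ').mul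
      (((ha.contDiffAt (hW.mem_nhds hpΩ.2))).comp p hψ')).mul ?_
    have h1 : ContDiffAt ℝ (2 * r : ℕ) (fun p => (fderiv ℝ ψ p).comp
        (prodEquiv β₀ : E d →L[ℝ] E m × E k)) p := by
      refine ContDiffAt.clm_comp ((hψd p hpΩ.1).fderiv_right ?_) contDiffAt_const
      exact_mod_cast Nat.le_succ (2 * r + 1)
    exact (contDiffAt_abs (hdet p hpΩ.1)).comp p
      ((contDiff_det (2 * r : ℕ)).contDiffAt.comp p h1)
  have hbc : HasCompactSupport b := by
    refine κ.hasCompactSupport.mono fun p hp => ?_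
    exact left_ne_zero_of_mul hp
  have hbB : ∀ p ∈ B, b p = θ (ψ p) * a (ψ p) * J p := fun p hp => by
    simp only [hbdef, κ.one_of_mem_closedBall (Metric.ball_subset_closedBall hp), one_mul]
  have hb0 : ∀ p, p ∉ B → b p = 0 := fun p hp => by
    by_cases hpt : p ∈ e.target
    · have : ψ p ∉ V := by
        rintro ⟨-, h2⟩
        rw [Set.mem_preimage, e.right_inv hpt] at h2
        exact hp h2
      simp [hbdef, hθ0 _ this]
    · have : κ p = 0 := κ.zero_of_le_dist (not_lt.1 fun h =>
        hpt (hcbΩ (Metric.ball_subset_closedBall h)).1)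
      simp [hbdef, this]
  obtain ⟨hint, c', hc'0, hc'⟩ := exists_hasAsymptotics_laplace hb hbc hΦ₂ hΦ₂0 hc1 hΦ₂le
  have hcv : ∀ l, ∫ z, θ z * a z * Real.exp (-(l * Φ z)) =
      ∫ p, b p * Real.exp (-(l * Φ₂ p)) := by
    intro l
    rw [← setIntegral_eq_integral_of_forall_compl_eq_zero (s := V)
      (fun z hz => by rw [hθ0 z hz]; ring), hVB, setIntegral_source_eq (Nat.succ_ne_zero _) he' β₀
      Metric.isOpen_ball.measurableSet (fun p hp => (hBΩ hp).1),
      ← setIntegral_eq_integral_of_forall_compl_eq_zero (s := B)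
      (f := fun p => b p * Real.exp (-(l * Φ₂ p))) (fun p hp => by rw [hb0 p hp, zero_mul])]
    refine setIntegral_congr_fun Metric.isOpen_ball.measurableSet fun p hp => ?_
    simp only
    rw [hbB p hp, hΦ₂eq p hp]
    simp only [hJdef, Function.comp_apply]
    ring
  -- the leading coefficient
  set φ : E m → E d := fun y => ψ (y, 0) with hφdef
  set U : Set (E m) := {y | (y, (0 : E k)) ∈ B} with hUdef
  have hUo : IsOpen U := Metric.isOpen_ball.preimage (by fun_prop)
  have hUt : ∀ y ∈ U, (y, (0 : E k)) ∈ e.target := fun y hy => (hBΩ hy).1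
  have hφL : ∀ y ∈ U, HasFDerivAt φ ((fderiv ℝ ψ (y, 0)).comp
      (ContinuousLinearMap.inl ℝ (E m) (E k))) y := fun y hy =>
    (hψL _ (hUt y hy)).comp y (hasFDerivAt_prodMk_left y (0 : E k))
  have hφc : ContDiffOn ℝ 1 φ U := fun y hy => by
    have h1 : ContDiffAt ℝ 1 ψ (y, 0) := (hψd _ (hUt y hy)).of_le (by
      exact_mod_cast Nat.le_add_left 1 (2 * r + 1))
    exact (h1.comp y (contDiff_id.prodMk contDiff_const).contDiffAt).contDiffWithinAt
  have hφinj : Set.InjOn φ U := fun y hy y' hy' h => by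
    have := e.symm.injOn (hUt y hy) (hUt y' hy') h
    exact congrArg Prod.fst this
  have hφi : ∀ y ∈ U, Function.Injective (fderiv ℝ φ y) := fun y hy => by
    rw [(hφL y hy).fderiv]
    have h1 : Function.Injective (fderiv ℝ ψ (y, 0)) := by
      rw [injective_iff_map_eq_zero]
      intro q hq
      by_contra hq0
      refine hdet _ (hUt y hy) ?_
      have h2 : ((fderiv ℝ ψ (y, 0)).comp (prodEquiv β₀ : E d →L[ℝ] E m × E k)).det =
        LinearMap.det ((fderiv ℝ ψ (y, 0)).comp
          (prodEquiv β₀ : E d →L[ℝ] E m × E k)).toLinearMap := rfl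
      rw [h2]
      refine LinearMap.det_eq_zero_iff_ker_ne_bot.2 ((Submodule.ne_bot_iff _).2
        ⟨(prodEquiv β₀).symm q, ?_, by simpa using hq0⟩)
      simpa using hq
    exact h1.comp fun y y' h => congrArg Prod.fst h
  have hφU : φ '' U = M ∩ V := by
    ext z
    constructor
    · rintro ⟨y, hy, rfl⟩
      exact ⟨hψM y (hUt y hy), by rw [hVB]; exact ⟨_, hy, rfl⟩⟩
    · rintro ⟨hzM, hz1, hz2⟩
      have h1 := (heM z hz1).1 hzM
      have h2 : ((e z).1, (0 : E k)) = e z := by rw [← h1]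
      refine ⟨(e z).1, ?_, ?_⟩
      · rw [hUdef, Set.mem_ofPred_eq, h2]; exact hz2
      · simp only [hφdef, h2]; exact e.left_inv hz1
  set h : E d → ℝ := fun z => θ z * a z * D z ^ (-(1 / 2) : ℝ) with hhdef
  have hkey : ∀ y ∈ U, 0 < (fderiv ℝ φ y).toLinearMap.normDet ∧
      ∫ ζ, b (y, 0) * Real.exp (-fibreCoeff Φ₂ 2 (y, ζ)) =
        (2 * Real.pi) ^ ((k : ℝ) / 2) * ((fderiv ℝ φ y).toLinearMap.normDet * h (φ y)) := by
    intro y hy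
    have h1 := fibreCoeff_of_hasNormalHessian (hD _ (hψM y (hUt y hy))) (hΦ₂.of_le hn2) hΦ₂0
      hΦ₂pos (hψL _ (hUt y hy)) rfl (by
        filter_upwards [Metric.isOpen_ball.mem_nhds hy] with p hp
        exact hΦ₂eq p hp) β₀ (hdet _ (hUt y hy))
    rw [(hφL y hy).fderiv, integral_const_mul, hbB _ hy]
    refine ⟨h1.2.1, ?_⟩
    simp only [hhdef, hφdef, hJdef]
    linear_combination (θ (ψ (y, 0)) * a (ψ (y, 0))) * h1.2.2.2
  have hπ : 0 < (2 * Real.pi) ^ ((k : ℝ) / 2) := by positivity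
  -- `D` is an arbitrary function, so the measurability of `h` is recovered from `hkey`, which
  -- expresses it through a measurable fibre integral and the Jacobian.
  have hmeas : AEStronglyMeasurable h (μHE[m].restrict (φ '' U)) := by
    have hfc : Continuous (fibreCoeff Φ₂ 2) :=
      (fibreCoeff_mem isCompact_empty hΦ₂ (Nat.le_add_left 2 (2 * r))).1
    have hIm : Measurable fun y => ∫ ζ, b (y, 0) * Real.exp (-fibreCoeff Φ₂ 2 (y, ζ)) := by
      have : Continuous fun p : E m × E k => b (p.1, 0) * Real.exp (-fibreCoeff Φ₂ 2 p) := by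
        have := hb.continuous
        fun_prop
      exact (this.stronglyMeasurable.integral_prod_right (ν := volume)).measurable
    have hh0 : Measurable fun y => (∫ ζ, b (y, 0) * Real.exp (-fibreCoeff Φ₂ 2 (y, ζ))) /
        ((2 * Real.pi) ^ ((k : ℝ) / 2) * (fderiv ℝ φ y).toLinearMap.normDet) :=
      hIm.div (measurable_const.mul (continuous_normDet.measurable.comp (measurable_fderiv ℝ φ)))
    have hSm : MeasurableSet (φ '' U) := by rw [hφU]; exact hMm.inter hVo.measurableSet
    have hec : AEMeasurable (fun z => (e z).1) (μHE[m].restrict (φ '' U)) := by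
      refine ContinuousOn.aemeasurable ?_ hSm
      refine continuous_fst.comp_continuousOn (e.continuousOn.mono ?_)
      rw [hφU]
      exact fun z hz => hz.2.1
    refine (hh0.comp_aemeasurable hec).aestronglyMeasurable.congr ?_
    refine (ae_restrict_mem hSm).mono fun z hz => ?_
    obtain ⟨y, hy, rfl⟩ := hz
    have h1 : (e (φ y)).1 = y := by
      simp only [hφdef]
      rw [e.right_inv (hUt y hy)]
    simp only [Function.comp_apply, h1]
    obtain ⟨h2, h3⟩ := hkey y hy
    rw [h3]
    field_simp
  obtain ⟨harea1, harea2⟩ :=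
    integrableOn_image_iff_and_setIntegral_image hUo hφc hφinj hφi hmeas
  have hMV0 : ∀ z ∈ M \ (φ '' U), h z = 0 := fun z hz => by
    have : z ∉ V := fun hzV => hz.2 (by rw [hφU]; exact ⟨hz.1, hzV⟩)
    simp [hhdef, hθ0 z this]
  have hsub : φ '' U ⊆ M := by rw [hφU]; exact Set.inter_subset_left
  refine ⟨?_, c', ?_, ?_⟩
  · refine IntegrableOn.of_forall_sdiff_eq_zero (harea1.2 ?_) hMm hMV0
    have h1 : IntegrableOn (fun y => ((2 * Real.pi) ^ ((k : ℝ) / 2))⁻¹ *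
        ∫ ζ, b (y, 0) * Real.exp (-fibreCoeff Φ₂ 2 (y, ζ))) U :=
      (hint.integral_prod_left.const_mul _).integrableOn
    refine h1.congr_fun (fun y hy => ?_) hUo.measurableSet
    simp only
    rw [(hkey y hy).2]
    field_simp
  · rw [hc'0, setIntegral_eq_of_subset_of_forall_sdiff_eq_zero hMm hsub hMV0, harea2,
      ← integral_const_mul, Measure.volume_eq_prod, integral_prod _ hint,
      ← setIntegral_eq_integral_of_forall_compl_eq_zero (s := U) (fun y hy => by
        simp [hb0 (y, 0) hy])]
    exact setIntegral_congr_fun hUo.measurableSet fun y hy => (hkey y hy).2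
  · simp_rw [hcv]
    exact hc'

end LocalLaplace


/-! ### Laplace's method along a compact submanifold -/

section Global

theorem HasAsymptotics.add {r : ℕ} {c c' : ℕ → ℝ} {f f' : ℝ → ℝ} (h : HasAsymptotics r c f)
    (h' : HasAsymptotics r c' f') : HasAsymptotics r (c + c') fun l => f l + f' l := by
  refine (IsLittleO.add h h').congr_left fun l => ?_
  simp only [Pi.add_apply, add_mul, Finset.sum_add_distrib]
  ring

theorem HasAsymptotics.of_isLittleO {r : ℕ} {c : ℕ → ℝ} {f f' : ℝ → ℝ} (h : HasAsymptotics r c f)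
    (h' : (fun l => f' l - f l) =o[atTop] fun l : ℝ => (l⁻¹) ^ r) : HasAsymptotics r c f' := by
  refine (IsLittleO.add h h').congr_left fun l => ?_
  ring

theorem hasAsymptotics_zero (r : ℕ) : HasAsymptotics r 0 fun _ => 0 := by
  refine (isLittleO_zero _ _).congr_left fun l => ?_
  simp

theorem HasAsymptotics.sum {ι : Type*} (s : Finset ι) {r : ℕ} {c : ι → ℕ → ℝ} {f : ι → ℝ → ℝ}
    (h : ∀ i ∈ s, HasAsymptotics r (c i) (f i)) :
    HasAsymptotics r (∑ i ∈ s, c i) fun l => ∑ i ∈ s, f i l := by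
  classical
  induction s using Finset.induction_on with
  | empty => simpa using hasAsymptotics_zero r
  | insert i s his ih =>
    simp only [Finset.sum_insert his]
    exact (h i (Finset.mem_insert_self i s)).add
      (ih fun j hj => h j (Finset.mem_insert_of_mem hj))

theorem HasAsymptotics.tendsto {r : ℕ} {c : ℕ → ℝ} {f : ℝ → ℝ} (h : HasAsymptotics r c f) :
    Tendsto f atTop (𝓝 (c 0)) := by
  have hinv : Tendsto (fun l : ℝ => l⁻¹) atTop (𝓝 0) := tendsto_inv_atTop_zero
  have h1 : Tendsto (fun l => f l - ∑ i ∈ Finset.range (r + 1), c i * (l⁻¹) ^ i) atTop (𝓝 0) := by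
    rw [HasAsymptotics] at h
    exact (isLittleO_one_iff ℝ).1 (h.trans_isBigO ((hinv.pow r).isBigO_one ℝ))
  have h2 : Tendsto (fun l : ℝ => ∑ i ∈ Finset.range (r + 1), c i * (l⁻¹) ^ i) atTop (𝓝 (c 0)) := by
    have : Continuous fun x : ℝ => ∑ i ∈ Finset.range (r + 1), c i * x ^ i := by fun_prop
    have h3 := (this.tendsto 0).comp hinv
    rw [Finset.sum_range_succ'] at h3
    simpa [Function.comp_def] using h3
  simpa using h1.add h2

theorem isLittleO_rpow_mul_exp_neg (s : ℝ) {ε : ℝ} (hε : 0 < ε) (r : ℕ) :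
    (fun l : ℝ => l ^ s * Real.exp (-(ε * l))) =o[atTop] fun l : ℝ => (l⁻¹) ^ r := by
  have h := isLittleO_exp_neg_mul_rpow_atTop hε (-(r : ℝ) - s)
  have h1 : (fun l : ℝ => l ^ s * Real.exp (-ε * l)) =o[atTop]
      fun l => l ^ s * l ^ (-(r : ℝ) - s) := (isBigO_refl (fun l : ℝ => l ^ s) atTop).mul_isLittleO h
  refine h1.congr' (Eventually.of_forall fun l => by simp only [neg_mul]) ?_
  filter_upwards [eventually_gt_atTop 0] with l hl
  rw [← Real.rpow_add hl, add_sub_cancel, Real.rpow_neg hl.le, Real.rpow_natCast, inv_pow]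

variable {d : ℕ}

/-- The data of a Laplace integral over an open set `W`, whose phase is minimal exactly on `M`. -/
structure IsLaplaceData (Φ a : E d → ℝ) (W M : Set (E d)) : Prop where
  isOpen : IsOpen W
  subset : M ⊆ W
  amplitude_nonneg : ∀ z ∈ W, 0 ≤ a z
  integrableOn : ∀ l : ℝ, 0 < l → IntegrableOn (fun z => a z * Real.exp (-(l * Φ z))) W
  separation : ∀ N, IsOpen N → M ⊆ N → ∃ ε, 0 < ε ∧ ∀ z ∈ W, z ∉ N → ε ≤ Φ z

/-- The part of a Laplace integral away from the minimum set is negligible. -/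
theorem IsLaplaceData.isLittleO_away {Φ a : E d → ℝ} {W M : Set (E d)} (hL : IsLaplaceData Φ a W M)
    {N : Set (E d)} (hN : IsOpen N) (hMN : M ⊆ N) (s : ℝ) (r : ℕ) :
    (fun l : ℝ => l ^ s * ∫ z in W \ N, a z * Real.exp (-(l * Φ z))) =o[atTop]
      fun l : ℝ => (l⁻¹) ^ r := by
  obtain ⟨ε, hε, hle⟩ := hL.separation N hN hMN
  have hWm : MeasurableSet (W \ N) := hL.isOpen.measurableSet.diff hN.measurableSet
  set I := ∫ z in W, a z * Real.exp (-(1 * Φ z)) with hI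
  refine IsBigO.trans_isLittleO (g := fun l : ℝ => l ^ s * Real.exp (-(ε * l))) ?_
    (isLittleO_rpow_mul_exp_neg s hε r)
  refine (isBigO_refl (fun l : ℝ => l ^ s) atTop).mul (IsBigO.of_bound (Real.exp ε * I) ?_)
  filter_upwards [eventually_ge_atTop 1] with l hl
  have h0 : 0 ≤ ∫ z in W \ N, a z * Real.exp (-(l * Φ z)) :=
    setIntegral_nonneg hWm fun z hz => mul_nonneg (hL.amplitude_nonneg z hz.1) (Real.exp_pos _).le
  rw [Real.norm_of_nonneg h0, Real.norm_of_nonneg (Real.exp_pos _).le]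
  calc ∫ z in W \ N, a z * Real.exp (-(l * Φ z))
      ≤ ∫ z in W \ N, Real.exp ε * Real.exp (-(ε * l)) * (a z * Real.exp (-(1 * Φ z))) := by
        refine setIntegral_mono_on ((hL.integrableOn l (by linarith)).mono_set Set.sdiff_subset)
          (((hL.integrableOn 1 one_pos).mono_set Set.sdiff_subset).const_mul _) hWm fun z hz => ?_
        -- For `l ≥ 1` and `Φ z ≥ ε` one has `l Φ z ≥ Φ z + ε (l - 1)`, so a multiple of the
        -- integrand at `l = 1` dominates.
        rw [← Real.exp_add, mul_left_comm, ← Real.exp_add]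
        refine mul_le_mul_of_nonneg_left (Real.exp_le_exp.2 ?_) (hL.amplitude_nonneg z hz.1)
        nlinarith [hle z hz.1 hz.2]
    _ = Real.exp ε * Real.exp (-(ε * l)) * ∫ z in W \ N, a z * Real.exp (-(1 * Φ z)) :=
        integral_const_mul _ _
    _ ≤ Real.exp ε * Real.exp (-(ε * l)) * I := by
        refine mul_le_mul_of_nonneg_left ?_ (by positivity)
        refine setIntegral_mono_set (hL.integrableOn 1 one_pos) ?_
          (Eventually.of_forall fun z hz => hz.1)
        exact (ae_restrict_mem hL.isOpen.measurableSet).mono fun z hz =>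
          mul_nonneg (hL.amplitude_nonneg z hz) (Real.exp_pos _).le
    _ = _ := by ring

open scoped Manifold ContDiff in
/-- The Laplace method for a phase whose minimum set is a compact submanifold, along which the phase
is non-degenerate in the normal directions. -/
theorem IsLaplaceData.exists_hasAsymptotics {m k r : ℕ} {Φ a : E d → ℝ} {W M : Set (E d)}
    (hL : IsLaplaceData Φ a W M) (hΦ : ContDiffOn ℝ (2 * r + 2 : ℕ) Φ W)
    (ha : ContDiffOn ℝ (2 * r : ℕ) a W) (hpos : ∀ z ∈ W, 0 ≤ Φ z) (hMc : IsCompact M)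
    (hM0 : ∀ z ∈ M, Φ z = 0) {D : E d → ℝ} (hD : ∀ v ∈ M, HasNormalHessian m k Φ v (D v))
    (hM : ∀ v ∈ M, ∃ e : OpenPartialHomeomorph (E d) (E m × E k),
      v ∈ e.source ∧ ContDiffOn ℝ (2 * r + 2 : ℕ) e e.source ∧
      ContDiffOn ℝ (2 * r + 2 : ℕ) e.symm e.target ∧ ∀ w ∈ e.source, w ∈ M ↔ (e w).2 = 0) :
    IntegrableOn (fun z => a z * D z ^ (-(1 / 2) : ℝ)) M μHE[m] ∧
    (∃ N, IsOpen N ∧ M ⊆ N ∧ ∃ C, ∀ z ∈ N, Metric.infDist z M ^ 2 ≤ C * Φ z) ∧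
    ∃ c : ℕ → ℝ, c 0 = (2 * Real.pi) ^ ((k : ℝ) / 2) *
        ∫ z in M, a z * D z ^ (-(1 / 2) : ℝ) ∂μHE[m] ∧
      HasAsymptotics r c fun l => l ^ ((k : ℝ) / 2) *
        ∫ z in W, a z * Real.exp (-(l * Φ z)) := by
  have hloc := fun v (hv : v ∈ M) =>
    let ⟨_, h1, h2, h3, h4⟩ := hM v hv
    exists_local_laplace hL.isOpen hΦ ha hpos hL.subset hMc.measurableSet hM0 hD h2 h3 h4 hv h1
  choose! V hVo hvV hVW hVC hVθ using hloc
  obtain ⟨t, ht⟩ := hMc.elim_nhds_subcover' (fun v _ => V v)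
    (fun v hv => (hVo v hv).mem_nhds (hvV v hv))
  set U : t → Set (E d) := fun v => V v.1 with hU
  have hUo : ∀ i, IsOpen (U i) := fun i => hVo _ i.1.2
  have hMU : M ⊆ ⋃ i, U i := fun z hz => by
    obtain ⟨v, hv, hzv⟩ := Set.mem_iUnion₂.1 (ht hz)
    exact Set.mem_iUnion.2 ⟨⟨v, hv⟩, hzv⟩
  -- The partition of unity has to sum to one on a neighbourhood of `M`, not just on `M`; the error
  -- then lives away from `M`, where it is negligible.
  obtain ⟨K, hK, hMK, hKU⟩ := exists_compact_between hMc (isOpen_iUnion hUo) hMU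
  obtain ⟨f, hf⟩ := SmoothPartitionOfUnity.exists_isSubordinate 𝓘(ℝ, E d) hK.isClosed U hUo hKU
  have hfs : ∀ i, ContDiff ℝ (2 * r : ℕ) (f i) := fun i =>
    contDiff_infty.1 (f i).contMDiff.contDiff _
  have hfsum : ∀ z ∈ K, ∑ i, f i z = 1 := fun z hz => by
    rw [← finsum_eq_sum_of_fintype]
    exact f.sum_eq_one hz
  have hfle : ∀ z, ∑ i, f i z ≤ 1 := fun z => by
    rw [← finsum_eq_sum_of_fintype]
    exact f.sum_le_one z
  have hf0 : ∀ i z, 0 ≤ f i z := fun i z => f.nonneg i z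
  have hfz : ∀ i z, z ∉ W → f i z = 0 := fun i z hz => by
    by_contra h
    exact hz (hVW _ i.1.2 (hf i (subset_tsupport _ h)))
  have hkey := fun i : t => hVθ i.1 i.1.2 (f i) (hfs i) (hf i)
  have hMKs : M ⊆ K := hMK.trans interior_subset
  have hsplit : ∀ z ∈ M, ∑ i, f i z * a z * D z ^ (-(1 / 2) : ℝ) = a z * D z ^ (-(1 / 2) : ℝ) :=
    fun z hz => by
      rw [← Finset.sum_mul, ← Finset.sum_mul, hfsum z (hMKs hz), one_mul]
  choose hint c hc0 hc using hkey
  refine ⟨?_, ?_, ∑ i, c i, ?_, ?_⟩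
  · exact IntegrableOn.congr_fun (integrable_finsetSum Finset.univ fun i _ => hint i)
      (fun z hz => by simpa using hsplit z hz) hMc.measurableSet
  · choose! C hC using hVC
    refine ⟨⋃ i, U i, isOpen_iUnion hUo, hMU, ∑ i : t, |C i.1|, fun z hz => ?_⟩
    obtain ⟨i, hi⟩ := Set.mem_iUnion.1 hz
    refine (hC i.1 i.1.2 z hi).trans (mul_le_mul_of_nonneg_right ?_ (hpos z (hVW _ i.1.2 hi)))
    exact (le_abs_self _).trans (Finset.single_le_sum (f := fun i : t => |C i.1|)
      (fun j _ => abs_nonneg _) (Finset.mem_univ i))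
  · rw [Finset.sum_apply]
    simp_rw [hc0]
    rw [← Finset.mul_sum, ← integral_finsetSum _ fun i _ => hint i]
    congr 1
    exact setIntegral_congr_fun hMc.measurableSet fun z hz => hsplit z hz
  · refine (HasAsymptotics.sum Finset.univ fun i _ => hc i).of_isLittleO ?_
    refine IsBigO.trans_isLittleO ?_ (hL.isLittleO_away isOpen_interior hMK ((k : ℝ) / 2) r)
    refine IsBigO.of_bound 1 ?_
    filter_upwards [eventually_gt_atTop 0] with l hl
    have hWm := hL.isOpen.measurableSet
    have hil := hL.integrableOn l hl
    have hfil : ∀ i, IntegrableOn (fun z => f i z * (a z * Real.exp (-(l * Φ z)))) W := fun i => by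
      refine hil.bdd_mul (c := 1) (hfs i).continuous.aestronglyMeasurable
        (Eventually.of_forall fun z => ?_)
      rw [Real.norm_of_nonneg (hf0 i z)]
      exact f.le_one i z
    have e1 : ∀ i, ∫ z, f i z * a z * Real.exp (-(l * Φ z)) =
        ∫ z in W, f i z * (a z * Real.exp (-(l * Φ z))) := fun i => by
      rw [setIntegral_eq_integral_of_forall_compl_eq_zero fun z hz => by rw [hfz i z hz, zero_mul]]
      simp_rw [mul_assoc]
    simp_rw [e1]
    rw [← Finset.mul_sum, ← mul_sub, ← integral_finsetSum _ fun i _ => hfil i,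
      ← integral_sub hil (integrable_finsetSum _ fun i _ => hfil i), one_mul, norm_mul, norm_mul]
    refine mul_le_mul_of_nonneg_left ?_ (norm_nonneg _)
    have e2 : ∀ z, a z * Real.exp (-(l * Φ z)) - ∑ i, f i z * (a z * Real.exp (-(l * Φ z))) =
        (1 - ∑ i, f i z) * (a z * Real.exp (-(l * Φ z))) := fun z => by
      rw [← Finset.sum_mul]; ring
    simp_rw [e2]
    have e3 : ∫ z in W, (1 - ∑ i, f i z) * (a z * Real.exp (-(l * Φ z))) =
        ∫ z in W \ interior K, (1 - ∑ i, f i z) * (a z * Real.exp (-(l * Φ z))) := by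
      refine setIntegral_eq_of_subset_of_forall_sdiff_eq_zero hWm Set.sdiff_subset fun z hz => ?_
      have : z ∈ K := interior_subset (by
        by_contra h
        exact hz.2 ⟨hz.1, h⟩)
      rw [hfsum z this]
      ring
    have hDm : MeasurableSet (W \ interior K) := hWm.diff isOpen_interior.measurableSet
    rw [e3, Real.norm_eq_abs, Real.norm_eq_abs]
    refine (abs_integral_le_integral_abs).trans ((setIntegral_mono_on ?_
      (hil.mono_set Set.sdiff_subset) hDm fun z hz => ?_).trans (le_abs_self _))
    · have h1 : IntegrableOn (fun z => (1 - ∑ i, f i z) * (a z * Real.exp (-(l * Φ z)))) W := by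
        refine (hil.sub (integrable_finsetSum Finset.univ fun i _ => hfil i)).congr
          (Eventually.of_forall fun z => ?_)
        simpa using e2 z
      exact (h1.mono_set Set.sdiff_subset).abs
    · have h1 := mul_nonneg (hL.amplitude_nonneg z hz.1) (Real.exp_pos (-(l * Φ z))).le
      have h2 : 0 ≤ ∑ i, f i z := Finset.sum_nonneg fun i _ => hf0 i z
      rw [abs_mul, abs_of_nonneg h1, abs_of_nonneg (by linarith [hfle z])]
      exact mul_le_of_le_one_left h1 (by linarith)

end Global


/-! ### The second order expansion of the phase -/

section Hessian

theorem isBigO_dotProduct_mulVec {n : ℕ} (A : Matrix (Fin n) (Fin n) ℝ)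
    (l : Filter (Fin n → ℝ)) : (fun t => t ⬝ᵥ A.mulVec t) =O[l] fun t => ‖t‖ ^ 2 := by
  have h : ∀ i, (fun t : Fin n → ℝ => t i) =O[l] fun t => ‖t‖ := fun i =>
    IsBigO.of_bound 1 (Eventually.of_forall fun t => by
      rw [one_mul, norm_norm]; exact norm_le_pi_norm t i)
  simp only [dotProduct, Matrix.mulVec, sq]
  refine IsBigO.fun_sum fun i _ => (h i).mul (IsBigO.fun_sum fun j _ => ?_)
  exact (h j).const_mul_left _

theorem isBigO_sum_sq {n : ℕ} (l : Filter (Fin n → ℝ)) :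
    (fun t => ∑ i, t i ^ 2) =O[l] fun t => ‖t‖ ^ 2 := by
  simpa [dotProduct, sq] using isBigO_dotProduct_mulVec (1 : Matrix (Fin n) (Fin n) ℝ) l

theorem hessian_isSymm {n : ℕ} {f : (Fin n → ℝ) → ℝ} {t : Fin n → ℝ} (hf : ContDiffAt ℝ 2 f t) :
    (hessian f t).IsSymm := by
  have h1 : IsSymmSndFDerivAt ℝ f t := hf.isSymmSndFDerivAt (by simp)
  have hd : DifferentiableAt ℝ (fderiv ℝ f) t :=
    (hf.fderiv_right (m := 1) (by norm_num)).differentiableAt (by norm_num)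
  ext i j
  simp only [Matrix.transpose_apply, hessian, Matrix.of_apply]
  rw [fderiv_clm_apply hd (differentiableAt_const _), fderiv_clm_apply hd (differentiableAt_const _)]
  simpa using h1 (Pi.single j 1) (Pi.single i 1)

theorem isLittleO_sub_hessian {n : ℕ} {f : (Fin n → ℝ) → ℝ} (hf : ContDiffAt ℝ 2 f 0)
    (h1 : fderiv ℝ f 0 = 0) :
    (fun t => f t - f 0 - (t ⬝ᵥ (hessian f 0).mulVec t) / 2) =o[𝓝 0] fun t => ‖t‖ ^ 2 := by
  refine isLittleO_iff.2 fun ε hε => ?_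
  have hd : DifferentiableAt ℝ (fderiv ℝ f) 0 :=
    (hf.fderiv_right (m := 1) (by norm_num)).differentiableAt (by norm_num)
  have hcd : ∀ᶠ x in 𝓝 (0 : Fin n → ℝ), ContDiffAt ℝ (2 : ℕ) f x :=
    hf.eventually (by norm_num)
  have hcont : ContinuousAt (iteratedFDeriv ℝ 2 f) 0 :=
    hf.continuousAt_iteratedFDeriv le_rfl
  have hclose := hcont.eventually (Metric.ball_mem_nhds _ hε)
  obtain ⟨ρ, hρ, hball⟩ := Metric.eventually_nhds_iff_ball.1 (hcd.and hclose)
  filter_upwards [Metric.ball_mem_nhds 0 hρ] with t ht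
  have hseg : ∀ s ∈ Set.Icc (0 : ℝ) 1, (0 : Fin n → ℝ) + s • t ∈ Metric.ball 0 ρ := fun s hs => by
    rw [zero_add, mem_ball_zero_iff, norm_smul, Real.norm_of_nonneg hs.1]
    rw [mem_ball_zero_iff] at ht
    exact (mul_le_of_le_one_left (norm_nonneg _) hs.2).trans_lt ht
  have hT := abs_sub_taylor_le (f := f) (x := 0) (y := t) (N := 2) (ε := ε)
    (fun s hs => (hball _ (hseg s hs)).1) (fun s hs => by
      rw [← dist_eq_norm]; exact (hball _ (hseg s hs)).2.le)
  rw [Finset.sum_range_succ, Finset.sum_range_succ, Finset.sum_range_one,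
    iteratedFDeriv_zero_apply, iteratedFDeriv_one_apply, h1, iteratedFDeriv_two_apply] at hT
  have h2 : fderiv ℝ (fderiv ℝ f) 0 t t = t ⬝ᵥ (hessian f 0).mulVec t := by
    have e : t = ∑ i, t i • (Pi.single i 1 : Fin n → ℝ) := by
      ext j
      simp [Finset.sum_apply, Pi.single_apply]
    have e2 : ∀ i j, fderiv ℝ (fderiv ℝ f) 0 (Pi.single i 1) (Pi.single j 1) = hessian f 0 i j := by
      intro i j
      simp only [hessian, Matrix.of_apply]
      rw [fderiv_clm_apply hd (differentiableAt_const _)]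
      simp
    conv_lhs => rw [e]
    simp only [map_sum, map_smul, FunLike.coe_sum, Finset.sum_apply, FunLike.coe_smul,
      Pi.smul_apply, smul_eq_mul, e2, dotProduct, Matrix.mulVec, Finset.mul_sum]
    rw [Finset.sum_comm]
    refine Finset.sum_congr rfl fun i _ => Finset.sum_congr rfl fun j _ => ?_
    ring
  rw [h2] at hT
  rw [Real.norm_eq_abs, norm_pow, norm_norm]
  convert! hT using 2
  simp [Nat.factorial]
  ring

variable {d n : ℕ} {g : E d → ℝ} {α : ℝ} {v : E d} {u : Fin (d - 1) → E d}

theorem IsTangentFrame.norm_sq (hu : IsTangentFrame v u) (hv : ‖v‖ = 1) (t : Fin (d - 1) → ℝ) :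
    ‖v + ∑ i, t i • u i‖ ^ 2 = 1 + ∑ i, t i ^ 2 := by
  rw [norm_add_sq_real, hv, inner_sum]
  simp only [inner_smul_right, hu.2, mul_zero, Finset.sum_const_zero, add_zero, one_pow]
  rw [← real_inner_self_eq_norm_sq, hu.1.inner_sum]
  simp [sq]

theorem IsTangentFrame.exists_orthonormalBasis (hu : IsTangentFrame v u) (hv : ‖v‖ = 1)
    (hd : 0 < d) :
    ∃ b : OrthonormalBasis (Option (Fin (d - 1))) ℝ (E d), ∀ o, b o = Option.elim o v u := by
  have hbo : Orthonormal ℝ (Option.elim · v u : Option (Fin (d - 1)) → E d) := by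
    constructor
    · rintro (_ | i)
      · exact hv
      · exact hu.1.1 i
    · rintro (_ | i) (_ | j) hij
      · exact absurd rfl hij
      · exact hu.2 j
      · rw [real_inner_comm]; exact hu.2 i
      · exact hu.1.2 fun h => hij (by rw [h])
  have hcard : Fintype.card (Option (Fin (d - 1))) = Module.finrank ℝ (E d) := by
    rw [Fintype.card_option, Fintype.card_fin, finrank_euclideanSpace, Fintype.card_fin]
    omega
  refine ⟨(basisOfOrthonormalOfCardEqFinrank hbo hcard).toOrthonormalBasis (by
    rw [coe_basisOfOrthonormalOfCardEqFinrank]; exact hbo), fun o => ?_⟩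
  simp [coe_basisOfOrthonormalOfCardEqFinrank]

namespace IsRegularHomogeneous

variable (hg : IsRegularHomogeneous n g α)
include hg

theorem contDiffAt_tangent (hv : ‖v‖ = 1) (u : Fin (d - 1) → E d) :
    ContDiffAt ℝ n (fun t : Fin (d - 1) → ℝ => g (v + ∑ i, t i • u i)) 0 := by
  have hv0 : v ∈ ({0}ᶜ : Set (E d)) := by
    rw [Set.mem_compl_singleton_iff]; rintro rfl; simp at hv
  have h1 : ContDiffAt ℝ n g (v + ∑ i, (0 : Fin (d - 1) → ℝ) i • u i) := by
    simpa using hg.contDiffOn.contDiffAt (isOpen_compl_singleton.mem_nhds hv0)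
  refine h1.comp (0 : Fin (d - 1) → ℝ) (f := fun t : Fin (d - 1) → ℝ => v + ∑ i, t i • u i) ?_
  fun_prop

/-- Leaving the sphere along the tangent plane increases the norm, so `v` need not be a local
maximum of `g` there. But `g` is bounded by `ĝ ‖·‖^α`, with equality at `v`. The gap between the two
is minimal at `v`, and so is the bound, whence both gradients vanish. -/
theorem fderiv_tangent_eq_zero (hn : n ≠ 0) (hv : v ∈ maxSet g) (hu : IsTangentFrame v u) :
    fderiv ℝ (fun t : Fin (d - 1) → ℝ => g (v + ∑ i, t i • u i)) 0 = 0 := by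
  have hv1 : ‖v‖ = 1 := by simpa using hv.1
  have hG := hg.sphereMax_pos
  have hα := hg.order_pos
  set q : (Fin (d - 1) → ℝ) → ℝ := fun t => sphereMax g * (1 + ∑ i, t i ^ 2) ^ (α / 2) with hq
  have hle : ∀ t, g (v + ∑ i, t i • u i) ≤ q t := fun t => by
    have hns := hu.norm_sq hv1 t
    have hs : 0 ≤ ∑ i, t i ^ 2 := Finset.sum_nonneg fun i _ => sq_nonneg _
    have h0 : v + ∑ i, t i • u i ≠ 0 := by
      intro h
      rw [h] at hns
      simp at hns
      linarith
    rw [hg.eq_rpow_mul h0]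
    have e : ‖v + ∑ i, t i • u i‖ ^ α = (1 + ∑ i, t i ^ 2) ^ (α / 2) := by
      rw [← hns, ← Real.rpow_natCast, ← Real.rpow_mul (norm_nonneg _)]
      congr 1; push_cast; ring
    rw [e, mul_comm]
    exact mul_le_mul_of_nonneg_right (hg.angular_le h0) (by positivity)
  have hγd : DifferentiableAt ℝ (fun t : Fin (d - 1) → ℝ => g (v + ∑ i, t i • u i)) 0 :=
    (hg.contDiffAt_tangent hv1 u).differentiableAt (by exact_mod_cast hn)
  have hqd : DifferentiableAt ℝ q 0 := by
    refine DifferentiableAt.const_mul (DifferentiableAt.rpow_const (by fun_prop) (Or.inl ?_)) _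
    simp
  have hq0 : q 0 = sphereMax g := by simp [hq]
  have h1 : fderiv ℝ q 0 = 0 := IsLocalMin.fderiv_eq_zero (Eventually.of_forall fun t => by
    have hs : 0 ≤ ∑ i, t i ^ 2 := Finset.sum_nonneg fun i _ => sq_nonneg _
    rw [hq0]
    exact le_mul_of_one_le_right hG.le (Real.one_le_rpow (by linarith) (by positivity)))
  have h2 : fderiv ℝ (fun t : Fin (d - 1) → ℝ => q t - g (v + ∑ i, t i • u i)) 0 = 0 :=
    IsLocalMin.fderiv_eq_zero (Eventually.of_forall fun t => by
      have := hle t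
      simp only [hq0, Pi.zero_apply, zero_smul, Finset.sum_const_zero, add_zero, hv.2, sub_self]
      linarith)
  rw [fderiv_fun_sub hqd hγd, h1, zero_sub, neg_eq_zero] at h2
  exact h2

/-- With `x = g/ĝ` on the tangent plane, homogeneity gives `(ĝ / angular g)^(2/α) = (1 + |t|²)
x^(-2/α)`. The first factor contributes the identity matrix of `A`, and expanding the power of `x`
contributes the Hessian divided by `αĝ`. -/
theorem isLittleO_tangent (hn : 2 ≤ n) (hv : v ∈ maxSet g) (hu : IsTangentFrame v u) :
    (fun t : Fin (d - 1) → ℝ => (sphereMax g / angular g (v + ∑ i, t i • u i)) ^ (2 / α) - 1 +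
      t ⬝ᵥ (matA g α v u).mulVec t) =o[𝓝 0] fun t => ‖t‖ ^ 2 := by
  have hv1 : ‖v‖ = 1 := by simpa using hv.1
  have hG := hg.sphereMax_pos
  have hα := hg.order_pos
  set γ : (Fin (d - 1) → ℝ) → ℝ := fun t => g (v + ∑ i, t i • u i) with hγ
  have hγ0 : γ 0 = sphereMax g := by simp [hγ, hv.2]
  have hγc : ContDiffAt ℝ 2 γ 0 := (hg.contDiffAt_tangent hv1 u).of_le (by exact_mod_cast hn)
  set Q : (Fin (d - 1) → ℝ) → ℝ := fun t => t ⬝ᵥ (tangentHessian g v u).mulVec t with hQ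
  have hT : (fun t => γ t - sphereMax g - Q t / 2) =o[𝓝 0] fun t => ‖t‖ ^ 2 := by
    have := isLittleO_sub_hessian hγc (hg.fderiv_tangent_eq_zero (by omega) hv hu)
    rwa [hγ0] at this
  set x : (Fin (d - 1) → ℝ) → ℝ := fun t => γ t / sphereMax g with hx
  have hx1 : (fun t => x t - 1 - Q t / (2 * sphereMax g)) =o[𝓝 0] fun t => ‖t‖ ^ 2 := by
    refine (hT.const_mul_left (sphereMax g)⁻¹).congr_left fun t => ?_
    simp only [hx]
    field_simp
  have hQO : Q =O[𝓝 0] fun t => ‖t‖ ^ 2 := isBigO_dotProduct_mulVec _ _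
  have hxO : (fun t => x t - 1) =O[𝓝 0] fun t => ‖t‖ ^ 2 := by
    refine (hx1.isBigO.add (hQO.const_mul_left (2 * sphereMax g)⁻¹)).congr_left fun t => ?_
    ring
  have hx0 : x 0 = 1 := by simp only [hx, hγ0]; exact div_self hG.ne'
  have hxc : Tendsto x (𝓝 0) (𝓝 1) := by
    rw [← hx0]
    exact (hγc.continuousAt.div_const _)
  have hpow : (fun t => x t ^ (-(2 / α)) - 1 + Q t / (α * sphereMax g)) =o[𝓝 0]
      fun t => ‖t‖ ^ 2 := by
    have hd : HasDerivAt (fun y : ℝ => y ^ (-(2 / α))) (-(2 / α)) 1 := by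
      simpa using Real.hasDerivAt_rpow_const (x := 1) (p := -(2 / α)) (Or.inl one_ne_zero)
    have h1 : (fun t => x t ^ (-(2 / α)) - 1 - (x t - 1) * (-(2 / α))) =o[𝓝 0]
        fun t => x t - 1 := by
      simpa [Function.comp_def] using hd.isLittleO.comp_tendsto hxc
    have h2 := (h1.trans_isBigO hxO).add (hx1.const_mul_left (-(2 / α)))
    refine h2.congr_left fun t => ?_
    field_simp
    ring
  have hsq := isBigO_sum_sq (n := d - 1) (𝓝 0)
  have hzero : (fun t => x t ^ (-(2 / α)) - 1) =o[𝓝 0] fun _ => (1 : ℝ) := by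
    rw [isLittleO_one_iff]
    have h1 := (hxc.rpow_const (p := -(2 / α)) (Or.inl one_ne_zero)).sub_const 1
    simpa using h1
  have hprod : (fun t => (∑ i, t i ^ 2) * (x t ^ (-(2 / α)) - 1)) =o[𝓝 0] fun t => ‖t‖ ^ 2 := by
    simpa using hsq.mul_isLittleO hzero
  refine (hpow.add hprod).congr' ?_ (Eventually.of_forall fun _ => rfl)
  filter_upwards [hxc.eventually (lt_mem_nhds one_pos)] with t ht
  have hns := hu.norm_sq hv1 t
  have hs : 0 ≤ ∑ i, t i ^ 2 := Finset.sum_nonneg fun i _ => sq_nonneg _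
  have hnp : 0 < ‖v + ∑ i, t i • u i‖ := by
    refine lt_of_le_of_ne (norm_nonneg _) fun h => ?_
    rw [← h] at hns
    linarith
  have h0 : v + ∑ i, t i • u i ≠ 0 := norm_pos_iff.1 hnp
  have hang := hg.eq_rpow_mul h0
  have hxt : x t = ‖v + ∑ i, t i • u i‖ ^ α * (angular g (v + ∑ i, t i • u i) / sphereMax g) := by
    simp only [hx, hγ, hang]
    ring
  have hap : 0 < angular g (v + ∑ i, t i • u i) / sphereMax g := by
    rw [hxt] at ht
    exact (mul_pos_iff_of_pos_left (by positivity)).1 ht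
  have e1 : (sphereMax g / angular g (v + ∑ i, t i • u i)) ^ (2 / α) =
      (1 + ∑ i, t i ^ 2) * x t ^ (-(2 / α)) := by
    rw [hxt, Real.mul_rpow (by positivity) hap.le, ← Real.rpow_mul hnp.le, ← hns]
    have e2 : α * (-(2 / α)) = -2 := by field_simp
    rw [e2, Real.rpow_neg hnp.le, Real.rpow_neg hap.le, ← Real.inv_rpow hap.le, inv_div, ← mul_assoc,
      show ((2 : ℝ)) = ((2 : ℕ) : ℝ) by norm_num, Real.rpow_natCast, mul_inv_cancel₀ (by positivity),
      one_mul]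
  have e3 : t ⬝ᵥ (matA g α v u).mulVec t = Q t / (α * sphereMax g) - ∑ i, t i ^ 2 := by
    rw [matA, Matrix.sub_mulVec, Matrix.one_mulVec, dotProduct_sub, Matrix.smul_mulVec,
      dotProduct_smul, smul_eq_mul, mul_comm α, inv_mul_eq_div]
    congr 1
    simp [dotProduct, sq]
  rw [e1, e3]
  ring

/-- The angular function has degree zero, so `v + w` may be rescaled to the tangent plane at `v`, at
a second order cost of `o(‖w‖²)`. The logarithmic radius is `⟨v, w⟩ + o(‖w‖)`. Hence the quadratic
part is the identity along `v` and `-A` across it. -/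
theorem isLittleO_phase (hn : 2 ≤ n) (hv : v ∈ maxSet g) (hu : IsTangentFrame v u) :
    (fun w => phase g α (v + w) - (inner ℝ v w ^ 2 -
      (fun i => inner ℝ (u i) w) ⬝ᵥ (matA g α v u).mulVec fun i => inner ℝ (u i) w) / 2) =o[𝓝 0]
      fun w => ‖w‖ ^ 2 := by
  have hv1 : ‖v‖ = 1 := by simpa using hv.1
  have hd0 := hg.dim_pos
  set τ : E d → Fin (d - 1) → ℝ := fun w i => inner ℝ (u i) w with hτ
  set s : E d → ℝ := fun w => inner ℝ v w with hs
  set t : E d → Fin (d - 1) → ℝ := fun w => (1 + s w)⁻¹ • τ w with ht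
  have hsc : Tendsto s (𝓝 0) (𝓝 0) := by
    have : Continuous s := by fun_prop
    simpa [hs] using this.tendsto 0
  have hτO : τ =O[𝓝 0] fun w => ‖w‖ := by
    refine isBigO_pi.2 fun i => IsBigO.of_bound ‖u i‖ (Eventually.of_forall fun w => ?_)
    rw [norm_norm]
    exact norm_inner_le_norm _ _
  have hsO : s =O[𝓝 0] fun w => ‖w‖ :=
    IsBigO.of_bound ‖v‖ (Eventually.of_forall fun w => by
      rw [norm_norm]; exact norm_inner_le_norm _ _)
  have hinv : Tendsto (fun w => (1 + s w)⁻¹) (𝓝 0) (𝓝 1) := by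
    simpa using (hsc.const_add 1).inv₀ (by norm_num)
  have htO : t =O[𝓝 0] fun w => ‖w‖ := by
    have := (hinv.isBigO_one ℝ).smul hτO
    exact this.congr_right fun w => one_smul ℝ _
  have ht0 : Tendsto t (𝓝 0) (𝓝 0) := by
    refine htO.trans_tendsto ?_
    exact tendsto_norm_zero
  -- decomposition of the point
  have hdec : ∀ w, v + w = (1 + s w) • v + ∑ i, τ w i • u i := by
    intro w
    obtain ⟨b, hbc⟩ := hu.exists_orthonormalBasis hv1 hd0
    have h1 := b.sum_repr' w
    rw [Fintype.sum_option] at h1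
    simp only [hbc, Option.elim_none, Option.elim_some] at h1
    rw [add_smul, one_smul, add_assoc]
    congr 1
    exact h1.symm
  have hmain := ((hg.isLittleO_tangent hn hv hu).comp_tendsto ht0).trans_isBigO (htO.norm_left.pow 2)
  -- the quadratic form at the rescaled point
  have hquad : (fun w => t w ⬝ᵥ (matA g α v u).mulVec (t w) - τ w ⬝ᵥ (matA g α v u).mulVec (τ w))
      =o[𝓝 0] fun w => ‖w‖ ^ 2 := by
    have h1 : (fun w => τ w ⬝ᵥ (matA g α v u).mulVec (τ w)) =O[𝓝 0] fun w => ‖w‖ ^ 2 := by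
      have h2 : Tendsto τ (𝓝 0) (𝓝 0) := hτO.trans_tendsto tendsto_norm_zero
      exact ((isBigO_dotProduct_mulVec (matA g α v u) (𝓝 0)).comp_tendsto h2).trans
        (hτO.norm_left.pow 2)
    have h2 : (fun w => (1 + s w)⁻¹ ^ 2 - 1) =o[𝓝 0] fun _ => (1 : ℝ) := by
      rw [isLittleO_one_iff]
      simpa using (hinv.pow 2).sub_const 1
    have h3 := h2.mul_isBigO h1
    simp only [one_mul] at h3
    refine h3.congr_left fun w => ?_
    simp only [ht, Matrix.mulVec_smul, smul_dotProduct, dotProduct_smul, smul_eq_mul]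
    ring
  -- the logarithmic radius
  have hlog : (fun w => Real.log ‖v + w‖ ^ 2 - s w ^ 2) =o[𝓝 0] fun w => ‖w‖ ^ 2 := by
    have h1 : HasFDerivAt (fun z : E d => Real.log (‖z‖ ^ 2) / 2) (innerSL ℝ v) v := by
      have h2 := ((hasStrictFDerivAt_norm_sq v).hasFDerivAt.log (by rw [hv1]; norm_num)).const_mul
        (1 / 2 : ℝ)
      refine (h2.congr_fderiv ?_).congr_of_eventuallyEq (Eventually.of_forall fun z => ?_)
      · ext w
        simp [hv1]
      · simp only; ring
    have h3 : (fun w => Real.log ‖v + w‖ - s w) =o[𝓝 0] fun w => ‖w‖ := by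
      have h4 := (hasFDerivAt_iff_isLittleO_nhds_zero.1 h1).norm_right
      refine h4.congr_left fun w => ?_
      simp only [Real.log_pow, hv1, hs, innerSL_apply_apply]
      simp
    have h5 : (fun w => Real.log ‖v + w‖ + s w) =O[𝓝 0] fun w => ‖w‖ := by
      refine (h3.isBigO.add (hsO.const_mul_left 2)).congr_left fun w => ?_
      ring
    refine (h3.mul_isBigO h5).congr (fun w => ?_) fun w => ?_
    · ring
    · ring
  refine (((hmain.sub hquad).add hlog).const_mul_left (1 / 2)).congr' ?_
    (Eventually.of_forall fun _ => rfl)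
  filter_upwards [hsc.eventually (lt_mem_nhds (show (-1 : ℝ) < 0 by norm_num))] with w hw
  have hpos : 0 < 1 + s w := by linarith
  have e1 : v + w = (1 + s w) • (v + ∑ i, t w i • u i) := by
    rw [hdec w, smul_add, Finset.smul_sum]
    congr 1
    refine Finset.sum_congr rfl fun i _ => ?_
    rw [smul_smul]
    congr 1
    simp only [ht, Pi.smul_apply, smul_eq_mul]
    rw [mul_inv_cancel_left₀ hpos.ne']
  have e2 : angular g (v + w) = angular g (v + ∑ i, t w i • u i) := by
    rw [angular, angular, e1, norm_smul, Real.norm_of_nonneg hpos.le, smul_smul, mul_inv]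
    congr 2
    field_simp
  simp only [Function.comp_apply, phase, e2]
  ring

end IsRegularHomogeneous

end Hessian


/-! ### Eigenvalues of the Hessian of the phase -/

section Spectral

theorem dotProduct_mulVec_eq_sum_eigenvalues {n : ℕ} {A : Matrix (Fin n) (Fin n) ℝ}
    (hA : A.IsHermitian) (t : Fin n → ℝ) :
    t ⬝ᵥ A.mulVec t =
      ∑ i, hA.eigenvalues i * ((hA.eigenvectorBasis i).ofLp ⬝ᵥ t) ^ 2 := by
  have hAs : A.transpose = A := by
    rw [← Matrix.conjTranspose_eq_transpose_of_trivial]; exact hA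
  have h := hA.eigenvectorBasis.sum_inner_mul_inner (WithLp.toLp 2 t) (WithLp.toLp 2 (A.mulVec t))
  simp only [EuclideanSpace.inner_eq_star_dotProduct, star_trivial] at h
  rw [dotProduct_comm, ← h]
  refine Finset.sum_congr rfl fun i _ => ?_
  have h1 : A.mulVec t ⬝ᵥ (hA.eigenvectorBasis i).ofLp =
      hA.eigenvalues i * ((hA.eigenvectorBasis i).ofLp ⬝ᵥ t) := by
    rw [dotProduct_comm, Matrix.dotProduct_mulVec, ← Matrix.mulVec_transpose, hAs,
      hA.mulVec_eigenvectorBasis, smul_dotProduct, smul_eq_mul]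
  rw [h1]
  ring

theorem abs_nonzeroMinor_eq_prod {n : ℕ} {A : Matrix (Fin n) (Fin n) ℝ} (hA : A.IsHermitian) :
    |nonzeroMinor A| = ∏ i, if hA.eigenvalues i = 0 then 1 else |hA.eigenvalues i| := by
  classical
  have h : nonzeroMinor A = ∏ i with hA.eigenvalues i ≠ 0, hA.eigenvalues i := by
    rw [nonzeroMinor, hA.roots_charpoly_eq_eigenvalues, Multiset.filter_map]
    rfl
  rw [h, Finset.abs_prod, Finset.prod_filter]
  refine Finset.prod_congr rfl fun i _ => ?_
  by_cases hi : hA.eigenvalues i = 0 <;> simp [hi]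

variable {d n m : ℕ} {g : E d → ℝ} {α : ℝ} {v : E d} {u : Fin (d - 1) → E d}

/-- The eigenvectors of `A`, carried over by the frame `u`, together with `v` diagonalize the
Hessian. The direction `v` adds the eigenvalue `1`, which does not change the product but raises the
number of nonzero eigenvalues from `d - 1 - m` to `d - m`. -/
theorem IsRegularHomogeneous.hasNormalHessian_phase (hg : IsRegularHomogeneous n g α) (hn : 2 ≤ n)
    (hv : v ∈ maxSet g) (hu : IsTangentFrame v u) (hmd : m < d)
    (hrank : (matA g α v u).rank = d - 1 - m) :
    HasNormalHessian m (d - m) (phase g α) v |nonzeroMinor (matA g α v u)| := by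
  classical
  have hv1 : ‖v‖ = 1 := by simpa using hv.1
  have hA : (matA g α v u).IsHermitian := by
    have h1 : (tangentHessian g v u).IsSymm :=
      hessian_isSymm ((hg.contDiffAt_tangent hv1 u).of_le (by exact_mod_cast hn))
    rw [Matrix.IsHermitian, Matrix.conjTranspose_eq_transpose_of_trivial, matA,
      Matrix.transpose_sub, Matrix.transpose_smul, h1.eq, Matrix.transpose_one]
  set a := hA.eigenvalues with ha
  set ε := hA.eigenvectorBasis with hε
  set w : Fin (d - 1) → E d := fun i => ∑ j, (ε i).ofLp j • u j with hw
  have hwi : ∀ i j, inner ℝ (w i) (w j) = inner ℝ (ε i) (ε j) := fun i j => by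
    simp only [hw]
    rw [hu.1.inner_sum, EuclideanSpace.inner_eq_star_dotProduct, dotProduct]
    simp [mul_comm]
  have hwf : IsTangentFrame v w := by
    refine ⟨?_, fun i => ?_⟩
    · rw [orthonormal_iff_ite]
      intro i j
      rw [hwi]
      exact orthonormal_iff_ite.1 ε.orthonormal i j
    · simp only [hw, inner_sum, inner_smul_right, hu.2, mul_zero, Finset.sum_const_zero]
  obtain ⟨b, hb⟩ := hwf.exists_orthonormalBasis hv1 (by omega)
  have hinner : ∀ i x, inner ℝ (w i) x = (ε i).ofLp ⬝ᵥ fun j => inner ℝ (u j) x := fun i x => by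
    simp only [hw, sum_inner, real_inner_smul_left, dotProduct]
  have hform : ∀ x, inner ℝ v x ^ 2 - (fun i => inner ℝ (u i) x) ⬝ᵥ (matA g α v u).mulVec
      (fun i => inner ℝ (u i) x) = inner ℝ v x ^ 2 - ∑ i, a i * inner ℝ (w i) x ^ 2 := fun x => by
    rw [dotProduct_mulVec_eq_sum_eigenvalues hA]
    simp only [hinner]
    rfl
  have hphase := hg.isLittleO_phase hn hv hu
  simp_rw [hform] at hphase
  -- Along an eigenvector with `a i > 0` the phase would be at most `-a i s²/2 + a i s²/4`, which is
  -- negative.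
  have hnonpos : ∀ i, a i ≤ 0 := by
    intro i
    by_contra! hi
    have h1 : Tendsto (fun s : ℝ => s • w i) (𝓝[≠] 0) (𝓝 0) := by
      have : Continuous fun s : ℝ => s • w i := by fun_prop
      have h2 := this.tendsto 0
      rw [zero_smul] at h2
      exact h2.mono_left nhdsWithin_le_nhds
    have h2 := (h1.eventually (hphase.def (c := a i / 4) (by positivity)))
    have h3 : ∀ᶠ x in 𝓝 (0 : E d), v + x ∈ positiveCone g := by
      have h4 : Tendsto (fun x : E d => v + x) (𝓝 0) (𝓝 v) := by
        have : Continuous fun x : E d => v + x := by fun_prop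
        simpa using this.tendsto 0
      exact h4.eventually (hg.isOpen_positiveCone.mem_nhds (hg.maxSet_subset hv))
    obtain ⟨s, ⟨hs1, hs2⟩, hs0⟩ := ((h2.and (h1.eventually h3)).and self_mem_nhdsWithin).exists
    have hs0' : s ≠ 0 := hs0
    have h5 := hg.phase_nonneg hs2
    have h6 : ∑ j, a j * inner ℝ (w j) (s • w i) ^ 2 = a i * s ^ 2 := by
      rw [Finset.sum_eq_single i]
      · rw [inner_smul_right, real_inner_self_eq_norm_sq, hwf.1.1 i]; ring
      · intro j _ hj
        rw [inner_smul_right, hwf.1.2 hj]; ring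
      · simp
    have h7 : ‖s • w i‖ ^ 2 = s ^ 2 := by
      rw [norm_smul, hwf.1.1 i, mul_one, Real.norm_eq_abs, sq_abs]
    rw [h6, inner_smul_right, hwf.2, Real.norm_eq_abs, norm_pow, norm_norm, h7] at hs1
    have h8 := (abs_le.1 hs1).2
    have h9 : 0 < a i * s ^ 2 := by positivity
    nlinarith
  -- eigenvalues of the full Hessian
  set ev : Option (Fin (d - 1)) → ℝ := fun o => o.elim (-1) a with hev
  have hcard : Fintype.card {i // a i ≠ 0} = d - 1 - m := by
    rw [← hrank, hA.rank_eq_card_non_zero_eigs]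
  have hc2 : Fintype.card {o // ¬ ev o = 0} = d - m := by
    rw [Fintype.card_subtype, Finset.card_filter, Fintype.sum_option]
    rw [Fintype.card_subtype, Finset.card_filter] at hcard
    simp only [hev, Option.elim_none, Option.elim_some]
    rw [if_pos (by norm_num)]
    simp only [ne_eq] at hcard
    rw [hcard]
    omega
  have hc1 : Fintype.card {o // ev o = 0} = m := by
    have h1 := Fintype.card_subtype_compl fun o => ev o = 0
    rw [hc2, Fintype.card_option, Fintype.card_fin] at h1
    have h2 := Fintype.card_subtype_le fun o => ev o = 0
    rw [Fintype.card_option, Fintype.card_fin] at h2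
    omega
  set σ₁ : Fin m ≃ {o // ev o = 0} := (Fintype.equivFinOfCardEq hc1).symm
  set σ₂ : Fin (d - m) ≃ {o // ¬ ev o = 0} := (Fintype.equivFinOfCardEq hc2).symm
  set σ : Fin m ⊕ Fin (d - m) ≃ Option (Fin (d - 1)) :=
    (Equiv.sumCongr σ₁ σ₂).trans (Equiv.sumCompl fun o => ev o = 0) with hσ
  have hσr : ∀ i, σ (Sum.inr i) = (σ₂ i).1 := fun i => by simp [hσ]
  refine ⟨b.reindex σ.symm, fun i => -ev (σ₂ i).1, fun i => ?_, ?_, ?_⟩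
  · have h1 : ev (σ₂ i).1 ≠ 0 := (σ₂ i).2
    have h2 : ∀ o, ev o ≤ 0 := by
      rintro (_ | i)
      · simp [hev]
      · exact hnonpos i
    have := lt_of_le_of_ne (h2 _) h1
    linarith
  · rw [Equiv.prod_comp σ₂ fun o => -ev o.1, abs_nonzeroMinor_eq_prod hA,
      ← Finset.prod_subtype (Finset.univ.filter fun o => ¬ ev o = 0) (by simp) (fun o => -ev o),
      Finset.prod_filter, Fintype.prod_option]
    simp only [hev, Option.elim_none, Option.elim_some]
    rw [if_pos (by norm_num), neg_neg, one_mul]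
    refine Finset.prod_congr rfl fun i _ => ?_
    by_cases hi : a i = 0
    · rw [if_neg (not_not.2 hi), if_pos hi]
    · rw [if_pos hi, if_neg hi, abs_of_nonpos (hnonpos i)]
  · refine hphase.congr_left fun x => ?_
    congr 2
    simp only [OrthonormalBasis.reindex_apply, Equiv.symm_symm, hσr]
    rw [Equiv.sum_comp σ₂ fun o => -ev o.1 * inner ℝ (b o.1) x ^ 2]
    have h1 : ∑ o : {o // ¬ ev o = 0}, -ev o.1 * inner ℝ (b o.1) x ^ 2 =
        ∑ o, -ev o * inner ℝ (b o) x ^ 2 := by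
      rw [← Finset.sum_subtype (Finset.univ.filter fun o => ¬ ev o = 0) (by simp)
        (fun o => -ev o * inner ℝ (b o) x ^ 2)]
      refine Finset.sum_filter_of_ne fun o _ ho h0 => ho ?_
      rw [h0]
      ring
    rw [h1, Fintype.sum_option]
    simp only [hb, hev, Option.elim_none, Option.elim_some, neg_neg, one_mul, neg_mul,
      Finset.sum_neg_distrib]
    ring

end Spectral


/-! ### Dependence of the Laplace integral on the jets -/

section Comparison

variable {d n : ℕ} {g : E d → ℝ} {α : ℝ}

/-- The phase is at least one outside the compact set where the radius lies in `[e⁻², e²]` and the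
angular function is at least `δ`. On the part of that set outside `N` it is continuous and positive,
hence bounded below. -/
theorem IsRegularHomogeneous.exists_le_phase (hg : IsRegularHomogeneous n g α) {N : Set (E d)}
    (hN : IsOpen N) (hMN : maxSet g ⊆ N) :
    ∃ ε, 0 < ε ∧ ∀ z ∈ positiveCone g, z ∉ N → ε ≤ phase g α z := by
  have hα := hg.order_pos
  have hG := hg.sphereMax_pos
  -- Below this level `(ĝ / angular g)^(2/α) ≥ 3`, so the phase is at least one.
  set δ := sphereMax g * 3 ^ (-(α / 2)) with hδ
  have hδ0 : 0 < δ := by positivity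
  set R : Set (E d) := {z | ‖z‖ ∈ Set.Icc (Real.exp (-2)) (Real.exp 2)} with hR
  have hR0 : ∀ z ∈ R, z ≠ 0 := by
    rintro z hz rfl
    have := hz.1
    rw [norm_zero] at this
    exact absurd this (not_le.2 (Real.exp_pos _))
  have hRc : IsCompact R := by
    refine (isCompact_closedBall (0 : E d) (Real.exp 2)).of_isClosed_subset
      (isClosed_Icc.preimage continuous_norm) fun z hz => ?_
    simpa using hz.2
  set K := (R ∩ angular g ⁻¹' Set.Ici δ) ∩ Nᶜ with hK
  have hKc : IsCompact K := by
    refine (hRc.of_isClosed_subset ?_ Set.inter_subset_left).inter_right hN.isClosed_compl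
    refine ContinuousOn.preimage_isClosed_of_isClosed (fun z hz => ?_) hRc.isClosed isClosed_Ici
    exact (hg.contDiffAt_angular (hR0 z hz)).continuousAt.continuousWithinAt
  have hKW : K ⊆ positiveCone g := fun z hz => hδ0.trans_le hz.1.2
  obtain ⟨ε, hε, hle⟩ := hKc.exists_forall_le' (f := phase g α) (a := 0)
    (hg.contDiffOn_phase.continuousOn.mono hKW) fun z hz =>
      lt_of_le_of_ne (hg.phase_nonneg (hKW hz)) fun h =>
        hz.2 (hMN ((hg.phase_eq_zero_iff (hKW hz)).1 h.symm))
  refine ⟨min ε 1, lt_min hε one_pos, fun z hz hzN => ?_⟩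
  by_cases hzK : z ∈ K
  · exact (min_le_left _ _).trans (hle z hzK)
  refine (min_le_right _ _).trans ?_
  have h1 := Real.one_le_rpow (hg.one_le_div hz) (z := 2 / α) (by positivity)
  have h2 := sq_nonneg (Real.log ‖z‖)
  have hz0 : 0 < ‖z‖ := norm_pos_iff.2 (hg.ne_zero hz)
  rw [phase]
  by_cases hzR : z ∈ R
  · have hzδ : angular g z < δ := by
      by_contra! h
      exact hzK ⟨⟨hzR, h⟩, hzN⟩
    have hz' : 0 < angular g z := hz
    have h3 : (3 : ℝ) ≤ (sphereMax g / angular g z) ^ (2 / α) := by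
      have h4 : (3 : ℝ) ^ (α / 2) ≤ sphereMax g / angular g z := by
        rw [le_div_iff₀ hz']
        calc (3 : ℝ) ^ (α / 2) * angular g z ≤ 3 ^ (α / 2) * δ := by gcongr
          _ = sphereMax g := by
            rw [hδ, mul_left_comm, ← Real.rpow_add (by norm_num), add_neg_cancel, Real.rpow_zero,
              mul_one]
      calc (3 : ℝ) = (3 ^ (α / 2)) ^ (2 / α) := by
            rw [← Real.rpow_mul (by norm_num)]
            field_simp
            simp
        _ ≤ _ := by gcongr
    linarith
  · have h3 : 4 ≤ Real.log ‖z‖ ^ 2 := by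
      by_cases h4 : ‖z‖ < Real.exp (-2)
      · have := (Real.log_lt_iff_lt_exp hz0).2 h4
        nlinarith
      · have h5 : Real.exp 2 < ‖z‖ := by
          by_contra! h6
          exact hzR ⟨not_lt.1 h4, h6⟩
        have := (Real.lt_log_iff_exp_lt hz0).2 h5
        nlinarith
    linarith

theorem IsRegularHomogeneous.isLaplaceData (hg : IsRegularHomogeneous n g α) :
    IsLaplaceData (phase g α) (amplitude g α) (positiveCone g) (maxSet g) where
  isOpen := hg.isOpen_positiveCone
  subset := hg.maxSet_subset
  amplitude_nonneg _ hz := hg.amplitude_nonneg hz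
  integrableOn _ hl := hg.integrableOn_amplitude_mul_exp hl
  separation _ hN hMN := hg.exists_le_phase hN hMN

theorem abs_exp_neg_sub_exp_neg_le {c x y : ℝ} (hx : c ≤ x) (hy : c ≤ y) :
    |Real.exp (-x) - Real.exp (-y)| ≤ |x - y| * Real.exp (-c) := by
  wlog h : x ≤ y generalizing x y
  · rw [abs_sub_comm, abs_sub_comm x]
    exact this hy hx (le_of_not_ge h)
  have h1 : Real.exp (-y) ≤ Real.exp (-x) := Real.exp_le_exp.2 (by linarith)
  rw [abs_of_nonneg (by linarith), abs_of_nonpos (by linarith)]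
  have h2 : Real.exp (-y) = Real.exp (-x) * Real.exp (-(y - x)) := by
    rw [← Real.exp_add]; congr 1; ring
  have h3 := Real.add_one_le_exp (-(y - x))
  have h4 : Real.exp (-x) ≤ Real.exp (-c) := Real.exp_le_exp.2 (by linarith)
  calc Real.exp (-x) - Real.exp (-y) = Real.exp (-x) * (1 - Real.exp (-(y - x))) := by rw [h2]; ring
    _ ≤ Real.exp (-x) * (y - x) := by
        refine mul_le_mul_of_nonneg_left ?_ (Real.exp_pos _).le
        linarith
    _ ≤ Real.exp (-c) * (y - x) := mul_le_mul_of_nonneg_right h4 (by linarith)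
    _ = _ := by ring

theorem exists_pow_mul_exp_neg_le (j : ℕ) :
    ∃ C : ℝ, 0 < C ∧ ∀ x : ℝ, 0 ≤ x → x ^ j * Real.exp (-(x / 4)) ≤ C := by
  refine ⟨4 ^ j * j.factorial, by positivity, fun x hx => ?_⟩
  have h := Real.pow_div_factorial_le_exp (x / 4) (by positivity) j
  rw [div_le_iff₀ (by positivity), div_pow, div_le_iff₀ (by positivity)] at h
  calc x ^ j * Real.exp (-(x / 4)) ≤ (Real.exp (x / 4) * j.factorial * 4 ^ j) *
        Real.exp (-(x / 4)) := by gcongr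
    _ = 4 ^ j * j.factorial * (Real.exp (x / 4) * Real.exp (-(x / 4))) := by ring
    _ = _ := by rw [← Real.exp_add, add_neg_cancel, Real.exp_zero, mul_one]

/-- The difference of the integrands of two Laplace integrals whose phases and amplitudes are close
to a high order. -/
theorem abs_sub_laplace_integrand_le {r : ℕ} {C ε l φ₁ φ₂ b₁ b₂ : ℝ}
    (hC : ∀ x : ℝ, 0 ≤ x → x ^ (r + 1) * Real.exp (-(x / 4)) ≤ C) (hε0 : 0 ≤ ε) (hε : ε ≤ 1 / 2)
    (hl : 1 ≤ l) (hb : 0 ≤ b₁) (h0 : 0 ≤ φ₁) (h1 : φ₁ ≤ 1) (hφ : |φ₂ - φ₁| ≤ ε * φ₁ ^ (r + 1))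
    (hb' : |b₂ - b₁| ≤ ε * φ₁ ^ (r + 1) * b₁) :
    |b₁ * Real.exp (-(l * φ₁)) - b₂ * Real.exp (-(l * φ₂))| ≤
      3 * ε * C * (l⁻¹) ^ r * (b₁ * Real.exp (-(l / 4 * φ₁))) := by
  have hp1 : φ₁ ^ (r + 1) ≤ φ₁ := by
    rw [pow_succ]; exact mul_le_of_le_one_left h0 (pow_le_one₀ h0 h1)
  have hp0 : 0 ≤ φ₁ ^ (r + 1) := by positivity
  have hl0 : 0 < l := by linarith
  have hφ2 : φ₁ / 2 ≤ φ₂ := by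
    have := (abs_le.1 hφ).1
    nlinarith
  have hb2 : |b₂| ≤ 2 * b₁ := by
    have h2 : ε * φ₁ ^ (r + 1) * b₁ ≤ 1 * b₁ := by
      refine mul_le_mul_of_nonneg_right ?_ hb
      nlinarith
    have h3 := abs_sub_abs_le_abs_sub b₂ b₁
    rw [abs_of_nonneg hb] at h3
    linarith
  have he := abs_exp_neg_sub_exp_neg_le (c := l * (φ₁ / 2)) (x := l * φ₁) (y := l * φ₂)
    (by nlinarith) (by nlinarith)
  have he1 : Real.exp (-(l * φ₁)) ≤ Real.exp (-(l * (φ₁ / 2))) := Real.exp_le_exp.2 (by nlinarith)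
  have hd : |l * φ₁ - l * φ₂| ≤ l * (ε * φ₁ ^ (r + 1)) := by
    rw [← mul_sub, abs_mul, abs_of_pos hl0, abs_sub_comm]
    gcongr
  set e := Real.exp (-(l * (φ₁ / 2))) with hedef
  have he0 : 0 ≤ e := (Real.exp_pos _).le
  have hmain : |b₁ * Real.exp (-(l * φ₁)) - b₂ * Real.exp (-(l * φ₂))| ≤
      3 * ε * b₁ * (l * φ₁ ^ (r + 1) * e) := by
    calc |b₁ * Real.exp (-(l * φ₁)) - b₂ * Real.exp (-(l * φ₂))|
        = |-(b₂ - b₁) * Real.exp (-(l * φ₁)) +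
            b₂ * (Real.exp (-(l * φ₁)) - Real.exp (-(l * φ₂)))| := by congr 1; ring
      _ ≤ |b₂ - b₁| * Real.exp (-(l * φ₁)) +
            |b₂| * |Real.exp (-(l * φ₁)) - Real.exp (-(l * φ₂))| := by
          refine (abs_add_le _ _).trans_eq ?_
          rw [abs_mul, abs_mul, abs_neg, abs_of_pos (Real.exp_pos (-(l * φ₁)))]
      _ ≤ ε * φ₁ ^ (r + 1) * b₁ * e + 2 * b₁ * (l * (ε * φ₁ ^ (r + 1)) * e) := by
          have := he.trans (mul_le_mul_of_nonneg_right hd he0)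
          gcongr
      _ = ε * φ₁ ^ (r + 1) * b₁ * e * 1 + 2 * b₁ * (l * (ε * φ₁ ^ (r + 1)) * e) := by ring
      _ ≤ ε * φ₁ ^ (r + 1) * b₁ * e * l + 2 * b₁ * (l * (ε * φ₁ ^ (r + 1)) * e) := by gcongr
      _ = _ := by ring
  refine hmain.trans ?_
  have hx := hC (l * φ₁) (by positivity)
  -- `l φ^(r+1) = l^(-r) (l φ)^(r+1)`. One half of the exponential absorbs the power of `l φ`; the
  -- other half remains as the weight of a Laplace integral at `l/4`.
  have hsplit : l * φ₁ ^ (r + 1) * e =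
      (l⁻¹) ^ r * ((l * φ₁) ^ (r + 1) * Real.exp (-(l * φ₁ / 4))) * Real.exp (-(l / 4 * φ₁)) := by
    have e1 : e = Real.exp (-(l * φ₁ / 4)) * Real.exp (-(l / 4 * φ₁)) := by
      rw [hedef, ← Real.exp_add]; congr 1; ring
    rw [e1, mul_pow, pow_succ l, inv_pow]
    field_simp
  rw [hsplit]
  calc _ ≤ 3 * ε * b₁ * ((l⁻¹) ^ r * C * Real.exp (-(l / 4 * φ₁))) := by gcongr
    _ = _ := by ring

/-- Away from `M` both integrals are negligible. Near `M` the difference of the integrands is at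
most a multiple of `ε l^(-r)` times the first integrand at `l/4`, and the integral of the latter is
`O(l^(-s))` by hypothesis. -/
theorem IsLaplaceData.isLittleO_sub {s : ℝ} {r : ℕ} {Φ₁ Φ₂ a₁ a₂ : E d → ℝ} {W₁ W₂ M : Set (E d)}
    (h₁ : IsLaplaceData Φ₁ a₁ W₁ M) (h₂ : IsLaplaceData Φ₂ a₂ W₂ M) (hpos : ∀ z ∈ W₁, 0 ≤ Φ₁ z)
    (hbdd : (fun l : ℝ => l ^ s * ∫ z in W₁, a₁ z * Real.exp (-(l * Φ₁ z))) =O[atTop]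
      fun _ => (1 : ℝ))
    (hclose : ∀ ε, 0 < ε → ∃ N, IsOpen N ∧ M ⊆ N ∧ N ⊆ W₁ ∩ W₂ ∧ ∀ z ∈ N, Φ₁ z ≤ 1 ∧
      |Φ₂ z - Φ₁ z| ≤ ε * Φ₁ z ^ (r + 1) ∧ |a₂ z - a₁ z| ≤ ε * Φ₁ z ^ (r + 1) * a₁ z) :
    (fun l : ℝ => l ^ s * (∫ z in W₂, a₂ z * Real.exp (-(l * Φ₂ z))) -
      l ^ s * ∫ z in W₁, a₁ z * Real.exp (-(l * Φ₁ z))) =o[atTop] fun l : ℝ => (l⁻¹) ^ r := by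
  refine isLittleO_iff.2 fun δ hδ => ?_
  obtain ⟨C, hC0, hC⟩ := exists_pow_mul_exp_neg_le (r + 1)
  obtain ⟨B, hB0, hB⟩ := hbdd.exists_pos
  have hquarter : Tendsto (fun l : ℝ => l / 4) atTop atTop :=
    tendsto_id.atTop_div_const (by norm_num)
  have hB' := hquarter.eventually hB.bound
  -- `1/2` is what the pointwise estimate requires; the other term lets the part near `M` take a
  -- third of `δ`. The factor `4^s` comes from passing from `l/4` to `l`.
  set ε := min (1 / 2) (δ / 3 / (3 * C * (4 ^ s * B))) with hε
  have h4s : (0 : ℝ) < 4 ^ s := by positivity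
  have hε0 : 0 < ε := lt_min (by norm_num) (by positivity)
  have hεle : 3 * ε * C * (4 ^ s * B) ≤ δ / 3 := by
    have := min_le_right (1 / 2) (δ / 3 / (3 * C * (4 ^ s * B)))
    rw [← hε, le_div_iff₀ (by positivity)] at this
    linarith
  obtain ⟨N, hNo, hMN, hNW, hN⟩ := hclose ε hε0
  have ho1 := isLittleO_iff.1 (h₁.isLittleO_away hNo hMN s r) (show 0 < δ / 3 by positivity)
  have ho2 := isLittleO_iff.1 (h₂.isLittleO_away hNo hMN s r) (show 0 < δ / 3 by positivity)
  filter_upwards [hB', ho1, ho2, eventually_ge_atTop 1] with l hl hl1 hl2 hl0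
  have hl0' : 0 < l := by linarith
  have hN1 : N ⊆ W₁ := fun z hz => (hNW hz).1
  have hN2 : N ⊆ W₂ := fun z hz => (hNW hz).2
  have hi1 := h₁.integrableOn l hl0'
  have hi2 := h₂.integrableOn l hl0'
  have hi4 := h₁.integrableOn (l / 4) (by positivity)
  have hsp1 := integral_inter_add_sdiff (s := W₁) hNo.measurableSet hi1
  have hsp2 := integral_inter_add_sdiff (s := W₂) hNo.measurableSet hi2
  rw [Set.inter_eq_self_of_subset_right hN1] at hsp1
  rw [Set.inter_eq_self_of_subset_right hN2] at hsp2
  have hmid : |(∫ z in N, a₂ z * Real.exp (-(l * Φ₂ z))) - ∫ z in N, a₁ z * Real.exp (-(l * Φ₁ z))| ≤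
      3 * ε * C * (l⁻¹) ^ r * ∫ z in W₁, a₁ z * Real.exp (-(l / 4 * Φ₁ z)) := by
    rw [abs_sub_comm, ← integral_sub (hi1.mono_set hN1) (hi2.mono_set hN2)]
    refine (abs_integral_le_integral_abs).trans ?_
    calc ∫ z in N, |a₁ z * Real.exp (-(l * Φ₁ z)) - a₂ z * Real.exp (-(l * Φ₂ z))|
        ≤ ∫ z in N, 3 * ε * C * (l⁻¹) ^ r * (a₁ z * Real.exp (-(l / 4 * Φ₁ z))) := by
          refine setIntegral_mono_on
            (((hi1.mono_set hN1).sub (hi2.mono_set hN2)).abs)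
            ((hi4.mono_set hN1).const_mul _) hNo.measurableSet fun z hz => ?_
          obtain ⟨hz1, hz2, hz3⟩ := hN z hz
          exact abs_sub_laplace_integrand_le hC hε0.le (min_le_left _ _) hl0
            (h₁.amplitude_nonneg z (hN1 hz)) (hpos z (hN1 hz)) hz1 hz2 hz3
      _ = 3 * ε * C * (l⁻¹) ^ r * ∫ z in N, a₁ z * Real.exp (-(l / 4 * Φ₁ z)) :=
          integral_const_mul _ _
      _ ≤ _ := by
          refine mul_le_mul_of_nonneg_left ?_ (by positivity)
          refine setIntegral_mono_set hi4 ?_ (Eventually.of_forall hN1)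
          exact (ae_restrict_mem h₁.isOpen.measurableSet).mono fun z hz =>
            mul_nonneg (h₁.amplitude_nonneg z hz) (Real.exp_pos _).le
  have hls : 0 < l ^ s := by positivity
  have hli : 0 < (l⁻¹) ^ r := by positivity
  have hmid' : |l ^ s * ((∫ z in N, a₂ z * Real.exp (-(l * Φ₂ z))) -
      ∫ z in N, a₁ z * Real.exp (-(l * Φ₁ z)))| ≤ δ / 3 * (l⁻¹) ^ r := by
    rw [abs_mul, abs_of_pos hls]
    have h5 : (l / 4) ^ s * ∫ z in W₁, a₁ z * Real.exp (-(l / 4 * Φ₁ z)) ≤ B := by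
      have := (le_abs_self _).trans hl
      simpa using this
    have h6 : l ^ s = 4 ^ s * (l / 4) ^ s := by
      rw [← Real.mul_rpow (by norm_num) (by positivity)]; congr 1; ring
    calc _ ≤ l ^ s * (3 * ε * C * (l⁻¹) ^ r *
          ∫ z in W₁, a₁ z * Real.exp (-(l / 4 * Φ₁ z))) := by gcongr
      _ = 3 * ε * C * (l⁻¹) ^ r * (4 ^ s *
          ((l / 4) ^ s * ∫ z in W₁, a₁ z * Real.exp (-(l / 4 * Φ₁ z)))) := by rw [h6]; ring
      _ ≤ 3 * ε * C * (l⁻¹) ^ r * (4 ^ s * B) := by gcongr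
      _ = 3 * ε * C * (4 ^ s * B) * (l⁻¹) ^ r := by ring
      _ ≤ _ := by gcongr
  rw [← hsp1, ← hsp2, Real.norm_eq_abs, Real.norm_of_nonneg hli.le]
  rw [Real.norm_eq_abs, Real.norm_of_nonneg hli.le] at hl1 hl2
  rw [abs_le] at hl1 hl2 hmid' ⊢
  constructor <;> nlinarith [hl1.1, hl1.2, hl2.1, hl2.2, hmid'.1, hmid'.2]

theorem eq_of_angularJets_eq {N : ℕ} {g₁ g₂ : E d → ℝ} (h : angularJets N g₁ = angularJets N g₂) :
    maxSet g₁ = maxSet g₂ ∧ ∀ v ∈ maxSet g₁, ∀ k ≤ N,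
      iteratedFDeriv ℝ k (angular g₁) v = iteratedFDeriv ℝ k (angular g₂) v := by
  have key : ∀ {f₁ f₂ : E d → ℝ}, angularJets N f₁ = angularJets N f₂ → ∀ v ∈ maxSet f₁,
      v ∈ maxSet f₂ ∧ ∀ k ≤ N,
      iteratedFDeriv ℝ k (angular f₁) v = iteratedFDeriv ℝ k (angular f₂) v := by
    intro f₁ f₂ h v hv
    have h1 : ((v, fun k => iteratedFDeriv ℝ k (angular f₁) v) : Jet d N) ∈ angularJets N f₂ :=
      h ▸ ⟨v, hv, rfl⟩
    obtain ⟨v', hv', he⟩ := h1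
    obtain ⟨rfl, h3⟩ := Prod.mk.inj he
    exact ⟨hv', fun k hk => (congrFun h3 ⟨k, Nat.lt_succ_of_le hk⟩).symm⟩
  exact ⟨Set.Subset.antisymm (fun v hv => (key h v hv).1) fun v hv => (key h.symm v hv).1,
    fun v hv => (key h v hv).2⟩

/-- All derivatives of the difference up to order `n` vanish on `M`. Taylor's formula from a nearest
point of `M` leaves only the oscillation of the top derivative, which is below `ε` on a thickening
of `M` by compactness. -/
theorem exists_abs_angular_sub_le {g₁ g₂ : E d → ℝ} (h₁ : IsRegularHomogeneous n g₁ α)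
    (h₂ : IsRegularHomogeneous n g₂ α) (hJ : angularJets n g₁ = angularJets n g₂) {ε : ℝ}
    (hε : 0 < ε) : ∃ N, IsOpen N ∧ maxSet g₁ ⊆ N ∧ ∀ z ∈ N,
      |angular g₂ z - angular g₁ z| ≤ ε * Metric.infDist z (maxSet g₁) ^ n := by
  obtain ⟨-, hjet⟩ := eq_of_angularJets_eq hJ
  set M := maxSet g₁ with hM
  have hMc : IsCompact M := h₁.isCompact_maxSet
  have hM0 : ∀ v ∈ M, v ≠ 0 := fun v hv => h₁.ne_zero (h₁.maxSet_subset hv)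
  set Δ := angular g₂ - angular g₁ with hΔ
  have hΔc : ∀ z, z ≠ 0 → ContDiffAt ℝ n Δ z := fun z hz =>
    (h₂.contDiffAt_angular hz).sub (h₁.contDiffAt_angular hz)
  have hΔ0 : ∀ v ∈ M, ∀ k ≤ n, iteratedFDeriv ℝ k Δ v = 0 := fun v hv k hk => by
    rw [hΔ, iteratedFDeriv_sub_apply ((h₂.contDiffAt_angular (hM0 v hv)).of_le (by exact_mod_cast hk))
      ((h₁.contDiffAt_angular (hM0 v hv)).of_le (by exact_mod_cast hk)), hjet v hv k hk, sub_self]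
  set O : Set (E d) := {0}ᶜ ∩ (fun z => ‖iteratedFDeriv ℝ n Δ z‖) ⁻¹' Set.Iio ε with hO
  have hOo : IsOpen O := by
    refine ContinuousOn.isOpen_inter_preimage (fun z hz => ?_) isOpen_compl_singleton isOpen_Iio
    exact ((hΔc z hz).continuousAt_iteratedFDeriv le_rfl).norm.continuousWithinAt
  have hMO : M ⊆ O := fun v hv => ⟨hM0 v hv, by simp [hΔ0 v hv n le_rfl, hε]⟩
  obtain ⟨δ, hδ, hsub⟩ := hMc.exists_thickening_subset_open hOo hMO
  refine ⟨Metric.thickening δ M, Metric.isOpen_thickening, Metric.self_subset_thickening hδ M,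
    fun z hz => ?_⟩
  have hne : M.Nonempty := by
    obtain ⟨v, hv, -⟩ := Metric.mem_thickening_iff.1 hz
    exact ⟨v, hv⟩
  obtain ⟨v, hv, hvd⟩ := hMc.exists_infDist_eq_dist hne z
  have hzv : dist z v < δ := by
    rw [← hvd]
    obtain ⟨v', hv', hlt⟩ := Metric.mem_thickening_iff.1 hz
    exact (Metric.infDist_le_dist_of_mem hv').trans_lt hlt
  have hseg : ∀ s ∈ Set.Icc (0 : ℝ) 1, v + s • (z - v) ∈ O := fun s hs => by
    refine hsub (Metric.mem_thickening_iff.2 ⟨v, hv, ?_⟩)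
    rw [dist_eq_norm, add_sub_cancel_left, norm_smul, Real.norm_of_nonneg hs.1, ← dist_eq_norm]
    exact (mul_le_of_le_one_left dist_nonneg hs.2).trans_lt hzv
  have hT := abs_sub_taylor_le (f := Δ) (x := v) (y := z - v) (N := n) (ε := ε)
    (fun s hs => hΔc _ (hseg s hs).1) (fun s hs => by
      rw [hΔ0 v hv n le_rfl, sub_zero]; exact (le_of_lt (hseg s hs).2))
  rw [Finset.sum_eq_zero fun k hk => by
    rw [hΔ0 v hv k (Nat.lt_succ_iff.1 (Finset.mem_range.1 hk))]; simp, sub_zero,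
    add_sub_cancel, ← dist_eq_norm, ← hvd] at hT
  exact hT

/-- Phase and amplitude are Lipschitz functions of the angular function as long as it stays in
`[ĝ/2, ĝ]`. The angular functions differ by a small multiple of the distance to the power `2r + 2`,
which is `O(phase^(r+1))`. -/
theorem exists_phase_amplitude_close {r : ℕ} {g₁ g₂ : E d → ℝ}
    (h₁ : IsRegularHomogeneous (2 * r + 2) g₁ α) (h₂ : IsRegularHomogeneous (2 * r + 2) g₂ α)
    (hG : sphereMax g₁ = sphereMax g₂)
    (hJ : angularJets (2 * r + 2) g₁ = angularJets (2 * r + 2) g₂)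
    (hdist : ∃ N, IsOpen N ∧ maxSet g₁ ⊆ N ∧
      ∃ C, ∀ z ∈ N, Metric.infDist z (maxSet g₁) ^ 2 ≤ C * phase g₁ α z) {ε : ℝ} (hε : 0 < ε) :
    ∃ N, IsOpen N ∧ maxSet g₁ ⊆ N ∧ N ⊆ positiveCone g₁ ∩ positiveCone g₂ ∧ ∀ z ∈ N,
      phase g₁ α z ≤ 1 ∧ |phase g₂ α z - phase g₁ α z| ≤ ε * phase g₁ α z ^ (r + 1) ∧
      |amplitude g₂ α z - amplitude g₁ α z| ≤ ε * phase g₁ α z ^ (r + 1) * amplitude g₁ α z := by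
  obtain ⟨hM, -⟩ := eq_of_angularJets_eq hJ
  have hα := h₁.order_pos
  have hG0 := h₁.sphereMax_pos
  obtain ⟨N₀, hN₀o, hMN₀, C, hC⟩ := hdist
  have hlip : ∀ β : ℝ, ∃ K : NNReal, LipschitzOnWith K (fun t : ℝ => (sphereMax g₁ / t) ^ β)
      (Set.Icc (sphereMax g₁ / 2) (sphereMax g₁)) := fun β => by
    refine ContDiffOn.exists_lipschitzOnWith (n := 1) (fun t ht => ?_) (by norm_num)
      (convex_Icc _ _) isCompact_Icc
    have ht0 : 0 < t := (half_pos hG0).trans_le ht.1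
    exact ((contDiffAt_const.div contDiffAt_id ht0.ne').rpow_const_of_ne
      (div_pos hG0 ht0).ne').contDiffWithinAt
  obtain ⟨K₁, hK₁⟩ := hlip (2 / α)
  obtain ⟨K₂, hK₂⟩ := hlip ((d : ℝ) / α)
  set K : ℝ := K₁ + K₂ + 1 with hK
  have hK0 : 0 < K := by positivity
  -- Makes the constant positive, so that it can be divided by.
  set C' := max C 1 with hC'
  have hC'0 : 0 < C' := lt_of_lt_of_le one_pos (le_max_right _ _)
  obtain ⟨N₁, hN₁o, hMN₁, hN₁⟩ := exists_abs_angular_sub_le h₁ h₂ hJ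
    (ε := ε / (K * C' ^ (r + 1))) (by positivity)
  have hopen : ∀ {f : E d → ℝ}, IsRegularHomogeneous (2 * r + 2) f α →
      IsOpen (positiveCone f ∩ angular f ⁻¹' Set.Ioi (sphereMax g₁ / 2)) := fun {f} hf =>
    ContinuousOn.isOpen_inter_preimage (fun z hz =>
      (hf.contDiffAt_angular (hf.ne_zero hz)).continuousAt.continuousWithinAt)
      hf.isOpen_positiveCone isOpen_Ioi
  have hmem : ∀ {f : E d → ℝ}, IsRegularHomogeneous (2 * r + 2) f α → sphereMax f = sphereMax g₁ →
      ∀ z ∈ maxSet f, z ∈ positiveCone f ∩ angular f ⁻¹' Set.Ioi (sphereMax g₁ / 2) := by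
    intro f hf hfG z hz
    refine ⟨hf.maxSet_subset hz, ?_⟩
    have h3 : ‖z‖ = 1 := by simpa using hz.1
    rw [Set.mem_preimage, Set.mem_Ioi, angular, h3, inv_one, one_smul, hz.2, hfG]
    linarith
  have hpo : IsOpen (positiveCone g₁ ∩ phase g₁ α ⁻¹' Set.Iio 1) :=
    h₁.contDiffOn_phase.continuousOn.isOpen_inter_preimage h₁.isOpen_positiveCone isOpen_Iio
  refine ⟨N₀ ∩ N₁ ∩ (positiveCone g₁ ∩ angular g₁ ⁻¹' Set.Ioi (sphereMax g₁ / 2)) ∩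
    (positiveCone g₂ ∩ angular g₂ ⁻¹' Set.Ioi (sphereMax g₁ / 2)) ∩
    (positiveCone g₁ ∩ phase g₁ α ⁻¹' Set.Iio 1),
    (((hN₀o.inter hN₁o).inter (hopen h₁)).inter (hopen h₂)).inter hpo, fun z hz => ?_,
    fun z hz => ⟨hz.2.1, hz.1.2.1⟩, ?_⟩
  · refine ⟨⟨⟨⟨hMN₀ hz, hMN₁ hz⟩, hmem h₁ rfl z hz⟩, hmem h₂ hG.symm z (hM ▸ hz)⟩,
      h₁.maxSet_subset hz, ?_⟩
    rw [Set.mem_preimage, (h₁.phase_eq_zero_iff (h₁.maxSet_subset hz)).2 hz]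
    simp
  rintro z ⟨⟨⟨⟨hz0, hz1⟩, hz2⟩, hz3⟩, hz4⟩
  have hzW := hz4.1
  have hp0 := h₁.phase_nonneg hzW
  have hm1 : angular g₁ z ∈ Set.Icc (sphereMax g₁ / 2) (sphereMax g₁) :=
    ⟨le_of_lt hz2.2, h₁.angular_le (h₁.ne_zero hzW)⟩
  have hm2 : angular g₂ z ∈ Set.Icc (sphereMax g₁ / 2) (sphereMax g₁) :=
    ⟨le_of_lt hz3.2, hG ▸ h₂.angular_le (h₁.ne_zero hzW)⟩
  have hd1 := hK₁.dist_le_mul _ hm2 _ hm1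
  have hd2 := hK₂.dist_le_mul _ hm2 _ hm1
  simp only [Real.dist_eq] at hd1 hd2
  have hang : K * |angular g₂ z - angular g₁ z| ≤ ε * phase g₁ α z ^ (r + 1) := by
    have e1 : Metric.infDist z (maxSet g₁) ^ (2 * r + 2) ≤ (C' * phase g₁ α z) ^ (r + 1) := by
      rw [show 2 * r + 2 = 2 * (r + 1) by ring, pow_mul]
      refine pow_le_pow_left₀ (sq_nonneg _) ((hC z hz0).trans ?_) _
      gcongr
      exact le_max_left _ _
    calc K * |angular g₂ z - angular g₁ z| ≤ K * (ε / (K * C' ^ (r + 1)) *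
          (C' * phase g₁ α z) ^ (r + 1)) := by
          refine mul_le_mul_of_nonneg_left ((hN₁ z hz1).trans ?_) hK0.le
          gcongr
      _ = _ := by rw [mul_pow]; field_simp
  have hKle : ∀ K' : NNReal, (K' : ℝ) ≤ K → K' * |angular g₂ z - angular g₁ z| ≤
      ε * phase g₁ α z ^ (r + 1) := fun K' hK' =>
    (mul_le_mul_of_nonneg_right hK' (abs_nonneg _)).trans hang
  have hK₁0 := K₁.coe_nonneg
  have hK₂0 := K₂.coe_nonneg
  have hb1 := hd1.trans (hKle K₁ (by linarith))
  have hb2 := hd2.trans (hKle K₂ (by linarith))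
  refine ⟨le_of_lt hz4.2, ?_, ?_⟩
  · have e1 : phase g₂ α z - phase g₁ α z = ((sphereMax g₁ / angular g₂ z) ^ (2 / α) -
        (sphereMax g₁ / angular g₁ z) ^ (2 / α)) / 2 := by
      rw [phase, phase, ← hG]; ring
    rw [e1, abs_div, abs_two]
    have := abs_nonneg ((sphereMax g₁ / angular g₂ z) ^ (2 / α) -
        (sphereMax g₁ / angular g₁ z) ^ (2 / α))
    linarith
  · have e1 : amplitude g₂ α z - amplitude g₁ α z = (‖z‖ ^ d)⁻¹ *
        ((sphereMax g₁ / angular g₂ z) ^ ((d : ℝ) / α) -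
        (sphereMax g₁ / angular g₁ z) ^ ((d : ℝ) / α)) := by
      rw [amplitude, amplitude, ← hG]; ring
    have e2 : (‖z‖ ^ d)⁻¹ ≤ amplitude g₁ α z := by
      rw [amplitude]
      exact le_mul_of_one_le_right (by positivity)
        (Real.one_le_rpow (h₁.one_le_div hzW) (by positivity))
    rw [e1, abs_mul, abs_of_nonneg (by positivity), mul_comm]
    exact mul_le_mul hb2 e2 (by positivity) (by positivity)

end Comparison


/-! ### Incomplete Gamma integrals of asymptotic expansions -/

section Tail

theorem HasAsymptotics.congr' {r : ℕ} {c : ℕ → ℝ} {f f' : ℝ → ℝ} (h : HasAsymptotics r c f)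
    (h' : f =ᶠ[atTop] f') : HasAsymptotics r c f' := by
  refine IsLittleO.congr' h ?_ (EventuallyEq.refl _ _)
  filter_upwards [h'] with l hl
  rw [hl]

theorem HasAsymptotics.const_mul {r : ℕ} {c : ℕ → ℝ} {f : ℝ → ℝ} (h : HasAsymptotics r c f)
    (a : ℝ) : HasAsymptotics r (a • c) fun l => a * f l := by
  refine (IsLittleO.const_mul_left h a).congr_left fun l => ?_
  simp only [Pi.smul_apply, smul_eq_mul, mul_assoc, ← Finset.mul_sum]
  ring

theorem HasAsymptotics.of_succ {r : ℕ} {c : ℕ → ℝ} {f : ℝ → ℝ} (h : HasAsymptotics (r + 1) c f) :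
    HasAsymptotics r c f := by
  have hinv : Tendsto (fun l : ℝ => l⁻¹) atTop (𝓝 0) := tendsto_inv_atTop_zero
  have h1 : (fun l : ℝ => (l⁻¹) ^ (r + 1)) =o[atTop] fun l : ℝ => (l⁻¹) ^ r := by
    have h2 : (fun l : ℝ => l⁻¹) =o[atTop] fun _ => (1 : ℝ) := (isLittleO_one_iff ℝ).2 hinv
    simpa [pow_succ] using (isBigO_refl (fun l : ℝ => (l⁻¹) ^ r) atTop).mul_isLittleO h2
  refine ((IsLittleO.trans h h1).add (h1.const_mul_left (c (r + 1)))).congr_left fun l => ?_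
  rw [Finset.sum_range_succ _ (r + 1)]
  ring

/-- The coefficients `0, …, 0, c 0, c 1, …` with `i` leading zeros. -/
def shiftCoeff (i : ℕ) (c : ℕ → ℝ) (j : ℕ) : ℝ := if i ≤ j then c (j - i) else 0

theorem HasAsymptotics.inv_mul {r : ℕ} {c : ℕ → ℝ} {f : ℝ → ℝ} (h : HasAsymptotics r c f) :
    HasAsymptotics (r + 1) (shiftCoeff 1 c) fun l => l⁻¹ * f l := by
  have h1 := (isBigO_refl (fun l : ℝ => l⁻¹) atTop).mul_isLittleO h
  refine h1.congr (fun l => ?_) fun l => by rw [pow_succ, mul_comm]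
  rw [Finset.sum_range_succ' _ (r + 1), mul_sub, Finset.mul_sum]
  simp only [shiftCoeff, Nat.le_add_left, if_true, Nat.add_sub_cancel, zero_mul,
    nonpos_iff_eq_zero, one_ne_zero, if_false, add_zero]
  congr 1
  refine Finset.sum_congr rfl fun i _ => ?_
  rw [pow_succ]
  ring

/-- Each factor `l⁻¹` gains one order, which `of_succ` gives up again to keep `r` fixed. -/
theorem HasAsymptotics.inv_pow_mul {r : ℕ} {c : ℕ → ℝ} {f : ℝ → ℝ} (h : HasAsymptotics r c f)
    (i : ℕ) : HasAsymptotics r (shiftCoeff i c) fun l => (l⁻¹) ^ i * f l := by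
  induction i with
  | zero =>
    have : shiftCoeff 0 c = c := by ext j; simp [shiftCoeff]
    simpa [this] using h
  | succ i ih =>
    have h1 := ih.inv_mul.of_succ
    have h2 : shiftCoeff 1 (shiftCoeff i c) = shiftCoeff (i + 1) c := by
      ext j
      simp only [shiftCoeff]
      by_cases hj : 1 ≤ j
      · by_cases hij : i + 1 ≤ j
        · rw [if_pos hj, if_pos (by omega), if_pos hij]; congr 1; omega
        · rw [if_pos hj, if_neg (by omega), if_neg hij]
      · rw [if_neg hj, if_neg (by omega)]
    rw [h2] at h1
    refine h1.congr' (Eventually.of_forall fun l => ?_)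
    simp only
    ring

/-- The normalized tail of the integral of `V w` against `w ^ q exp (- w / 2) / 2`. -/
noncomputable def gammaTail (q : ℝ) (V : ℝ → ℝ) (l : ℝ) : ℝ :=
  l ^ (-q) * Real.exp (l / 2) * ∫ w in Set.Ioi l, w ^ q * Real.exp (-(w / 2)) / 2 * V w

theorem isBigO_rpow_mul_exp (q : ℝ) :
    (fun w : ℝ => w ^ q * Real.exp (-(w / 2))) =O[atTop] fun w => Real.exp (-(1 / 4) * w) := by
  have h := (isLittleO_rpow_mul_exp_neg q (ε := 1 / 4) (by norm_num) 0).isBigO.mul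
    (isBigO_refl (fun w : ℝ => Real.exp (-(1 / 4) * w)) atTop)
  refine h.congr (fun w => ?_) fun w => by simp
  rw [mul_assoc, ← Real.exp_add]
  congr 2
  ring

theorem integrableOn_rpow_mul_exp (q : ℝ) {l : ℝ} (hl : 0 < l) :
    IntegrableOn (fun w : ℝ => w ^ q * Real.exp (-(w / 2)) / 2) (Set.Ioi l) := by
  refine (integrable_of_isBigO_exp_neg (b := 1 / 4) (by norm_num) (fun w hw => ?_)
    (isBigO_rpow_mul_exp q)).div_const 2
  have hw0 : w ≠ 0 := (hl.trans_le hw).ne'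
  exact ((Real.continuousAt_rpow_const w q (Or.inl hw0)).mul
    (by fun_prop : Continuous fun w : ℝ => Real.exp (-(w / 2))).continuousAt).continuousWithinAt

theorem gammaTail_nonneg (q : ℝ) {V : ℝ → ℝ} {l : ℝ} (hl : 0 < l) (hV : ∀ w, l < w → 0 ≤ V w) :
    0 ≤ gammaTail q V l := by
  refine mul_nonneg (by positivity) (setIntegral_nonneg measurableSet_Ioi fun w hw => ?_)
  have hw0 : 0 < w := hl.trans hw
  exact mul_nonneg (by positivity) (hV w hw)

/-- Integration by parts, the boundary term at infinity being zero. -/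
theorem gammaTail_recursion (q : ℝ) {l : ℝ} (hl : 0 < l) :
    gammaTail q 1 l = 1 + 2 * q * (l⁻¹ * gammaTail (q - 1) 1 l) := by
  have h1 := integrableOn_rpow_mul_exp q hl
  have h2 := integrableOn_rpow_mul_exp (q - 1) hl
  have hder : ∀ w ∈ Set.Ici l, HasDerivAt (fun w : ℝ => -(w ^ q * Real.exp (-(w / 2))))
      (w ^ q * Real.exp (-(w / 2)) / 2 - 2 * q * (w ^ (q - 1) * Real.exp (-(w / 2)) / 2)) w := by
    intro w hw
    have hw0 : w ≠ 0 := (hl.trans_le hw).ne'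
    have h3 := (Real.hasDerivAt_rpow_const (x := w) (p := q) (Or.inl hw0)).mul
      (((hasDerivAt_id w).div_const 2).neg.exp)
    refine h3.neg.congr_deriv ?_
    simp only [Pi.neg_apply, id]
    ring
  have hlim : Tendsto (fun w : ℝ => -(w ^ q * Real.exp (-(w / 2)))) atTop (𝓝 0) := by
    have h3 := isLittleO_rpow_mul_exp_neg q (ε := 1 / 2) (by norm_num) 0
    simp only [pow_zero] at h3
    have h4 := ((isLittleO_one_iff ℝ).1 h3).neg
    rw [neg_zero] at h4
    refine h4.congr fun w => ?_
    congr 3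
    ring
  have h3 := integral_Ioi_of_hasDerivAt_of_tendsto' hder (h1.sub (h2.const_mul (2 * q))) hlim
  rw [integral_sub h1 (h2.const_mul (2 * q)), integral_const_mul] at h3
  have h4 : ∫ w in Set.Ioi l, w ^ q * Real.exp (-(w / 2)) / 2 =
      l ^ q * Real.exp (-(l / 2)) +
        2 * q * ∫ w in Set.Ioi l, w ^ (q - 1) * Real.exp (-(w / 2)) / 2 := by linarith
  simp only [gammaTail, Pi.one_apply, mul_one]
  rw [h4, mul_add]
  have e1 : l ^ (-q) * Real.exp (l / 2) * (l ^ q * Real.exp (-(l / 2))) = 1 := by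
    have : l ^ (-q) * l ^ q = 1 := by rw [← Real.rpow_add hl, neg_add_cancel, Real.rpow_zero]
    have h5 : Real.exp (l / 2) * Real.exp (-(l / 2)) = 1 := by
      rw [← Real.exp_add, add_neg_cancel, Real.exp_zero]
    linear_combination (Real.exp (l / 2) * Real.exp (-(l / 2))) * this + h5
  have e2 : l ^ (-(q - 1)) = l ^ (-q) * l := by
    rw [show -(q - 1) = -q + 1 by ring, Real.rpow_add hl, Real.rpow_one]
  rw [e1, e2]
  field_simp

/-- For `q ≤ 0` the second term of the recursion is not positive, so `1` is a bound; each
application of the recursion lowers `q` by one. -/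
theorem exists_gammaTail_one_le (q : ℝ) : ∃ C, ∀ l : ℝ, 1 ≤ l → gammaTail q 1 l ≤ C := by
  have key : ∀ j : ℕ, ∀ q : ℝ, q ≤ j → ∃ C, ∀ l : ℝ, 1 ≤ l → gammaTail q 1 l ≤ C := by
    intro j
    induction j with
    | zero =>
      intro q hq
      refine ⟨1, fun l hl => ?_⟩
      have hl0 : 0 < l := by linarith
      have hq' : q ≤ 0 := by simpa using hq
      have h1 := gammaTail_nonneg (q - 1) (V := 1) hl0 fun _ _ => zero_le_one
      rw [gammaTail_recursion q hl0]
      have : 0 ≤ l⁻¹ * gammaTail (q - 1) 1 l := by positivity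
      nlinarith
    | succ j ih =>
      intro q hq
      obtain ⟨C, hC⟩ := ih (q - 1) (by push_cast at hq; linarith)
      refine ⟨1 + 2 * |q| * C, fun l hl => ?_⟩
      have hl0 : 0 < l := by linarith
      have h1 := gammaTail_nonneg (q - 1) (V := 1) hl0 fun _ _ => zero_le_one
      have h2 : l⁻¹ * gammaTail (q - 1) 1 l ≤ C :=
        (mul_le_of_le_one_left h1 (inv_le_one_of_one_le₀ hl)).trans (hC l hl)
      have h3 : 0 ≤ l⁻¹ * gammaTail (q - 1) 1 l := by positivity
      rw [gammaTail_recursion q hl0]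
      have h4 := mul_le_mul_of_nonneg_right (le_abs_self q) h3
      have h5 := mul_le_mul_of_nonneg_left h2 (abs_nonneg q)
      linarith
  obtain ⟨j, hj⟩ := exists_nat_ge q
  exact key j q hj

/-- The recursion gains one order and lowers `q`, so the induction on `r` treats all `q` at once. At
order zero, boundedness of the shifted tail suffices. -/
theorem exists_hasAsymptotics_gammaTail_one (r : ℕ) : ∀ q : ℝ, ∃ γ : ℕ → ℝ, γ 0 = 1 ∧
    HasAsymptotics r γ (gammaTail q 1) := by
  have hrec : ∀ q : ℝ, ∀ s : ℕ, ∀ f : ℝ → ℝ,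
      (∀ l, 0 < l → f l = l⁻¹ * gammaTail (q - 1) 1 l) → ∀ γ, γ 0 = 0 → HasAsymptotics s γ f →
      ∃ γ' : ℕ → ℝ, γ' 0 = 1 ∧ HasAsymptotics s γ' (gammaTail q 1) := by
    intro q s f hf γ hγ0 hγ
    have h1 : HasAsymptotics s (fun i => if i = 0 then 1 else 0) fun _ => (1 : ℝ) := by
      refine (isLittleO_zero _ _).congr_left fun l => ?_
      rw [Finset.sum_range_succ']
      simp
    refine ⟨_, ?_, (h1.add (hγ.const_mul (2 * q))).congr' ?_⟩
    · simp [hγ0]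
    · filter_upwards [eventually_gt_atTop 0] with l hl
      rw [gammaTail_recursion q hl, hf l hl]
  induction r with
  | zero =>
    intro q
    refine hrec q 0 _ (fun l _ => rfl) 0 rfl ?_
    obtain ⟨C, hC⟩ := exists_gammaTail_one_le (q - 1)
    have h1 : gammaTail (q - 1) 1 =O[atTop] fun _ => (1 : ℝ) := by
      refine IsBigO.of_bound C ?_
      filter_upwards [eventually_ge_atTop 1] with l hl
      rw [Real.norm_of_nonneg (gammaTail_nonneg _ (V := 1) (by linarith) fun _ _ => zero_le_one), norm_one,
        mul_one]
      exact hC l hl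
    have h2 : (fun l : ℝ => l⁻¹) =o[atTop] fun _ => (1 : ℝ) :=
      (isLittleO_one_iff ℝ).2 tendsto_inv_atTop_zero
    refine (h2.mul_isBigO h1).congr (fun l => ?_) fun l => ?_ <;> simp
  | succ r ih =>
    intro q
    obtain ⟨γ, -, hγ⟩ := ih (q - 1)
    exact hrec q (r + 1) _ (fun l _ => rfl) _ (by simp [shiftCoeff]) hγ.inv_mul

theorem gammaTail_inv_pow (q : ℝ) (i : ℕ) {l : ℝ} (hl : 0 < l) :
    gammaTail q (fun w => (w⁻¹) ^ i) l = (l⁻¹) ^ i * gammaTail (q - i) 1 l := by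
  have e1 : ∀ w : ℝ, 0 < w → w ^ (q - i) = w ^ q * (w⁻¹) ^ i := fun w hw => by
    rw [Real.rpow_sub hw, Real.rpow_natCast, inv_pow, div_eq_mul_inv]
  have e2 : l ^ (-(q - i)) = l ^ (-q) * l ^ i := by
    rw [show -(q - i) = -q + i by ring, Real.rpow_add hl, Real.rpow_natCast]
  have e3 : ∫ w in Set.Ioi l, w ^ q * Real.exp (-(w / 2)) / 2 * (w⁻¹) ^ i =
      ∫ w in Set.Ioi l, w ^ (q - i) * Real.exp (-(w / 2)) / 2 * (1 : ℝ → ℝ) w := by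
    refine setIntegral_congr_fun measurableSet_Ioi fun w hw => ?_
    simp only [Pi.one_apply, mul_one]
    rw [e1 w (hl.trans hw)]
    ring
  rw [gammaTail, gammaTail, e3, e2, inv_pow]
  field_simp

theorem integrableOn_rpow_mul_exp_mul_inv_pow (q : ℝ) (i : ℕ) {l : ℝ} (hl : 0 < l) :
    IntegrableOn (fun w : ℝ => w ^ q * Real.exp (-(w / 2)) / 2 * (w⁻¹) ^ i) (Set.Ioi l) := by
  refine (integrableOn_rpow_mul_exp (q - i) hl).congr_fun (fun w hw => ?_) measurableSet_Ioi
  have hw0 : 0 < w := hl.trans hw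
  simp only
  rw [Real.rpow_sub hw0, Real.rpow_natCast, inv_pow]
  ring

/-- Integration of an asymptotic expansion against the tail of a Gamma law: the coefficients of the
result are determined by those of the integrand. -/
theorem exists_hasAsymptotics_gammaTail (r : ℕ) (q : ℝ) (c : ℕ → ℝ) :
    ∃ c' : ℕ → ℝ, c' 0 = c 0 ∧ ∀ V : ℝ → ℝ,
      IntegrableOn (fun w => w ^ q * Real.exp (-(w / 2)) / 2 * V w) (Set.Ioi 1) →
      HasAsymptotics r c V → HasAsymptotics r c' (gammaTail q V) := by
  choose γ hγ0 hγ using fun i : ℕ => exists_hasAsymptotics_gammaTail_one r (q - i)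
  refine ⟨∑ i ∈ Finset.range (r + 1), c i • shiftCoeff i (γ i), ?_, fun V hV hcV => ?_⟩
  · rw [Finset.sum_apply, Finset.sum_range_succ', Finset.sum_eq_zero fun i _ => by simp [shiftCoeff]]
    simp [shiftCoeff, hγ0]
  refine (HasAsymptotics.sum (Finset.range (r + 1)) fun i _ =>
    ((hγ i).inv_pow_mul i).const_mul (c i)).of_isLittleO ?_
  obtain ⟨C, hC⟩ := exists_gammaTail_one_le (q - r)
  refine isLittleO_iff.2 fun δ hδ => ?_
  set ε := δ / (|C| + 1) with hε
  have hε0 : 0 < ε := by positivity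
  obtain ⟨l₀, hl₀⟩ := eventually_atTop.1 (isLittleO_iff.1 hcV hε0)
  filter_upwards [eventually_ge_atTop l₀, eventually_ge_atTop 1] with l hl hl1
  have hl0 : 0 < l := by linarith
  have hVl := hV.mono_set (Set.Ioi_subset_Ioi hl1)
  have hi := fun i : ℕ => (integrableOn_rpow_mul_exp_mul_inv_pow q i hl0).const_mul (c i)
  have hsum : ∑ i ∈ Finset.range (r + 1), c i * ((l⁻¹) ^ i * gammaTail (q - i) 1 l) =
      l ^ (-q) * Real.exp (l / 2) * ∫ w in Set.Ioi l, ∑ i ∈ Finset.range (r + 1),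
        c i * (w ^ q * Real.exp (-(w / 2)) / 2 * (w⁻¹) ^ i) := by
    rw [integral_finsetSum _ fun i _ => hi i, Finset.mul_sum]
    refine Finset.sum_congr rfl fun i _ => ?_
    rw [← gammaTail_inv_pow q i hl0, gammaTail, integral_const_mul]
    ring
  rw [hsum, gammaTail, ← mul_sub, ← integral_sub hVl (integrable_finsetSum _ fun i _ => hi i),
    norm_mul, Real.norm_of_nonneg (by positivity : 0 ≤ l ^ (-q) * Real.exp (l / 2)),
    Real.norm_of_nonneg (by positivity : 0 ≤ (l⁻¹) ^ r)]
  have hle : ‖∫ w in Set.Ioi l, (w ^ q * Real.exp (-(w / 2)) / 2 * V w -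
      ∑ i ∈ Finset.range (r + 1), c i * (w ^ q * Real.exp (-(w / 2)) / 2 * (w⁻¹) ^ i))‖ ≤
      ∫ w in Set.Ioi l, ε * (w ^ q * Real.exp (-(w / 2)) / 2 * (w⁻¹) ^ r) := by
    refine norm_integral_le_of_norm_le
      ((integrableOn_rpow_mul_exp_mul_inv_pow q r hl0).const_mul ε) ?_
    refine (ae_restrict_mem measurableSet_Ioi).mono fun w hw => ?_
    have hlw : l < w := hw
    have hw0 : 0 < w := hl0.trans hlw
    have h1 := hl₀ w (hl.trans hlw.le)
    rw [Real.norm_of_nonneg (by positivity : 0 ≤ (w⁻¹) ^ r)] at h1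
    have e1 : w ^ q * Real.exp (-(w / 2)) / 2 * V w - ∑ i ∈ Finset.range (r + 1),
        c i * (w ^ q * Real.exp (-(w / 2)) / 2 * (w⁻¹) ^ i) = w ^ q * Real.exp (-(w / 2)) / 2 *
        (V w - ∑ i ∈ Finset.range (r + 1), c i * (w⁻¹) ^ i) := by
      rw [mul_sub, Finset.mul_sum]
      congr 1
      refine Finset.sum_congr rfl fun i _ => ?_
      ring
    rw [e1, norm_mul, Real.norm_of_nonneg (by positivity), mul_left_comm]
    gcongr
  have hmul : l ^ (-q) * Real.exp (l / 2) * ∫ w in Set.Ioi l,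
      ε * (w ^ q * Real.exp (-(w / 2)) / 2 * (w⁻¹) ^ r) =
      ε * ((l⁻¹) ^ r * gammaTail (q - r) 1 l) := by
    rw [← gammaTail_inv_pow q r hl0, gammaTail, integral_const_mul]
    ring
  refine (mul_le_mul_of_nonneg_left hle (by positivity)).trans ?_
  rw [hmul]
  have h2 : gammaTail (q - r) 1 l ≤ |C| + 1 := (hC l hl1).trans (by linarith [le_abs_self C])
  calc ε * ((l⁻¹) ^ r * gammaTail (q - r) 1 l) ≤ ε * ((l⁻¹) ^ r * (|C| + 1)) := by gcongr
    _ = δ * (l⁻¹) ^ r := by rw [hε]; field_simp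

/-- Reads an expansion in `1/l` at `l = (x/ĝ)^(2/α)`; the powers of `ĝ` pass into the coefficients.
-/
theorem HasAsymptotics.hasChaosExpansion {r : ℕ} {c : ℕ → ℝ} {W : ℝ → ℝ} (h : HasAsymptotics r c W)
    {α G β : ℝ} (hα : 0 < α) (hG : 0 < G) {F : ℝ → ℝ}
    (hF : ∀ᶠ x in atTop, F x = (x / G) ^ β * Real.exp (-(x / G) ^ (2 / α) / 2) *
      W ((x / G) ^ (2 / α))) :
    HasChaosExpansion F α G β r (c 0) fun i => c i * G ^ (2 * (i : ℝ) / α) := by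
  have hpow : ∀ i : ℕ, ∀ x : ℝ, 0 < x → (((x / G) ^ (2 / α))⁻¹) ^ i =
      G ^ (2 * (i : ℝ) / α) * x ^ (-(2 * (i : ℝ)) / α) := by
    intro i x hx
    rw [← Real.rpow_neg (by positivity), ← Real.rpow_natCast, ← Real.rpow_mul (by positivity),
      Real.div_rpow hx.le hG.le, neg_div,
      show -(2 / α) * (i : ℝ) = -(2 * i / α) by ring,
      Real.rpow_neg hG.le, div_inv_eq_mul, mul_comm]
  have hlim : Tendsto (fun x : ℝ => (x / G) ^ (2 / α)) atTop atTop :=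
    (tendsto_rpow_atTop (by positivity)).comp (tendsto_id.atTop_div_const hG)
  refine ⟨fun x => W ((x / G) ^ (2 / α)) - ∑ i ∈ Finset.range (r + 1), c i *
    (((x / G) ^ (2 / α))⁻¹) ^ i, ?_, ?_⟩
  · have h1 := IsLittleO.comp_tendsto h hlim
    refine h1.trans_isBigO (IsBigO.of_bound (G ^ (2 * (r : ℝ) / α)) ?_)
    filter_upwards [eventually_gt_atTop 0] with x hx
    simp only [Function.comp_apply]
    rw [hpow r x hx, norm_mul, Real.norm_of_nonneg (by positivity : 0 ≤ G ^ (2 * (r : ℝ) / α))]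
  · filter_upwards [hF, eventually_gt_atTop 0] with x hx hx0
    rw [hx]
    congr 1
    have h2 : ∑ i ∈ Finset.range (r + 1), c i * (((x / G) ^ (2 / α))⁻¹) ^ i =
        c 0 + ∑ i ∈ Finset.Icc 1 r, c i * G ^ (2 * (i : ℝ) / α) * x ^ (-(2 * (i : ℝ)) / α) := by
      rw [Finset.range_eq_Ico, Finset.sum_eq_sum_Ico_succ_bot (Nat.succ_pos r)]
      simp only [pow_zero, mul_one]
      congr 1
      refine Finset.sum_congr (by ext i; simp) fun i _ => ?_
      rw [hpow i x hx0]
      ring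
    rw [h2]
    ring

end Tail


/-! ### From the Laplace integral to the density and the tail -/

section Chaos

variable {d : ℕ} {g : E d → ℝ} {α : ℝ}

/-- The normalized Laplace integral of a homogeneous function whose maximum set has dimension `m`. -/
noncomputable def laplaceIntegral (m : ℕ) (g : E d → ℝ) (α w : ℝ) : ℝ :=
  w ^ (((d - m : ℕ) : ℝ) / 2) *
    ∫ z in positiveCone g, amplitude g α z * Real.exp (-(w * phase g α z))

/-- The constant `(2 π) ^ (- (d + 1) / 2)`. -/
noncomputable def gaussianConst (d : ℕ) : ℝ := (2 * Real.pi) ^ (-((d : ℝ) + 1) / 2)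

theorem gaussianConst_pos (d : ℕ) : 0 < gaussianConst d :=
  Real.rpow_pos_of_pos (by positivity) _

theorem hasDerivWithinAt_radius (g : E d → ℝ) (α : ℝ) {l : ℝ} (hl : 0 < l) : ∀ w ∈ Set.Ioi l,
    HasDerivWithinAt (fun w => sphereMax g * w ^ (α / 2))
      (sphereMax g * (α / 2 * w ^ (α / 2 - 1))) (Set.Ioi l) w := fun _ hw =>
  ((Real.hasDerivAt_rpow_const (Or.inl (hl.trans hw).ne')).const_mul _).hasDerivWithinAt

namespace IsRegularHomogeneous

variable {n m : ℕ} (hg : IsRegularHomogeneous n g α)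

include hg

theorem chaosDensity_eq_laplaceIntegral (hm : m ≤ d) {x : ℝ} (hx : 0 < x) : chaosDensity g α x =
    (x / sphereMax g) ^ (((m : ℝ) + 1) / α - 1) * Real.exp (-(x / sphereMax g) ^ (2 / α) / 2) *
      (gaussianConst d / (α * sphereMax g) *
        laplaceIntegral m g α ((x / sphereMax g) ^ (2 / α))) := by
  have hα := hg.order_pos
  have hG := hg.sphereMax_pos
  rw [hg.chaosDensity_eq hx, laplaceIntegral, gaussianConst]
  set s := x / sphereMax g with hs
  have hs0 : 0 < s := div_pos hx hG
  have hxs : x = sphereMax g * s := by rw [hs]; field_simp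
  have e1 : s ^ (((d : ℝ) + 1) / α) =
      s ^ (((m : ℝ) + 1) / α - 1) * s * (s ^ (2 / α)) ^ (((d - m : ℕ) : ℝ) / 2) := by
    rw [← Real.rpow_mul hs0.le, ← Real.rpow_add_one hs0.ne', ← Real.rpow_add hs0, Nat.cast_sub hm]
    congr 1
    field_simp
    ring
  rw [e1, hxs]
  field_simp

/-- The integrand after the substitution `y = ĝ w^(α/2)`, which makes the exponent linear and brings
the tail into the form of `gammaTail`. -/
theorem deriv_mul_chaosDensity_eq (hm : m ≤ d) {w : ℝ} (hw : 0 < w) :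
    sphereMax g * (α / 2 * w ^ (α / 2 - 1)) * chaosDensity g α (sphereMax g * w ^ (α / 2)) =
      gaussianConst d *
        (w ^ (((m : ℝ) - 1) / 2) * Real.exp (-(w / 2)) / 2 * laplaceIntegral m g α w) := by
  have hα := hg.order_pos
  have hG := hg.sphereMax_pos
  have e1 : (w ^ (α / 2)) ^ (2 / α) = w := by
    rw [← Real.rpow_mul hw.le, show α / 2 * (2 / α) = 1 by field_simp, Real.rpow_one]
  have e2 : w ^ (α / 2 - 1) * (w ^ (α / 2)) ^ (((m : ℝ) + 1) / α - 1) =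
      w ^ (((m : ℝ) - 1) / 2) := by
    rw [← Real.rpow_mul hw.le, ← Real.rpow_add hw]
    congr 1
    field_simp
    ring
  rw [hg.chaosDensity_eq_laplaceIntegral hm (by positivity), mul_div_cancel_left₀ _ hG.ne', e1,
    ← e2, neg_div]
  field_simp

theorem image_Ioi {l : ℝ} (hl : 0 < l) : (fun w => sphereMax g * w ^ (α / 2)) '' Set.Ioi l =
    Set.Ioi (sphereMax g * l ^ (α / 2)) := by
  have hα := hg.order_pos
  have hG := hg.sphereMax_pos
  ext y
  constructor
  · rintro ⟨w, hw, rfl⟩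
    exact mul_lt_mul_of_pos_left (Real.rpow_lt_rpow hl.le hw (by positivity)) hG
  · intro hy
    have hy' : l ^ (α / 2) < y / sphereMax g := by rwa [lt_div_iff₀ hG, mul_comm]
    have hp : 0 < l ^ (α / 2) := by positivity
    have e1 : ∀ t : ℝ, 0 < t → (t ^ (α / 2)) ^ (2 / α) = t := fun t ht => by
      rw [← Real.rpow_mul ht.le, show α / 2 * (2 / α) = 1 by field_simp, Real.rpow_one]
    refine ⟨(y / sphereMax g) ^ (2 / α), ?_, ?_⟩
    · have h2 := Real.rpow_lt_rpow hp.le hy' (z := 2 / α) (by positivity)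
      rwa [e1 l hl] at h2
    · have h3 : 0 < y / sphereMax g := hp.trans hy'
      simp only
      rw [← Real.rpow_mul h3.le, show 2 / α * (α / 2) = 1 by field_simp, Real.rpow_one]
      field_simp

theorem injOn_radius {l : ℝ} (hl : 0 < l) :
    Set.InjOn (fun w => sphereMax g * w ^ (α / 2)) (Set.Ioi l) := by
  have hα := hg.order_pos
  intro a ha b hb hab
  have h1 := mul_left_cancel₀ hg.sphereMax_pos.ne' hab
  exact Real.rpow_left_injOn (by positivity : α / 2 ≠ 0) (hl.trans ha).le (hl.trans hb).le h1

theorem abs_deriv_smul_eq (hm : m ≤ d) {l : ℝ} (hl : 0 < l) :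
    Set.EqOn (fun w => |sphereMax g * (α / 2 * w ^ (α / 2 - 1))| •
      chaosDensity g α (sphereMax g * w ^ (α / 2)))
      (fun w => gaussianConst d *
        (w ^ (((m : ℝ) - 1) / 2) * Real.exp (-(w / 2)) / 2 * laplaceIntegral m g α w))
      (Set.Ioi l) := by
  intro w hw
  have hα := hg.order_pos
  have hG := hg.sphereMax_pos
  have hw0 : 0 < w := hl.trans hw
  simp only
  rw [abs_of_pos (by positivity), smul_eq_mul, hg.deriv_mul_chaosDensity_eq hm hw0]

theorem integral_chaosDensity_eq (hm : m ≤ d) {l : ℝ} (hl : 0 < l) :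
    ∫ y in Set.Ioi (sphereMax g * l ^ (α / 2)), chaosDensity g α y =
      gaussianConst d * ∫ w in Set.Ioi l,
        w ^ (((m : ℝ) - 1) / 2) * Real.exp (-(w / 2)) / 2 * laplaceIntegral m g α w := by
  rw [← hg.image_Ioi hl, integral_image_eq_integral_abs_deriv_smul measurableSet_Ioi
    (hasDerivWithinAt_radius g α hl) (hg.injOn_radius hl), ← integral_const_mul]
  exact setIntegral_congr_fun measurableSet_Ioi (hg.abs_deriv_smul_eq hm hl)

theorem integrableOn_mul_laplaceIntegral (hm : m ≤ d) {l : ℝ} (hl : 0 < l)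
    (h : IntegrableOn (chaosDensity g α) (Set.Ioi (sphereMax g * l ^ (α / 2)))) :
    IntegrableOn (fun w => w ^ (((m : ℝ) - 1) / 2) * Real.exp (-(w / 2)) / 2 *
      laplaceIntegral m g α w) (Set.Ioi l) := by
  rw [← hg.image_Ioi hl, integrableOn_image_iff_integrableOn_abs_deriv_smul measurableSet_Ioi
    (hasDerivWithinAt_radius g α hl) (hg.injOn_radius hl)] at h
  have h1 := (IntegrableOn.congr_fun h (hg.abs_deriv_smul_eq hm hl) measurableSet_Ioi).const_mul
    (gaussianConst d)⁻¹
  refine IntegrableOn.congr_fun h1 (fun w _ => ?_) measurableSet_Ioi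
  rw [inv_mul_cancel_left₀ (gaussianConst_pos d).ne']

end IsRegularHomogeneous

theorem IsDensityOffZero.integrableOn_and_tail_eq {Ω : Type*} [MeasurableSpace Ω] {P : Measure Ω}
    [IsFiniteMeasure P] {X : Ω → ℝ} (hX : AEMeasurable X P) {p : ℝ → ℝ}
    (h : IsDensityOffZero P X p) {x : ℝ} (hx : 0 ≤ x) :
    IntegrableOn p (Set.Ioi x) ∧ P.real {ω | x < X ω} = ∫ y in Set.Ioi x, p y := by
  obtain ⟨hpm, hp0, -, hd⟩ := h
  have h1 : P {ω | x < X ω} = ∫⁻ y in Set.Ioi x, ENNReal.ofReal (p y) := by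
    rw [← withDensity_apply _ measurableSet_Ioi, ← hd, Measure.restrict_apply measurableSet_Ioi,
      Set.inter_eq_left.2 fun y hy => ?_, Measure.map_apply_of_aemeasurable hX measurableSet_Ioi]
    · rfl
    · simpa using (hx.trans_lt hy).ne'
  have h2 : IntegrableOn p (Set.Ioi x) := by
    refine ⟨hpm.aestronglyMeasurable, ?_⟩
    rw [hasFiniteIntegral_iff_ofReal (Eventually.of_forall hp0), ← h1]
    exact measure_lt_top _ _
  refine ⟨h2, ?_⟩
  rw [Measure.real, h1, integral_eq_lintegral_of_nonneg_ae (Eventually.of_forall hp0)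
    hpm.aestronglyMeasurable]

/-- `g` is regular, its phase dominates the squared distance to the maximum set, and its Laplace
integral has the asymptotic coefficients `c`. -/
structure HasLaplaceExpansion (m r : ℕ) (g : E d → ℝ) (α : ℝ) (c : ℕ → ℝ) : Prop where
  regular : IsRegularHomogeneous (2 * r + 2) g α
  infDist_le : ∃ N, IsOpen N ∧ maxSet g ⊆ N ∧
    ∃ C, ∀ z ∈ N, Metric.infDist z (maxSet g) ^ 2 ≤ C * phase g α z
  hasAsymptotics : HasAsymptotics r c (laplaceIntegral m g α)

/-- Equal jets bring the phases and amplitudes so close near `M` that the Laplace integrals differ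
by `o(l^(-r))`. The coefficients of `g₁` are therefore valid for `g₂`, whatever coefficients `g₂`
was given. -/
theorem HasLaplaceExpansion.congr_of_angularJets_eq {m r : ℕ} {g₁ g₂ : E d → ℝ} {c₁ c₂ : ℕ → ℝ}
    (h₁ : HasLaplaceExpansion m r g₁ α c₁) (h₂ : HasLaplaceExpansion m r g₂ α c₂)
    (hG : sphereMax g₁ = sphereMax g₂)
    (hJ : angularJets (2 * r + 2) g₁ = angularJets (2 * r + 2) g₂) :
    HasLaplaceExpansion m r g₂ α c₁ := by
  refine ⟨h₂.regular, h₂.infDist_le, h₁.hasAsymptotics.of_isLittleO ?_⟩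
  have hM := (eq_of_angularJets_eq hJ).1
  have hL₂ := h₂.regular.isLaplaceData
  rw [← hM] at hL₂
  exact h₁.regular.isLaplaceData.isLittleO_sub hL₂ (fun z hz => h₁.regular.phase_nonneg hz)
    (h₁.hasAsymptotics.tendsto.isBigO_one ℝ) fun ε hε =>
      exists_phase_amplitude_close h₁.regular h₂.regular hG hJ h₁.infDist_le hε

theorem HasAsymptotics.coeff_zero_unique {r : ℕ} {c c' : ℕ → ℝ} {f : ℝ → ℝ}
    (h : HasAsymptotics r c f) (h' : HasAsymptotics r c' f) : c 0 = c' 0 :=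
  tendsto_nhds_unique h.tendsto h'.tendsto

/-- The Laplace method applied to the phase, whose normal determinant is the absolute value of the
nonzero minor. The amplitude equals one on `M`, so it disappears from the leading coefficient. -/
theorem IsRegularHomogeneous.exists_hasLaplaceExpansion {m r : ℕ}
    (hg : IsRegularHomogeneous (2 * r + 2) g α) (hmd : m < d)
    (hM : IsSubmanifold (2 * r + 2) m (maxSet g)) {u : E d → Fin (d - 1) → E d}
    (hu : ∀ v ∈ maxSet g, IsTangentFrame v (u v))
    (hrank : ∀ v ∈ maxSet g, (matA g α v (u v)).rank = d - 1 - m) :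
    IntegrableOn (leadingIntegrand g α u) (maxSet g) μHE[m] ∧
    ∃ c, c 0 = (2 * Real.pi) ^ (((d - m : ℕ) : ℝ) / 2) *
        ∫ v in maxSet g, leadingIntegrand g α u v ∂μHE[m] ∧ HasLaplaceExpansion m r g α c := by
  have hms : MeasurableSet (maxSet g) := hg.isCompact_maxSet.measurableSet
  have heq : Set.EqOn (fun z => amplitude g α z * |nonzeroMinor (matA g α z (u z))| ^
      (-(1 / 2) : ℝ)) (leadingIntegrand g α u) (maxSet g) := fun z hz => by
    simp only [hg.amplitude_eq_one hz, one_mul, leadingIntegrand]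
  obtain ⟨h1, h2, c, hc0, hc⟩ := hg.isLaplaceData.exists_hasAsymptotics (m := m) (k := d - m)
    (r := r) hg.contDiffOn_phase (hg.contDiffOn_amplitude.of_le (by norm_cast; omega))
    (fun z hz => hg.phase_nonneg hz) hg.isCompact_maxSet
    (fun z hz => (hg.phase_eq_zero_iff (hg.maxSet_subset hz)).2 hz)
    (fun v hv => hg.hasNormalHessian_phase (by omega) hv (hu v hv) hmd (hrank v hv)) hM
  refine ⟨h1.congr_fun heq hms, c, ?_, hg, h2, hc⟩
  rw [hc0, setIntegral_congr_fun hms heq]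

end Chaos


/-! ### Coefficients as functions of the jets -/

section Chaos

variable {d : ℕ} {α : ℝ}

/-- The coefficients of `gammaTail q V` in terms of the coefficients of `V`. -/
noncomputable def gammaTailCoeff (r : ℕ) (q : ℝ) (c : ℕ → ℝ) : ℕ → ℝ :=
  (exists_hasAsymptotics_gammaTail r q c).choose

theorem gammaTailCoeff_zero (r : ℕ) (q : ℝ) (c : ℕ → ℝ) : gammaTailCoeff r q c 0 = c 0 :=
  (exists_hasAsymptotics_gammaTail r q c).choose_spec.1

theorem HasAsymptotics.gammaTail {r : ℕ} {q : ℝ} {c : ℕ → ℝ} {V : ℝ → ℝ}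
    (h : HasAsymptotics r c V)
    (hV : IntegrableOn (fun w => w ^ q * Real.exp (-(w / 2)) / 2 * V w) (Set.Ioi 1)) :
    HasAsymptotics r (gammaTailCoeff r q c) (gammaTail q V) :=
  (exists_hasAsymptotics_gammaTail r q c).choose_spec.2 V hV h

open Classical in
/-- The asymptotic coefficients of the Laplace integral of the functions with given order, maximum
on the sphere and jets of the angular function at the maximum points. -/
noncomputable def laplaceCoeff (m r : ℕ) (α G : ℝ) (J : Set (Jet d (2 * r + 2))) : ℕ → ℝ :=
  if h : ∃ c, ∃ g : E d → ℝ, HasLaplaceExpansion m r g α c ∧ sphereMax g = G ∧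
    angularJets (2 * r + 2) g = J then h.choose else 0

/-- The chosen coefficients may belong to another function with the same order, maximum and jets; by
`congr_of_angularJets_eq` they serve for `g` all the same. -/
theorem HasLaplaceExpansion.laplaceCoeff {m r : ℕ} {g : E d → ℝ} {c : ℕ → ℝ}
    (h : HasLaplaceExpansion m r g α c) : HasLaplaceExpansion m r g α
      (laplaceCoeff m r α (sphereMax g) (angularJets (2 * r + 2) g)) := by
  have hex : ∃ c, ∃ g' : E d → ℝ, HasLaplaceExpansion m r g' α c ∧ sphereMax g' = sphereMax g ∧
    angularJets (2 * r + 2) g' = angularJets (2 * r + 2) g := ⟨c, g, h, rfl, rfl⟩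
  rw [GaussianChaos.laplaceCoeff, dif_pos hex]
  obtain ⟨g', h', hG, hJ⟩ := hex.choose_spec
  exact h'.congr_of_angularJets_eq h hG hJ

theorem gaussianConst_mul_eq {m : ℕ} (hm : m ≤ d) (I : ℝ) :
    gaussianConst d * ((2 * Real.pi) ^ (((d - m : ℕ) : ℝ) / 2) * I) =
      1 / (2 * Real.pi) ^ (((m : ℝ) + 1) / 2) * I := by
  have h2 : 0 < 2 * Real.pi := by positivity
  rw [gaussianConst, ← mul_assoc, ← Real.rpow_add h2, one_div, ← Real.rpow_neg h2.le,
    Nat.cast_sub hm]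
  congr 2
  ring

namespace HasLaplaceExpansion

variable {m r : ℕ} {g : E d → ℝ} {c : ℕ → ℝ} (h : HasLaplaceExpansion m r g α c)

include h

theorem hasChaosExpansion_density (hm : m ≤ d) :
    HasChaosExpansion (chaosDensityOffZero g α) α (sphereMax g) (((m : ℝ) + 1) / α - 1) r
      (gaussianConst d / (α * sphereMax g) * c 0)
      fun i => gaussianConst d / (α * sphereMax g) * c i * sphereMax g ^ (2 * (i : ℝ) / α) := by
  refine (h.hasAsymptotics.const_mul (gaussianConst d / (α * sphereMax g))).hasChaosExpansion
    h.regular.order_pos h.regular.sphereMax_pos ?_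
  filter_upwards [eventually_gt_atTop 0] with x hx
  rw [chaosDensityOffZero, if_pos hx, h.regular.chaosDensity_eq_laplaceIntegral hm hx]

/-- The tail is `gaussianConst d` times a power, an exponential and `gammaTail` of the Laplace
integral. Since `gammaTailCoeff` is fixed before the function is given, its coefficients depend on
`c` only. -/
theorem hasChaosExpansion_tail (hm : m ≤ d) {T : ℝ → ℝ}
    (hT : ∀ x, 0 < x → IntegrableOn (chaosDensity g α) (Set.Ioi x) ∧
      T x = ∫ y in Set.Ioi x, chaosDensity g α y) :
    HasChaosExpansion T α (sphereMax g) (((m : ℝ) - 1) / α) r (gaussianConst d * c 0)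
      fun i => gaussianConst d * gammaTailCoeff r (((m : ℝ) - 1) / 2) c i *
        sphereMax g ^ (2 * (i : ℝ) / α) := by
  have hα := h.regular.order_pos
  have hG := h.regular.sphereMax_pos
  have hint := h.regular.integrableOn_mul_laplaceIntegral hm one_pos (hT _ (by positivity)).1
  have h1 := ((h.hasAsymptotics.gammaTail hint).const_mul (gaussianConst d)).hasChaosExpansion
    (F := T) (β := ((m : ℝ) - 1) / α) hα hG ?_
  · simpa only [Pi.smul_apply, smul_eq_mul, gammaTailCoeff_zero] using h1
  filter_upwards [eventually_gt_atTop 0] with x hx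
  rw [(hT x hx).2, GaussianChaos.gammaTail]
  set s := x / sphereMax g with hs
  have hs0 : 0 < s := div_pos hx hG
  have e1 : sphereMax g * (s ^ (2 / α)) ^ (α / 2) = x := by
    rw [← Real.rpow_mul hs0.le, show 2 / α * (α / 2) = 1 by field_simp, Real.rpow_one, hs]
    field_simp
  have e2 : s ^ (((m : ℝ) - 1) / α) * (s ^ (2 / α)) ^ (-(((m : ℝ) - 1) / 2)) = 1 := by
    rw [← Real.rpow_mul hs0.le, ← Real.rpow_add hs0, ← Real.rpow_zero s]
    congr 1
    field_simp
    ring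
  have e3 : Real.exp (-s ^ (2 / α) / 2) * Real.exp (s ^ (2 / α) / 2) = 1 := by
    rw [← Real.exp_add, neg_div, neg_add_cancel, Real.exp_zero]
  have h2 := h.regular.integral_chaosDensity_eq hm (l := s ^ (2 / α)) (by positivity)
  rw [e1] at h2
  rw [h2]
  set I := ∫ w in Set.Ioi (s ^ (2 / α)), w ^ (((m : ℝ) - 1) / 2) * Real.exp (-(w / 2)) / 2 *
    laplaceIntegral m g α w
  linear_combination -(gaussianConst d * I) * e2 - gaussianConst d * I *
    (s ^ (((m : ℝ) - 1) / α) * (s ^ (2 / α)) ^ (-(((m : ℝ) - 1) / 2))) * e3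

end HasLaplaceExpansion

end Chaos

end GaussianChaos

/-! ### The main theorem -/

open GaussianChaos in
theorem theorem2 (d m r : ℕ) (hm : 1 ≤ m) (hmd : m ≤ d - 2) :
    -- the coefficients `h₁, …, h_r` as functions of `α`, `ĝ` and the derivatives of the angular
    -- function of `g` on the set of maximum points
    ∃ h : ℝ → ℝ → Set (Jet d (2 * r + 2)) → ℕ → ℝ,
      ∀ (α : ℝ), 0 < α →
      ∀ g : E d → ℝ, Homogeneous g α → (∃ v, 0 < g v) →
        ContDiffOn ℝ (2 * r + 2 : ℕ) g {0}ᶜ →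
        IsSubmanifold (2 * r + 2) m (maxSet g) →
      ∀ u : E d → Fin (d - 1) → E d, (∀ v ∈ maxSet g, IsTangentFrame v (u v)) →
        (∀ v ∈ maxSet g, (matA g α v (u v)).rank = d - 1 - m) →
      ∀ (Ω : Type*) [MeasurableSpace Ω] (P : Measure Ω) [IsProbabilityMeasure P] (η : Ω → E d),
        (∀ i, HasLaw (fun ω => η ω i) (gaussianReal 0 1) P) →
        iIndepFun (fun i ω => η ω i) P →
      IntegrableOn (leadingIntegrand g α u) (maxSet g) μHE[m] ∧
      HasChaosExpansion (fun x => P.real {ω | x < g (η ω)}) α (sphereMax g) (((m : ℝ) - 1) / α) r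
        (leadingConst g α m u) (h α (sphereMax g) (angularJets (2 * r + 2) g)) ∧
      ∃ p : ℝ → ℝ, IsDensityOffZero P (fun ω => g (η ω)) p ∧
        ∃ h' : ℕ → ℝ,
          HasChaosExpansion p α (sphereMax g) (((m : ℝ) + 1) / α - 1) r
            (leadingConst g α m u / (α * sphereMax g)) h' := by
  refine ⟨fun α G J i => gaussianConst d *
    gammaTailCoeff r (((m : ℝ) - 1) / 2) (laplaceCoeff m r α G J) i * G ^ (2 * (i : ℝ) / α), ?_⟩
  intro α hα g hh hpos hgc hM u hu hrank Ω _ P _ η hη hind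
  have hg : IsRegularHomogeneous (2 * r + 2) g α := ⟨hα, hh, hpos, hgc⟩
  -- Subtraction is truncated, but `1 ≤ m ≤ d - 2` forces `d ≥ 3`.
  have hmd' : m ≤ d := by omega
  obtain ⟨hint, c, hc0, hc⟩ := hg.exists_hasLaplaceExpansion (by omega) hM hu hrank
  have hc' := hc.laplaceCoeff
  -- Two coefficient sequences are in play: `c`, whose leading term is known explicitly, and the
  -- chosen one, which depends on the jets only. Their leading terms agree, both being the limit of
  -- the Laplace integral.
  have hzero := hc'.hasAsymptotics.coeff_zero_unique hc.hasAsymptotics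
  have hlead : gaussianConst d * c 0 = leadingConst g α m u := by
    rw [hc0, gaussianConst_mul_eq hmd', leadingConst]
  have hdens := isDensityOffZero hg.measurable hα hg.dim_pos hh hη hind
  have hX : AEMeasurable (fun ω => g (η ω)) P :=
    hg.measurable.comp_aemeasurable (map_eq_withDensity hη hind).1
  have hexp := hc.hasChaosExpansion_density hmd'
  rw [div_mul_eq_mul_div, hlead] at hexp
  refine ⟨hint, ?_, chaosDensityOffZero g α, hdens, _, hexp⟩
  have htail := hc'.hasChaosExpansion_tail hmd' (T := fun x => P.real {ω | x < g (η ω)})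
    fun x hx => ?_
  · rwa [hzero, hlead] at htail
  have heq : Set.EqOn (chaosDensityOffZero g α) (chaosDensity g α) (Set.Ioi x) := fun y hy =>
    if_pos (hx.trans hy)
  obtain ⟨h2, h3⟩ := hdens.integrableOn_and_tail_eq hX hx.le
  exact ⟨h2.congr_fun heq measurableSet_Ioi,
    h3.trans (setIntegral_congr_fun measurableSet_Ioi heq)⟩
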